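/- A Gaussian entire function (G.E.F.) is a random function of the form $f(z)=\sum_{k\ge 0}\zeta_k\frac{z^k}{\sqrt{k!}}$, where the $\zeta_k$ are independent standard complex Gaussian random variables (with density $\frac1\pi e^{-|w|^2}$ on $\mathbb C$); the series converges for all $z\in\mathbb C$ almost surely. For an oriented curve $\gamma$, let $\Delta_\gamma\arg f$ be the increment of the argument of $f$ along $\gamma$ (defined when $f$ has no zeros on $\gamma$), and let $\delta(f,\gamma)=\Delta_\gamma\arg f-\mathbb E\,\Delta_\gamma\arg f$. Arcs of the circle $R\mathbb T=\{|z|=R\}$ are oriented counterclockwise. There exist absolute constants $b_2>0$ and $R_0>0$ such that the following holds for all $R\ge R_0$, all $r$ with $1\le r\le 2$ and all $\Lambda$ with $3R^{1/2}\le\Lambda\le R$. Let $\{I_j\}$ be a finite collection of disjoint arcs of length $r$ of the circle $R\mathbb T$ that are separated by arcs of length at least $\log R$, let $w_j$ be the centre (midpoint) of $I_j$, and let $\widetilde{I_j}=I_j-w_j$. Let $f$ be a G.E.F. on a probability space. Then there exists, on the same probability space, a collection of independent G.E.F.s $\{f_j\}$ such that $$\Pr\Big\{\Big|\sum_j\delta(f,I_j)-\sum_j\delta(f_j,\widetilde{I_j})\Big|\ge\Lambda\Big\}\le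 e^{-b_2\Lambda}.$$ (All the deviations here are well defined: almost surely $f$ has no zeros on $I_j$ and $f_j$ has no zeros on $\widetilde{I_j}$, and $\Delta_{I_j}\arg f$ and $\Delta_{\widetilde{I_j}}\arg f_j$ are integrable.) -/

import Mathlib

open MeasureTheory ProbabilityTheory Set
open scoped ENNReal

/-- The standard complex Gaussian law: density `π⁻¹ exp (-|w|²)` with respect to Lebesgue measure
on the complex plane. -/
noncomputable def stdComplexGaussian : Measure ℂ :=
  (volume : Measure ℂ).withDensity
    (fun w => ENNReal.ofReal (Real.pi⁻¹ * Real.exp (-‖w‖ ^ 2)))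

/-- `F` is a Gaussian entire function on the probability space `(Ω, μ)`: almost surely
`F ω z = ∑ ζ_k(ω) z ^ k / √(k!)` for all `z`, where the `ζ_k` are independent standard complex
Gaussian random variables. -/
def IsGEF {Ω : Type*} [MeasurableSpace Ω] (μ : Measure Ω) (F : Ω → ℂ → ℂ) : Prop :=
  ∃ ζ : ℕ → Ω → ℂ,
    (∀ k, HasLaw (ζ k) stdComplexGaussian μ) ∧
    iIndepFun ζ μ ∧
    ∀ᵐ ω ∂μ, ∀ z : ℂ,
      HasSum (fun k : ℕ => ζ k ω * (z ^ k / ((Real.sqrt (k.factorial : ℝ) : ℝ) : ℂ))) (F ω z)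

/-- `θ` is a continuous branch on `[a, b]` of the argument of the nonvanishing function `h`. -/
def IsArgBranch (h : ℝ → ℂ) (a b : ℝ) (θ : ℝ → ℝ) : Prop :=
  ContinuousOn θ (Icc a b) ∧
    ∀ t ∈ Icc a b, h t ≠ 0 ∧ h t = (‖h t‖ : ℂ) * Complex.exp ((θ t : ℂ) * Complex.I)

open Classical in
/-- The increment over `[a, b]` of the argument of a continuous nonvanishing function `h`
(it does not depend on the branch, see `argIncrement_eq`; the value is `0` when there is no
continuous branch, for instance when `h` has a zero on `[a, b]`). -/
noncomputable def argIncrement (h : ℝ → ℂ) (a b : ℝ) : ℝ :=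
  if H : ∃ θ : ℝ → ℝ, IsArgBranch h a b θ then H.choose b - H.choose a else 0

/-- The increment of the argument may be computed with any continuous branch. -/
theorem argIncrement_eq {h : ℝ → ℂ} {a b : ℝ} (hab : a ≤ b) {θ : ℝ → ℝ}
    (hθ : IsArgBranch h a b θ) : argIncrement h a b = θ b - θ a := by
  have H : ∃ θ : ℝ → ℝ, IsArgBranch h a b θ := ⟨θ, hθ⟩
  rw [argIncrement, dif_pos H]
  obtain ⟨hc, hv⟩ := H.choose_spec
  set φ := H.choose
  have hpi : (2 * Real.pi) ≠ 0 := by positivity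
  have hmem : ∀ t ∈ Icc a b, ∃ n : ℤ, (n : ℝ) = (φ t - θ t) / (2 * Real.pi) := by
    intro t ht
    have h0 := (hv t ht).1
    have h1 := (hv t ht).2
    have h2 := (hθ.2 t ht).2
    have hn : (‖h t‖ : ℂ) ≠ 0 := by simpa using h0
    have h3 : Complex.exp ((φ t : ℂ) * Complex.I) = Complex.exp ((θ t : ℂ) * Complex.I) :=
      mul_left_cancel₀ hn (h1.symm.trans h2)
    obtain ⟨n, hn'⟩ := Complex.exp_eq_exp_iff_exists_int.1 h3
    refine ⟨n, ?_⟩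
    have h4 : (φ t : ℂ) = θ t + n * (2 * Real.pi) := by
      apply mul_right_cancel₀ Complex.I_ne_zero
      rw [hn']; ring
    have h5 : φ t = θ t + n * (2 * Real.pi) := by exact_mod_cast h4
    rw [h5]; field_simp; ring
  choose! m hm using hmem
  have hcont : ContinuousOn m (Icc a b) := by
    rw [Int.isClosedEmbedding_coe_real.isInducing.continuousOn_iff]
    exact ((hc.sub hθ.1).div_const (2 * Real.pi)).congr hm
  have hconst : m a = m b :=
    isPreconnected_Icc.constant hcont (left_mem_Icc.2 hab) (right_mem_Icc.2 hab)
  have h6 := (hm a (left_mem_Icc.2 hab)).symm.trans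
    ((congrArg (Int.cast : ℤ → ℝ) hconst).trans (hm b (right_mem_Icc.2 hab)))
  have h7 : φ a - θ a = φ b - θ b := (div_left_inj' hpi).1 h6
  linarith

/-- A continuous nonvanishing function has a continuous branch of the argument. -/
theorem exists_isArgBranch {h : ℝ → ℂ} {a b : ℝ} (hab : a ≤ b)
    (hc : ContinuousOn h (Icc a b)) (h0 : ∀ t ∈ Icc a b, h t ≠ 0) :
    ∃ θ : ℝ → ℝ, IsArgBranch h a b θ := by
  have hc' : Continuous (IccExtend hab ((Icc a b).domRestrict h)) :=
    (continuousOn_iff_continuous_domRestrict.1 hc).Icc_extend'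
  obtain ⟨f, hf, hfe⟩ := Complex.exists_continuousOn_eqOn_exp_comp (U := (univ : Set ℝ))
    (Homeomorph.Set.univ ℝ).toHomotopyEquiv.simplyConnectedSpace isOpen_univ
    (g := IccExtend hab ((Icc a b).domRestrict h)) hc'.continuousOn (by
      rintro ⟨t, -, ht⟩
      exact h0 _ (projIcc a b hab t).2 ht)
  refine ⟨fun t => (f t).im, (Complex.continuous_im.comp_continuousOn hf).mono (subset_univ _),
    fun t ht => ⟨h0 t ht, ?_⟩⟩
  have h1 : Complex.exp (f t) = h t := by
    have := hfe (mem_univ t)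
    rw [IccExtend_of_mem hab _ ht] at this
    exact this
  rw [← h1, Complex.norm_exp, Complex.ofReal_exp, ← Complex.exp_add, Complex.re_add_im]

/-- `Δ_γ arg F(ω)`, for a random function `F` and the curve `γ` parametrized by `[a, b]`. -/
noncomputable def curveArgIncrement {Ω : Type*} (F : Ω → ℂ → ℂ) (γ : ℝ → ℂ) (a b : ℝ) (ω : Ω) :
    ℝ :=
  argIncrement (fun t => F ω (γ t)) a b

/-- `δ(F, γ) = Δ_γ arg F - 𝔼 Δ_γ arg F`. -/
noncomputable def argDeviation {Ω : Type*} [MeasurableSpace Ω] (μ : Measure Ω)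
    (F : Ω → ℂ → ℂ) (γ : ℝ → ℂ) (a b : ℝ) (ω : Ω) : ℝ :=
  curveArgIncrement F γ a b ω - ∫ ω', curveArgIncrement F γ a b ω' ∂μ

/-- The deviation `δ(F, γ)` makes sense: almost surely `F` has no zeros on the curve, and
`Δ_γ arg F` is integrable. -/
def HasArgDeviation {Ω : Type*} [MeasurableSpace Ω] (μ : Measure Ω)
    (F : Ω → ℂ → ℂ) (γ : ℝ → ℂ) (a b : ℝ) : Prop :=
  (∀ᵐ ω ∂μ, ∀ t ∈ Icc a b, F ω (γ t) ≠ 0) ∧ Integrable (curveArgIncrement F γ a b) μ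

/-- Counterclockwise parametrization by arc length of the circle of radius `R` about the origin,
starting from the point of polar angle `θ`. The arc of length `r` centred at `R exp (i θ)` is
the restriction to `[-r / 2, r / 2]`. -/
noncomputable def circleArc (R θ : ℝ) (s : ℝ) : ℂ :=
  (R : ℂ) * Complex.exp (((θ + s / R : ℝ) : ℂ) * Complex.I)

/-- The translate `I - w` of the arc by its centre `w = R exp (i θ)`. -/
noncomputable def centredArc (R θ : ℝ) (s : ℝ) : ℂ :=
  circleArc R θ s - circleArc R θ 0

/-- The arcs of length `r` of the circle of radius `R` centred at the polar angles `θ j` are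
separated by arcs of length at least `d`: going from a point of one of them to a point of
another one along the circle, in either direction (and with any number of turns, `m`), one has to
cover a length of at least `d`. -/
def ArcsSeparated {n : ℕ} (R r d : ℝ) (θ : Fin n → ℝ) : Prop :=
  ∀ j k, j ≠ k → ∀ s ∈ Icc (-(r / 2)) (r / 2), ∀ t ∈ Icc (-(r / 2)) (r / 2), ∀ m : ℤ,
    d ≤ |(R * θ j + s) - (R * θ k + t) + 2 * Real.pi * R * m|

/-!
The translate `T_j(z) = f (w_j + z) exp (- z w̄_j - |w_j|² / 2)` of a Gaussian entire function `f` is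
again a Gaussian entire function, and the increment of its argument along `I_j - w_j` differs from
the increment of the argument of `f` along `I_j` by a deterministic constant, so that both have the
same deviation from the mean. It remains to compare the dependent functions `T_j` with independent
ones.

*Coupling.* The covariance of `T_j(z)` and `T_k(z')` has absolute value
`exp ((|z|² + |z'|²) / 2 - |w_j + z - w_k - z'|² / 2)`. When the centres are at a distance of order
`log R`, this is smaller than any power of `R`, and it beats even the factorials that enter when one
passes to the first `N ≈ 56 log R` normalized Taylor coefficients. These coefficients, for all `j`
together, thus form an almost orthonormal system in the Gaussian space of `f`
(`displacedCoeff_almost_orthonormal`). The Gram-Schmidt process (`exists_orthonormal_near`) makes it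
orthonormal, and completing it by unused coefficients of `f` one gets independent Gaussian entire
functions `g_j` with `|T_j - g_j| ≤ R⁻²²` on a disc, except on an event of probability at most
`exp (-R)` (`eventually_exists_coupling`, `Coupling.exists_coupledFamily`).

*One arc.* If `|g_j| ≥ 2 R⁻²⁰` on the arc, then the increments of the arguments of `T_j` and `g_j`
differ by at most `2 R⁻²` (`abs_argIncrement_sub_le`). Otherwise, which happens with probability at
most `R⁻¹⁷` (`IsStdFamily.measure_nearZero_le`), Jensen's formula bounds both increments by a
logarithm of (maximum of the function) / (value at the centre)
(`abs_argIncrement_centredArc_le_log_add`). This gives integrability, and shows that the means of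
the increments differ by at most `1 / R` (`CoupledFamily.abs_integral_sub_le`).

*All arcs.* There are at most `8 R` arcs, so the good arcs and the means contribute `O(1)`. A small
exponential moment of the contribution of the bad arcs is bounded by the mean of a product over `j`
of functions of `g_j` and of `|T_j(0)|⁻¹`. By the inequality between the arithmetic and the geometric
mean (`prod_one_add_mul_le`) it is enough to bound separately the products of the functions of `g_j`,
which are independent, and the products of the functions of `|T_j(0)|⁻¹`. The latter are not
independent, but `T_j(0)` is a multiple of `g_j(0)` plus a variable that does not involve
`g_j(0), g_{j+1}(0), …`, and `|b + s w|⁻¹` has a bounded mean uniformly in the shift `b`; hence one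
may integrate over the `g_j(0)` one after the other (`IsStdFamily.lintegral_prod_triangular_le`).
Chebyshev's inequality finishes the proof (`CoupledFamily.measure_sum_ge_le`).
-/

/-! ### The standard complex Gaussian law -/

theorem charFun_stdComplexGaussian (t : ℂ) :
    charFun stdComplexGaussian t = Complex.exp (-((‖t‖ ^ 2 / 4 : ℝ) : ℂ)) := by
  rw [charFun_apply, stdComplexGaussian]
  have hm : Measurable fun w : ℂ => Real.toNNReal (Real.pi⁻¹ * Real.exp (-‖w‖ ^ 2)) := by
    fun_prop
  have : (fun w : ℂ => ENNReal.ofReal (Real.pi⁻¹ * Real.exp (-‖w‖ ^ 2))) =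
      fun w : ℂ => ((Real.toNNReal (Real.pi⁻¹ * Real.exp (-‖w‖ ^ 2)) : NNReal) : ℝ≥0∞) := rfl
  rw [this, integral_withDensity_eq_integral_smul hm]
  have h1 := GaussianFourier.integral_cexp_neg_mul_sq_norm_add (V := ℂ) (b := 1) (by simp)
    Complex.I t
  have h2 : ∀ w : ℂ, Real.toNNReal (Real.pi⁻¹ * Real.exp (-‖w‖ ^ 2)) •
      Complex.exp ((inner ℝ w t : ℝ) * Complex.I) =
      (Real.pi : ℂ)⁻¹ * Complex.exp (-1 * (‖w‖ : ℂ) ^ 2 + Complex.I * (inner ℝ t w : ℝ)) := by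
    intro w
    rw [NNReal.smul_def, Real.coe_toNNReal _ (by positivity), Complex.real_smul, Complex.exp_add,
      real_inner_comm]
    push_cast
    ring_nf
  simp_rw [h2]
  rw [integral_const_mul, h1]
  have hpi : (Real.pi : ℂ) ≠ 0 := by exact_mod_cast Real.pi_ne_zero
  simp only [Complex.finrank_real_complex, div_one, Nat.cast_ofNat, div_self (two_ne_zero' ℂ),
    Complex.cpow_one]
  rw [← mul_assoc, inv_mul_cancel₀ hpi, one_mul]
  congr 1
  rw [Complex.I_sq]
  push_cast
  ring

theorem lintegral_exp_half_sq_stdComplexGaussian :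
    ∫⁻ w, ENNReal.ofReal (Real.exp (‖w‖ ^ 2 / 2)) ∂stdComplexGaussian = 2 := by
  rw [stdComplexGaussian, lintegral_withDensity_eq_lintegral_mul _ (by fun_prop) (by fun_prop)]
  have h1 := GaussianFourier.integral_rexp_neg_mul_sq_norm (V := ℂ) (b := 1 / 2) (by norm_num)
  have h2 : ∀ w : ℂ, ((fun w : ℂ => ENNReal.ofReal (Real.pi⁻¹ * Real.exp (-‖w‖ ^ 2))) *
      fun w : ℂ => ENNReal.ofReal (Real.exp (‖w‖ ^ 2 / 2))) w =
      ENNReal.ofReal (Real.pi⁻¹ * Real.exp (-(1 / 2) * ‖w‖ ^ 2)) := by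
    intro w
    simp only [Pi.mul_apply]
    rw [← ENNReal.ofReal_mul (by positivity), mul_assoc, ← Real.exp_add]
    ring_nf
  simp_rw [h2]
  have hint : Integrable fun w : ℂ => Real.exp (-(1 / 2) * ‖w‖ ^ 2) :=
    .of_integral_ne_zero (by rw [h1]; positivity)
  rw [← ofReal_integral_eq_lintegral_ofReal (hint.const_mul _)
    (Filter.Eventually.of_forall fun w => by positivity), integral_const_mul, h1]
  have : Real.pi⁻¹ * (Real.pi / (1 / 2)) ^ ((Module.finrank ℝ ℂ : ℝ) / 2) = 2 := by
    simp only [Complex.finrank_real_complex, Nat.cast_ofNat, div_self (two_ne_zero' ℝ),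
      Real.rpow_one]
    field_simp
  rw [this]; simp

instance isProbabilityMeasure_stdComplexGaussian : IsProbabilityMeasure stdComplexGaussian := by
  refine ⟨?_⟩
  rw [stdComplexGaussian, withDensity_apply _ MeasurableSet.univ, Measure.restrict_univ]
  have h1 := GaussianFourier.integral_rexp_neg_mul_sq_norm (V := ℂ) (b := 1) (by norm_num)
  have hint : Integrable fun w : ℂ => Real.exp (-1 * ‖w‖ ^ 2) :=
    .of_integral_ne_zero (by rw [h1]; positivity)
  have h2 : ∀ w : ℂ, -‖w‖ ^ 2 = -1 * ‖w‖ ^ 2 := fun w => by ring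
  simp_rw [h2]
  rw [← ofReal_integral_eq_lintegral_ofReal (hint.const_mul _)
    (Filter.Eventually.of_forall fun w => by positivity), integral_const_mul, h1]
  have : Real.pi⁻¹ * (Real.pi / 1) ^ ((Module.finrank ℝ ℂ : ℝ) / 2) = 1 := by
    simp only [Complex.finrank_real_complex, Nat.cast_ofNat, div_self (two_ne_zero' ℝ),
      Real.rpow_one]
    field_simp
  rw [this]; simp

/-- The density of the standard complex Gaussian law is at most `1 / π`. -/
theorem stdComplexGaussian_closedBall_le (c : ℂ) {x : ℝ} (hx : 0 ≤ x) :
    stdComplexGaussian (Metric.closedBall c x) ≤ ENNReal.ofReal (x ^ 2) := by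
  rw [stdComplexGaussian, withDensity_apply _ measurableSet_closedBall]
  calc _ ≤ ∫⁻ w in Metric.closedBall c x, ENNReal.ofReal Real.pi⁻¹ := by
        refine lintegral_mono fun w => ENNReal.ofReal_le_ofReal ?_
        have : Real.exp (-‖w‖ ^ 2) ≤ 1 := Real.exp_le_one_iff.2 (by nlinarith [sq_nonneg ‖w‖])
        have hp : 0 < Real.pi⁻¹ := by positivity
        nlinarith
    _ = ENNReal.ofReal (x ^ 2) := by
        rw [lintegral_const, Measure.restrict_apply_univ, Complex.volume_closedBall,
          ENNReal.ofReal_pow hx, ← ENNReal.ofReal_coe_nnreal, NNReal.coe_real_pi, mul_comm, mul_assoc,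
          ← ENNReal.ofReal_mul (by positivity), mul_inv_cancel₀ Real.pi_ne_zero]
        simp

/-- Small ball estimate for an affine function of a Gaussian variable, uniform in the shift. -/
theorem stdComplexGaussian_shift_le (b s : ℂ) (hs : 1 / 2 ≤ ‖s‖) {x : ℝ} (hx : 0 ≤ x) :
    stdComplexGaussian {w | ‖b + s * w‖ ≤ x} ≤ ENNReal.ofReal (4 * x ^ 2) := by
  have hs0 : s ≠ 0 := by
    rintro rfl; norm_num at hs
  have hsub : {w : ℂ | ‖b + s * w‖ ≤ x} ⊆ Metric.closedBall (-b / s) (2 * x) := by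
    intro w hw
    simp only [mem_ofPred_eq] at hw
    rw [Metric.mem_closedBall, dist_eq_norm]
    have h : b + s * w = s * (w - -b / s) := by field_simp; ring
    rw [h, norm_mul] at hw
    nlinarith [norm_nonneg (w - -b / s)]
  refine (measure_mono hsub).trans ((stdComplexGaussian_closedBall_le _ (by positivity)).trans ?_)
  apply ENNReal.ofReal_le_ofReal; nlinarith

/-- The inverse of the absolute value is locally integrable in the plane, so that the mean is bounded
uniformly in the shift. -/
theorem lintegral_inv_norm_shift_le (b s : ℂ) (hs : 1 / 2 ≤ ‖s‖) :
    ∫⁻ w, ENNReal.ofReal (‖b + s * w‖⁻¹) ∂stdComplexGaussian ≤ 17 := by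
  -- dyadic decomposition according to the size of `‖b + s w‖`
  have key : ∀ y : ℝ, 0 ≤ y → ENNReal.ofReal y⁻¹ ≤
      1 + ∑' i : ℕ, (2 : ℝ≥0∞) ^ (i + 1) * (if y ≤ (1 / 2 : ℝ) ^ i then 1 else 0) := by
    intro y hy
    rcases hy.eq_or_lt with rfl | hy
    · simp
    rcases le_or_gt 1 y with h1 | h1
    · refine le_trans ?_ le_self_add
      rw [← ENNReal.ofReal_one]
      exact ENNReal.ofReal_le_ofReal (inv_le_one_of_one_le₀ h1)
    · obtain ⟨i, hi1, hi2⟩ := exists_nat_pow_near_of_lt_one hy h1.le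
        (by norm_num : (0 : ℝ) < 1 / 2) (by norm_num)
      refine le_trans ?_ le_add_self
      refine le_trans ?_ (ENNReal.le_tsum i)
      rw [if_pos hi2, mul_one]
      have : (2 : ℝ≥0∞) ^ (i + 1) = ENNReal.ofReal (2 ^ (i + 1)) := by
        rw [ENNReal.ofReal_pow (by norm_num)]; simp
      rw [this]
      apply ENNReal.ofReal_le_ofReal
      rw [inv_le_comm₀ hy (by positivity)]
      calc ((2 : ℝ) ^ (i + 1))⁻¹ = (1 / 2) ^ (i + 1) := by simp
        _ ≤ y := hi1.le
  calc _ ≤ ∫⁻ w, (1 + ∑' i : ℕ, (2 : ℝ≥0∞) ^ (i + 1) *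
        (if ‖b + s * w‖ ≤ (1 / 2 : ℝ) ^ i then 1 else 0)) ∂stdComplexGaussian :=
        lintegral_mono fun w => key _ (norm_nonneg _)
    _ = 1 + ∑' i : ℕ, (2 : ℝ≥0∞) ^ (i + 1) *
        stdComplexGaussian {w | ‖b + s * w‖ ≤ (1 / 2 : ℝ) ^ i} := by
        have hms : ∀ i : ℕ, MeasurableSet {w : ℂ | ‖b + s * w‖ ≤ (1 / 2 : ℝ) ^ i} :=
          fun i => measurableSet_le (by fun_prop) (by fun_prop)
        have hmf : ∀ i : ℕ, Measurable fun w : ℂ =>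
            (if ‖b + s * w‖ ≤ (1 / 2 : ℝ) ^ i then (1 : ℝ≥0∞) else 0) :=
          fun i => Measurable.ite (hms i) measurable_const measurable_const
        rw [lintegral_add_left measurable_const, lintegral_const, measure_univ, mul_one,
          lintegral_tsum (fun i => ((hmf i).const_mul _).aemeasurable)]
        congr 2
        ext i
        rw [lintegral_const_mul _ (hmf i)]
        congr 1
        rw [← lintegral_indicator_one (hms i)]
        rfl
    _ ≤ 1 + ∑' i : ℕ, 8 * (2⁻¹ : ℝ≥0∞) ^ i := by
        refine add_le_add le_rfl (ENNReal.tsum_le_tsum fun i => ?_)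
        refine (mul_le_mul_right (stdComplexGaussian_shift_le b s hs (by positivity)) _).trans ?_
        have : (2 : ℝ≥0∞) ^ (i + 1) = ENNReal.ofReal (2 ^ (i + 1)) := by
          rw [ENNReal.ofReal_pow (by norm_num)]; simp
        have h3 : 8 * (2⁻¹ : ℝ≥0∞) ^ i = ENNReal.ofReal (8 * (1 / 2) ^ i) := by
          rw [ENNReal.ofReal_mul (by norm_num), ENNReal.ofReal_pow (by norm_num),
            one_div, ENNReal.ofReal_inv_of_pos (by norm_num)]
          simp
        rw [this, h3, ← ENNReal.ofReal_mul (by positivity)]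
        apply ENNReal.ofReal_le_ofReal
        apply le_of_eq
        have : (2 : ℝ) ^ i * (1 / 2) ^ i = 1 := by rw [← mul_pow]; norm_num
        calc (2 : ℝ) ^ (i + 1) * (4 * ((1 / 2) ^ i) ^ 2) =
            8 * (2 ^ i * (1 / 2) ^ i) * (1 / 2) ^ i := by ring
          _ = _ := by rw [this]; ring
    _ = 17 := by
        rw [ENNReal.tsum_mul_left, ENNReal.tsum_geometric, ENNReal.one_sub_inv_two, inv_inv]
        norm_num

/-- The Gaussian tail. The exponent `-t |t|` makes the bound trivially true for `t ≤ 0`. -/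
theorem stdComplexGaussian_norm_gt_le (t : ℝ) :
    stdComplexGaussian {w | t < ‖w‖} ≤ ENNReal.ofReal (2 * Real.exp (-t * |t| / 2)) := by
  have hm : ∀ w ∈ {w : ℂ | t < ‖w‖}, (1 : ℝ≥0∞) ≤ ENNReal.ofReal (Real.exp (-t * |t| / 2)) *
      ENNReal.ofReal (Real.exp (‖w‖ ^ 2 / 2)) := by
    intro w hw
    simp only [mem_ofPred_eq] at hw
    rw [← ENNReal.ofReal_mul (by positivity), ← Real.exp_add, ← ENNReal.ofReal_one]
    apply ENNReal.ofReal_le_ofReal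
    apply Real.one_le_exp
    rcases le_total 0 t with h | h
    · rw [abs_of_nonneg h]; nlinarith
    · rw [abs_of_nonpos h]; nlinarith [sq_nonneg ‖w‖, sq_nonneg t]
  have hms : MeasurableSet {w : ℂ | t < ‖w‖} := measurableSet_lt (by fun_prop) (by fun_prop)
  calc _ = ∫⁻ w in {w : ℂ | t < ‖w‖}, 1 ∂stdComplexGaussian := by simp
    _ ≤ ∫⁻ w in {w : ℂ | t < ‖w‖}, ENNReal.ofReal (Real.exp (-t * |t| / 2)) *
      ENNReal.ofReal (Real.exp (‖w‖ ^ 2 / 2)) ∂stdComplexGaussian :=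
        setLIntegral_mono (by fun_prop) hm
    _ ≤ ∫⁻ w, ENNReal.ofReal (Real.exp (-t * |t| / 2)) *
      ENNReal.ofReal (Real.exp (‖w‖ ^ 2 / 2)) ∂stdComplexGaussian := setLIntegral_le_lintegral _ _
    _ = _ := by
      rw [lintegral_const_mul _ (by fun_prop), lintegral_exp_half_sq_stdComplexGaussian,
        mul_comm 2, ENNReal.ofReal_mul (by positivity)]
      simp

theorem lintegral_norm_stdComplexGaussian_le :
    ∫⁻ w, ENNReal.ofReal ‖w‖ ∂stdComplexGaussian ≤ 2 := by
  rw [← lintegral_exp_half_sq_stdComplexGaussian]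
  refine lintegral_mono fun w => ENNReal.ofReal_le_ofReal ?_
  have := Real.add_one_le_exp (‖w‖ ^ 2 / 2)
  nlinarith [sq_nonneg (‖w‖ - 1)]

/-! ### Families of independent Gaussian variables -/

/-- A family of measurable independent standard complex Gaussian random variables. -/
structure IsStdFamily {Ω ι : Type*} [MeasurableSpace Ω] (μ : Measure Ω) (X : ι → Ω → ℂ) : Prop where
  measurable : ∀ i, Measurable (X i)
  map_eq : ∀ i, μ.map (X i) = stdComplexGaussian
  indep : iIndepFun X μ

/-- The combination `∑ e_m ζ_m` of the variables `ζ_m` with finitely many coefficients `e_m`. -/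
noncomputable def finComb {Ω : Type*} (ζ : ℕ → Ω → ℂ) (e : ℕ →₀ ℂ) (ω : Ω) : ℂ :=
  e.sum fun m c => c * ζ m ω

theorem finComb_eq_sum_range {Ω : Type*} (ζ : ℕ → Ω → ℂ) (e : ℕ →₀ ℂ) (ω : Ω) {d : ℕ}
    (hd : e.support ⊆ Finset.range d) : finComb ζ e ω = ∑ m ∈ Finset.range d, e m * ζ m ω := by
  rw [finComb, Finsupp.sum_of_support_subset _ hd _ (by simp)]

section
variable {Ω ι : Type*} [MeasurableSpace Ω] {μ : Measure Ω}

theorem measurable_finComb {ζ : ℕ → Ω → ℂ} (hζ : ∀ m, Measurable (ζ m)) (e : ℕ →₀ ℂ) :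
    Measurable (finComb ζ e) := by
  unfold finComb Finsupp.sum
  fun_prop

theorem IsStdFamily.isProbabilityMeasure {X : ι → Ω → ℂ} (h : IsStdFamily μ X) :
    IsProbabilityMeasure μ := h.indep.isProbabilityMeasure

/-- Finitely many orthonormal combinations of standard complex Gaussian variables have the standard
Gaussian law on `ℂ ^ ι`: their characteristic function is that of the original variables at a vector
of the same norm. -/
theorem map_finComb_eq_pi [Fintype ι] [DecidableEq ι] {ζ : ℕ → Ω → ℂ} (hζ : IsStdFamily μ ζ)
    (e : ι → ℕ →₀ ℂ)
    (he : ∀ i j, ((e i).sum fun m c => c * (starRingEnd ℂ) (e j m)) = if i = j then 1 else 0) :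
    μ.map (fun ω i => finComb ζ (e i) ω) = Measure.pi fun _ : ι => stdComplexGaussian := by
  have := hζ.isProbabilityMeasure
  have hmeas : ∀ i, Measurable (finComb ζ (e i)) := fun i => measurable_finComb hζ.measurable _
  have : IsProbabilityMeasure (μ.map (fun ω i => finComb ζ (e i) ω)) :=
    Measure.isProbabilityMeasure_map (by fun_prop)
  rw [← charFun_eq_pi_iff]
  intro t
  obtain ⟨d, hd⟩ : ∃ d, ∀ i, (e i).support ⊆ Finset.range d := by
    obtain ⟨d, hd⟩ := (Finset.univ.biUnion fun i => (e i).support).exists_nat_subset_range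
    exact ⟨d, fun i => (Finset.subset_biUnion_of_mem _ (Finset.mem_univ i)).trans hd⟩
  have hsub : iIndepFun (fun m : Fin d => ζ m) μ := hζ.indep.precomp Fin.val_injective
  have h1 := (iIndepFun_iff_charFun_pi (fun m : Fin d => (hζ.measurable m).aemeasurable)).1 hsub
    (WithLp.toLp 2 fun m : Fin d => ∑ i, (starRingEnd ℂ) (e i m) * t i)
  have h2 : charFun (μ.map fun ω => WithLp.toLp 2 fun m : Fin d => ζ m ω)
      (WithLp.toLp 2 fun m : Fin d => ∑ i, (starRingEnd ℂ) (e i m) * t i) =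
      charFun ((μ.map (fun ω i => finComb ζ (e i) ω)).map (WithLp.toLp 2)) t := by
    have := hζ.measurable
    rw [Measure.map_map (by fun_prop) (by fun_prop), charFun_apply, charFun_apply,
      integral_map (by fun_prop) (by fun_prop), integral_map (by fun_prop) (by fun_prop)]
    congr 1
    ext ω
    congr 3
    simp only [Function.comp, PiLp.inner_apply, finComb_eq_sum_range ζ _ ω (hd _)]
    refine (Finset.sum_congr rfl fun m _ => Complex.inner _ _).trans
      (Eq.trans ?_ (Finset.sum_congr rfl fun i _ => Complex.inner _ _).symm)
    simp only [← Complex.re_sum]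
    congr 1
    simp only [map_sum, map_mul, Finset.mul_sum, Finset.sum_mul, Finset.sum_range]
    rw [Finset.sum_comm]
    refine Finset.sum_congr rfl fun i _ => Finset.sum_congr rfl fun m _ => ?_
    ring
  rw [← h2, h1]
  simp only [hζ.map_eq, charFun_stdComplexGaussian, ← Complex.exp_sum]
  congr 1
  rw [Finset.sum_neg_distrib, Finset.sum_neg_distrib, ← Complex.ofReal_sum, ← Complex.ofReal_sum,
    ← Finset.sum_div, ← Finset.sum_div]
  congr 3
  -- Parseval's identity for the orthonormal family `e`
  apply Complex.ofReal_injective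
  push_cast
  simp only [← Complex.conj_mul']
  have h3 : ∀ i j, ∑ m : Fin d, e i m * (starRingEnd ℂ) (e j m) = if i = j then 1 else 0 := by
    intro i j
    rw [← he i j, Finsupp.sum_of_support_subset _ (hd i) _ (by simp), Finset.sum_range]
  calc ∑ m : Fin d, (starRingEnd ℂ) (∑ i, (starRingEnd ℂ) (e i m) * t i) *
        (∑ j, (starRingEnd ℂ) (e j m) * t j)
      = ∑ m : Fin d, ∑ i, ∑ j, (starRingEnd ℂ) (t i) * t j *
          (e i m * (starRingEnd ℂ) (e j m)) := by
        refine Finset.sum_congr rfl fun m _ => ?_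
        rw [map_sum, Finset.sum_mul_sum]
        refine Finset.sum_congr rfl fun i _ => Finset.sum_congr rfl fun j _ => ?_
        simp only [map_mul, Complex.conj_conj]
        ring
    _ = ∑ i, ∑ j, (starRingEnd ℂ) (t i) * t j *
          ∑ m : Fin d, (e i m * (starRingEnd ℂ) (e j m)) := by
        rw [Finset.sum_comm]
        refine Finset.sum_congr rfl fun i _ => ?_
        rw [Finset.sum_comm]
        simp only [Finset.mul_sum]
    _ = _ := by
        simp [h3]

/-- Orthonormal combinations of independent standard complex Gaussian variables are independent
standard complex Gaussian variables. -/
theorem IsStdFamily.finComb {ζ : ℕ → Ω → ℂ} (hζ : IsStdFamily μ ζ) (e : ι → ℕ →₀ ℂ)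
    [DecidableEq ι]
    (he : ∀ i j, ((e i).sum fun m c => c * (starRingEnd ℂ) (e j m)) = if i = j then 1 else 0) :
    IsStdFamily μ fun i => finComb ζ (e i) := by
  have := hζ.isProbabilityMeasure
  have hmeas : ∀ i, Measurable (_root_.finComb ζ (e i)) :=
    fun i => measurable_finComb hζ.measurable _
  have hfin : ∀ s : Finset ι, μ.map (fun ω (i : s) => _root_.finComb ζ (e i) ω) =
      Measure.pi fun _ : s => stdComplexGaussian := fun s =>
    map_finComb_eq_pi hζ (fun i : s => e i) fun i j => by rw [he]; simp only [Subtype.ext_iff]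
  have hmap : ∀ (s : Finset ι) (i : s),
      μ.map (_root_.finComb ζ (e i)) = stdComplexGaussian := by
    intro s i
    rw [← (measurePreserving_eval (fun _ : s => stdComplexGaussian) i).map_eq, ← hfin s,
      Measure.map_map (by fun_prop) (by fun_prop)]
    rfl
  refine ⟨hmeas, fun i => hmap {i} ⟨i, by simp⟩, ?_⟩
  rw [iIndepFun_iff_finset]
  intro s
  refine (iIndepFun_iff_map_fun_eq_pi_map (ι := s) (f := fun i : s => _root_.finComb ζ (e i))
    (fun i => (hmeas i).aemeasurable)).2 ?_
  exact (hfin s).trans (congrArg _ (funext fun i => (hmap s i).symm))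

theorem IsStdFamily.precomp {κ : Type*} {X : ι → Ω → ℂ} (h : IsStdFamily μ X) {g : κ → ι}
    (hg : Function.Injective g) : IsStdFamily μ fun k => X (g k) :=
  ⟨fun _ => h.measurable _, fun _ => h.map_eq _, h.indep.precomp hg⟩

theorem IsStdFamily.lintegral_comp {X : ι → Ω → ℂ} (h : IsStdFamily μ X) (i : ι) {ψ : ℂ → ℝ≥0∞}
    (hψ : Measurable ψ) : ∫⁻ ω, ψ (X i ω) ∂μ = ∫⁻ w, ψ w ∂stdComplexGaussian := by
  rw [← h.map_eq i, lintegral_map hψ (h.measurable i)]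

/-- Conditioning on the variables `X l`, `l ∈ S`: a bound uniform in the shift `b` for the mean of
`ψ (b + s w)` may be used when `b` and the weight `Z` depend only on these variables. -/
theorem IsStdFamily.lintegral_mul_shift_le {X : ι → Ω → ℂ} (h : IsStdFamily μ X) {i : ι}
    {S : Set ι} (hi : i ∉ S) {Z : Ω → ℝ≥0∞} {b : Ω → ℂ}
    (hZ : Measurable[⨆ l ∈ S, MeasurableSpace.comap (X l) inferInstance] Z)
    (hb : Measurable[⨆ l ∈ S, MeasurableSpace.comap (X l) inferInstance] b)
    {ψ : ℂ → ℝ≥0∞} (hψ : Measurable ψ) (s : ℂ) {C : ℝ≥0∞}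
    (hC : ∀ c, ∫⁻ w, ψ (c + s * w) ∂stdComplexGaussian ≤ C) :
    ∫⁻ ω, Z ω * ψ (b ω + s * X i ω) ∂μ ≤ C * ∫⁻ ω, Z ω ∂μ := by
  have := h.isProbabilityMeasure
  have hle : ∀ l, MeasurableSpace.comap (X l) inferInstance ≤ ‹MeasurableSpace Ω› :=
    fun l => (h.measurable l).comap_le
  have hle' : (⨆ l ∈ S, MeasurableSpace.comap (X l) inferInstance) ≤ ‹MeasurableSpace Ω› :=
    iSup₂_le fun l _ => hle l
  have hpair : Measurable[⨆ l ∈ S, MeasurableSpace.comap (X l) inferInstance]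
      fun ω => (Z ω, b ω) := hZ.prodMk hb
  have hind : IndepFun (fun ω => (Z ω, b ω)) (X i) μ := by
    rw [IndepFun_iff_Indep]
    have h1 := indep_iSup_of_disjoint hle h.indep.iIndep (S := S) (T := {i}) (by simpa using hi)
    simp only [mem_singleton_iff, iSup_iSup_eq_left] at h1
    exact indep_of_indep_of_le_left h1 hpair.comap_le
  have hpm : Measurable fun ω => (Z ω, b ω) := hpair.mono hle' le_rfl
  have hXm := h.measurable i
  have hjoint := (indepFun_iff_map_prod_eq_prod_map_map hpm.aemeasurable hXm.aemeasurable).1 hind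
  rw [h.map_eq i] at hjoint
  have := Measure.isProbabilityMeasure_map (μ := μ) hpm.aemeasurable
  have hF : Measurable fun p : (ℝ≥0∞ × ℂ) × ℂ => p.1.1 * ψ (p.1.2 + s * p.2) := by fun_prop
  calc ∫⁻ ω, Z ω * ψ (b ω + s * X i ω) ∂μ
      = ∫⁻ p, p.1.1 * ψ (p.1.2 + s * p.2) ∂(μ.map fun ω => ((Z ω, b ω), X i ω)) := by
        rw [lintegral_map hF (hpm.prodMk hXm)]
    _ = ∫⁻ q, ∫⁻ w, q.1 * ψ (q.2 + s * w) ∂stdComplexGaussian ∂(μ.map fun ω => (Z ω, b ω)) := by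
        rw [hjoint, lintegral_prod _ hF.aemeasurable]
    _ ≤ ∫⁻ q, C * q.1 ∂(μ.map fun ω => (Z ω, b ω)) := by
        refine lintegral_mono fun q => ?_
        rw [lintegral_const_mul _ (by fun_prop), mul_comm]
        gcongr
        exact hC q.2
    _ = C * ∫⁻ ω, Z ω ∂μ := by
        rw [lintegral_map (by fun_prop) hpm, lintegral_const_mul _ (hZ.mono hle' le_rfl)]

end

/-! ### Almost orthonormal families -/

/-- The Gram-Schmidt process moves an almost orthonormal family only a little: the projection of
`v a` on the span of the preceding vectors is small, because the Gram matrix is well conditioned.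
The second part records that the change of basis is triangular. -/
theorem exists_orthonormal_near {E : Type*} [NormedAddCommGroup E] [InnerProductSpace ℂ E] {M : ℕ}
    (v : Fin M → E) {ε : ℝ} (hε : 8 * M * ε ≤ 1)
    (hv : ∀ a b, ‖inner ℂ (v a) (v b) - if a = b then 1 else 0‖ ≤ ε) :
    ∃ e : Fin M → E, Orthonormal ℂ e ∧ ∀ a, ‖v a - e a‖ ≤ 5 * M * ε ∧
      ∃ c : Fin M → ℂ, v a = ∑ b, c b • e b ∧ (∀ b, a < b → c b = 0) ∧ 1 / 2 ≤ ‖c a‖ := by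
  set g := InnerProductSpace.gramSchmidt ℂ v with hg
  have hproj : ∀ a, ‖v a - g a‖ ≤ 2 * M * ε := by
    intro a
    have hM : (1 : ℝ) ≤ M := by
      have := a.pos
      exact_mod_cast this
    have hε0 : 0 ≤ ε := (norm_nonneg _).trans (hv a a)
    set u := v a - g a with hu
    have hdef := InnerProductSpace.gramSchmidt_def'' ℂ v a
    have hu' : u = ∑ i ∈ Finset.Iio a,
        (inner ℂ (g i) (v a) / (‖g i‖ : ℂ) ^ 2) • g i := by
      rw [hu]; nth_rewrite 1 [hdef]; rw [hg]; simp
    have hug : inner ℂ u (g a) = 0 := by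
      rw [hu', sum_inner]
      refine Finset.sum_eq_zero fun i hi => ?_
      rw [inner_smul_left, hg,
        InnerProductSpace.gramSchmidt_orthogonal ℂ v (Finset.mem_Iio.1 hi).ne, mul_zero]
    have humem : u ∈ Submodule.span ℂ (v '' ((Finset.Iio a : Finset (Fin M)) : Set (Fin M))) := by
      rw [Finset.coe_Iio, ← InnerProductSpace.span_gramSchmidt_Iio ℂ v a, hu']
      refine Submodule.sum_mem _ fun i hi => Submodule.smul_mem _ _ (Submodule.subset_span ?_)
      exact ⟨i, Finset.mem_Iio.1 hi, rfl⟩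
    obtain ⟨c, hc⟩ := Submodule.mem_span_image_finset_iff_exists_fun' ℂ |>.1 humem
    set S := ∑ b ∈ Finset.Iio a, ‖c b‖ with hS
    set Q := ∑ b ∈ Finset.Iio a, ‖c b‖ ^ 2 with hQ
    have hS0 : 0 ≤ S := Finset.sum_nonneg fun _ _ => norm_nonneg _
    have hQ0 : 0 ≤ Q := Finset.sum_nonneg fun _ _ => sq_nonneg _
    have hSQ : S ^ 2 ≤ M * Q := by
      refine (sq_sum_le_card_mul_sum_sq (s := Finset.Iio a) (f := fun b => ‖c b‖)).trans ?_
      gcongr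
      refine (Finset.card_le_univ _).trans (by simp)
    -- `u` is orthogonal to `g a`, so that `‖u‖² = ⟪u, v a⟫`, and `u` is a combination of vectors that
    -- are almost orthogonal to `v a`
    have h1 : ‖u‖ ^ 2 ≤ ε * S := by
      have e1 : inner ℂ u u = inner ℂ u (v a) := by
        have : v a = u + g a := by rw [hu]; abel
        rw [this, inner_add_right, hug, add_zero]
      have e2 : ‖u‖ ^ 2 = ‖inner ℂ u u‖ := by
        rw [inner_self_eq_norm_sq_to_K]; simp
      rw [e2, e1, ← hc, sum_inner, hS, Finset.mul_sum]
      refine (norm_sum_le _ _).trans (Finset.sum_le_sum fun b hb => ?_)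
      rw [inner_smul_left, norm_mul, RCLike.norm_conj, mul_comm]
      gcongr
      have := hv b a
      rwa [if_neg (Finset.mem_Iio.1 hb).ne, sub_zero] at this
    -- the Gram matrix is close to the identity
    have h2 : Q - ε * S ^ 2 ≤ ‖u‖ ^ 2 := by
      have e1 : inner ℂ u u = ∑ b ∈ Finset.Iio a, ∑ b' ∈ Finset.Iio a,
          (starRingEnd ℂ) (c b) * c b' * ((inner ℂ (v b) (v b') - if b = b' then 1 else 0) +
            if b = b' then 1 else 0) := by
        rw [← hc, sum_inner]
        refine Finset.sum_congr rfl fun b _ => ?_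
        rw [inner_sum]
        refine Finset.sum_congr rfl fun b' _ => ?_
        rw [inner_smul_left, inner_smul_right]; ring
      have e3 : inner ℂ u u - (Q : ℂ) = ∑ b ∈ Finset.Iio a, ∑ b' ∈ Finset.Iio a,
          (starRingEnd ℂ) (c b) * c b' * (inner ℂ (v b) (v b') - if b = b' then 1 else 0) := by
        rw [e1]
        simp only [mul_add, Finset.sum_add_distrib]
        rw [add_sub_assoc, add_eq_left, sub_eq_zero, hQ]
        push_cast
        refine Finset.sum_congr rfl fun b hb => ?_
        rw [← Complex.conj_mul']
        simp only [mul_ite, mul_one, mul_zero]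
        rw [Finset.sum_ite_eq, if_pos hb]
      have e4 : ‖inner ℂ u u - (Q : ℂ)‖ ≤ ε * S ^ 2 := by
        rw [e3, hS, sq, Finset.sum_mul_sum, Finset.mul_sum]
        refine (norm_sum_le _ _).trans (Finset.sum_le_sum fun b hb => ?_)
        rw [Finset.mul_sum]
        refine (norm_sum_le _ _).trans (Finset.sum_le_sum fun b' hb' => ?_)
        rw [norm_mul, norm_mul, RCLike.norm_conj, mul_comm ε]
        gcongr
        exact hv b b'
      have e5 : inner ℂ u u = ((‖u‖ ^ 2 : ℝ) : ℂ) := by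
        rw [inner_self_eq_norm_sq_to_K]; simp
      rw [e5, ← Complex.ofReal_sub, Complex.norm_real] at e4
      have := (abs_le.1 e4).1
      linarith
    have h3 : Q ≤ 2 * ‖u‖ ^ 2 := by nlinarith
    have h4 : (‖u‖ ^ 2) ^ 2 ≤ (2 * M * ε) ^ 2 * ‖u‖ ^ 2 := by
      calc (‖u‖ ^ 2) ^ 2 ≤ (ε * S) ^ 2 := by gcongr
        _ = ε ^ 2 * S ^ 2 := by ring
        _ ≤ ε ^ 2 * (M * (2 * ‖u‖ ^ 2)) := by gcongr; exact hSQ.trans (by gcongr)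
        _ = (2 * M * ε ^ 2) * ‖u‖ ^ 2 := by ring
        _ ≤ (2 * M * ε) ^ 2 * ‖u‖ ^ 2 := by
          gcongr
          nlinarith [mul_nonneg (sq_nonneg ε) (sub_nonneg.2 hM), sq_nonneg (M * ε)]
    rcases (norm_nonneg u).eq_or_lt with h0 | h0
    · rw [← h0]; positivity
    · have h5 : ‖u‖ ^ 2 ≤ (2 * M * ε) ^ 2 := by
        have : 0 < ‖u‖ ^ 2 := by positivity
        rw [sq (‖u‖ ^ 2)] at h4
        exact le_of_mul_le_mul_right h4 this
      exact (sq_le_sq₀ h0.le (by positivity)).1 h5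
  have hnorm : ∀ a, |‖g a‖ - 1| ≤ 3 * M * ε := by
    intro a
    have hM : (1 : ℝ) ≤ M := by
      have := a.pos
      exact_mod_cast this
    have hε0 : 0 ≤ ε := (norm_nonneg _).trans (hv a a)
    have h1 : |‖v a‖ - 1| ≤ ε := by
      have := hv a a
      rw [if_pos rfl, inner_self_eq_norm_sq_to_K] at this
      have h2 : ((‖v a‖ : ℂ) ^ 2 - 1) = (((‖v a‖ - 1) * (‖v a‖ + 1) : ℝ) : ℂ) := by
        push_cast; ring
      erw [h2, Complex.norm_real, Real.norm_eq_abs, abs_mul] at this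
      have h3 : 1 ≤ |‖v a‖ + 1| := by
        rw [abs_of_nonneg (by positivity)]; linarith [norm_nonneg (v a)]
      nlinarith [abs_nonneg (‖v a‖ - 1)]
    have h2 : |‖g a‖ - ‖v a‖| ≤ 2 * M * ε := by
      rw [abs_sub_comm]
      exact (abs_norm_sub_norm_le _ _).trans (hproj a)
    have h3 := abs_sub_le ‖g a‖ ‖v a‖ 1
    nlinarith
  have hhalf : ∀ a, 1 / 2 ≤ ‖g a‖ := fun a => by
    have := (abs_le.1 (hnorm a)).1
    linarith
  have hne : ∀ a, (‖g a‖ : ℂ) ≠ 0 := fun a => by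
    have := hhalf a
    have : 0 < ‖g a‖ := by linarith
    exact_mod_cast this.ne'
  refine ⟨fun a => (‖g a‖ : ℂ)⁻¹ • g a, ⟨fun a => ?_, fun a b hab => ?_⟩, fun a => ⟨?_,
    fun b => if b = a then (‖g a‖ : ℂ) else if b < a then
      inner ℂ (g b) (v a) / (‖g b‖ : ℂ) ^ 2 * ‖g b‖ else 0, ?_, ?_, ?_⟩⟩
  · rw [norm_smul, norm_inv, Complex.norm_real, norm_norm]
    exact inv_mul_cancel₀ (by simpa using hne a)
  · change inner ℂ _ _ = _
    rw [inner_smul_left, inner_smul_right, hg, InnerProductSpace.gramSchmidt_orthogonal ℂ v hab]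
    simp
  · have h1 : ‖g a - (‖g a‖ : ℂ)⁻¹ • g a‖ = |‖g a‖ - 1| := by
      have h2 : g a - (‖g a‖ : ℂ)⁻¹ • g a = ((‖g a‖ - 1 : ℝ) : ℂ) • ((‖g a‖ : ℂ)⁻¹ • g a) := by
        rw [smul_smul]; push_cast; rw [sub_mul, mul_inv_cancel₀ (hne a), sub_smul]; simp
      rw [h2, norm_smul, norm_smul, Complex.norm_real, norm_inv, Complex.norm_real, norm_norm,
        inv_mul_cancel₀ (by simpa using hne a)]
      simp
    have := norm_sub_le_norm_sub_add_norm_sub (v a) (g a) ((‖g a‖ : ℂ)⁻¹ • g a)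
    rw [h1] at this
    linarith [hproj a, hnorm a]
  · have hdef := InnerProductSpace.gramSchmidt_def'' ℂ v a
    simp only [ite_smul, zero_smul]
    rw [Finset.sum_ite]
    have f1 : Finset.univ.filter (fun b => b = a) = {a} := by ext; simp
    rw [f1, Finset.sum_singleton, smul_smul, mul_inv_cancel₀ (hne a), one_smul, Finset.sum_ite,
      Finset.sum_const_zero, add_zero]
    have f2 : ((Finset.univ.filter (fun b => ¬ b = a)).filter fun b => b < a) = Finset.Iio a := by
      ext b
      simp only [Finset.mem_filter, Finset.mem_univ, true_and, Finset.mem_Iio, and_iff_right_iff_imp]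
      exact fun h => h.ne
    rw [f2]
    nth_rewrite 1 [hdef]
    congr 1
    refine Finset.sum_congr rfl fun i _ => ?_
    rw [smul_smul, mul_assoc, mul_inv_cancel₀ (hne i), mul_one]
    rfl
  · intro b hb
    simp only
    rw [if_neg hb.ne', if_neg hb.not_gt]
  · simpa using hhalf a

/-! ### Taylor coefficients of entire functions -/

/-- The `k`-th Taylor coefficient of `f` at the origin. -/
noncomputable def taylorCoeff (f : ℂ → ℂ) (k : ℕ) : ℂ := iteratedDeriv k f 0 / k.factorial

/-- Cauchy's estimate. -/
theorem norm_taylorCoeff_le {f : ℂ → ℂ} (hf : Differentiable ℂ f) {ρ C : ℝ} (hρ : 0 < ρ)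
    (hC : ∀ z, ‖z‖ = ρ → ‖f z‖ ≤ C) (k : ℕ) : ‖taylorCoeff f k‖ ≤ C / ρ ^ k := by
  have h := Complex.norm_iteratedDeriv_le_of_forall_mem_sphere_norm_le (c := 0) k hρ
    hf.diffContOnCl (fun z hz => hC z (by simpa using hz))
  have hk : (0 : ℝ) < k.factorial := by positivity
  rw [taylorCoeff, norm_div, Complex.norm_natCast, div_le_iff₀ hk]
  refine h.trans (le_of_eq ?_)
  ring

theorem taylorCoeff_sum_mul {ι : Type*} (s : Finset ι) (c : ι → ℂ) {f : ι → ℂ → ℂ}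
    (hf : ∀ i, Differentiable ℂ (f i)) (k : ℕ) :
    taylorCoeff (fun z => ∑ i ∈ s, c i * f i z) k = ∑ i ∈ s, c i * taylorCoeff (f i) k := by
  have h : ∀ i ∈ s, ContDiffAt ℂ k (fun z => c i * f i z) 0 :=
    fun i _ => (((hf i).contDiff).const_smul (c i)).contDiffAt
  rw [taylorCoeff, iteratedDeriv_fun_sum h, Finset.sum_div]
  refine Finset.sum_congr rfl fun i _ => ?_
  rw [iteratedDeriv_const_mul_field, taylorCoeff, mul_div_assoc]

theorem taylorCoeff_sub {f g : ℂ → ℂ} (hf : Differentiable ℂ f) (hg : Differentiable ℂ g) (k : ℕ) :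
    taylorCoeff (fun z => f z - g z) k = taylorCoeff f k - taylorCoeff g k := by
  have := iteratedDeriv_sub (n := k) (x := 0) hf.contDiff.contDiffAt hg.contDiff.contDiffAt
  rw [taylorCoeff, taylorCoeff, taylorCoeff, ← sub_div, ← this]
  rfl

theorem taylorCoeff_exp (c : ℂ) (k : ℕ) :
    taylorCoeff (fun z => Complex.exp (c * z)) k = c ^ k / k.factorial := by
  rw [taylorCoeff, iteratedDeriv_cexp_const_mul]
  simp

theorem taylorCoeff_const_mul_pow (c : ℂ) (m k : ℕ) :
    taylorCoeff (fun z => c * z ^ m) k = if k = m then c else 0 := by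
  rw [taylorCoeff, iteratedDeriv_const_mul_field, iteratedDeriv_fun_pow_zero]
  by_cases h : k = m
  · subst h
    have : (k.factorial : ℂ) ≠ 0 := by exact_mod_cast k.factorial_ne_zero
    simp [this]
  · simp [h]

theorem taylorCoeff_const_mul (c : ℂ) (f : ℂ → ℂ) (k : ℕ) :
    taylorCoeff (fun z => c * f z) k = c * taylorCoeff f k := by
  rw [taylorCoeff, iteratedDeriv_const_mul_field, taylorCoeff, mul_div_assoc]

theorem hasSum_taylorCoeff {f : ℂ → ℂ} (hf : Differentiable ℂ f) (z : ℂ) :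
    HasSum (fun k => taylorCoeff f k * z ^ k) (f z) := by
  have := Complex.hasSum_taylorSeries_of_entire hf 0 z
  refine this.congr_fun ?_
  intro k
  simp only [taylorCoeff, sub_zero, smul_eq_mul]
  ring

/-- Taylor's formula with remainder for a function bounded by `C` on a circle of radius `ρ`. -/
theorem norm_sub_taylor_le {f : ℂ → ℂ} (hf : Differentiable ℂ f) {ρ C : ℝ} (hρ : 0 < ρ)
    (hC : ∀ z, ‖z‖ = ρ → ‖f z‖ ≤ C) (N : ℕ) {z : ℂ} {q : ℝ} (hq : q < 1) (hz : ‖z‖ ≤ q * ρ) :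
    ‖f z - ∑ k ∈ Finset.range (N + 1), taylorCoeff f k * z ^ k‖ ≤ C * q ^ (N + 1) / (1 - q) := by
  have hq0 : 0 ≤ q := by
    by_contra h
    have := mul_neg_of_neg_of_pos (not_le.1 h) hρ
    linarith [norm_nonneg z]
  have hs := (hasSum_nat_add_iff' (N + 1)).2 (hasSum_taylorCoeff hf z)
  have hC0 : 0 ≤ C := (norm_nonneg _).trans (hC ρ (by simp [hρ.le]))
  have hg : HasSum (fun k : ℕ => C * q ^ (N + 1) * q ^ k) (C * q ^ (N + 1) * (1 - q)⁻¹) :=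
    (hasSum_geometric_of_lt_one hq0 hq).mul_left _
  rw [div_eq_mul_inv, ← hs.tsum_eq]
  refine tsum_of_norm_bounded hg fun k => ?_
  rw [norm_mul, norm_pow]
  calc ‖taylorCoeff f (k + (N + 1))‖ * ‖z‖ ^ (k + (N + 1))
      ≤ C / ρ ^ (k + (N + 1)) * (q * ρ) ^ (k + (N + 1)) := by
        gcongr
        exact norm_taylorCoeff_le hf hρ hC _
    _ = C * q ^ (N + 1) * q ^ k := by
        rw [mul_pow]
        field_simp
        ring

/-! ### The displaced monomials -/

/-- The function `g_m(z) = (w + z) ^ m / √(m!) · exp (- z w̄ - |w|² / 2)`, the image of the `m`-th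
normalized monomial under the translation operator of the Fock space that takes `f` to
`f (w + z) exp (- z w̄ - |w|² / 2)`. -/
noncomputable def displaced (w : ℂ) (m : ℕ) (z : ℂ) : ℂ :=
  (w + z) ^ m / ((Real.sqrt (m.factorial : ℝ) : ℝ) : ℂ) *
    Complex.exp (-z * (starRingEnd ℂ) w - (‖w‖ ^ 2 / 2 : ℝ))

theorem differentiable_displaced (w : ℂ) (m : ℕ) : Differentiable ℂ (displaced w m) := by
  unfold displaced
  fun_prop

/-- The sum `∑ g_m(z) conj (g'_m(z'))` for the displaced monomials `g_m` at `w` and `g'_m` at `w'`: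
the covariance of the values at `z` and `z'` of the translates by `w` and by `w'` of a Gaussian
entire function. -/
noncomputable def displacedKernel (w w' z z' : ℂ) : ℂ :=
  Complex.exp ((w + z) * (starRingEnd ℂ) (w' + z') - z * (starRingEnd ℂ) w -
    (starRingEnd ℂ) z' * w' - (‖w‖ ^ 2 / 2 : ℝ) - (‖w'‖ ^ 2 / 2 : ℝ))

theorem hasSum_displaced (w w' z z' : ℂ) :
    HasSum (fun m => displaced w m z * (starRingEnd ℂ) (displaced w' m z'))
      (displacedKernel w w' z z') := by
  have h := (NormedSpace.expSeries_div_hasSum_exp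
    ((w + z) * (starRingEnd ℂ) (w' + z'))).mul_right
      (Complex.exp (-z * (starRingEnd ℂ) w - (‖w‖ ^ 2 / 2 : ℝ)) *
        (starRingEnd ℂ) (Complex.exp (-z' * (starRingEnd ℂ) w' - (‖w'‖ ^ 2 / 2 : ℝ))))
  rw [← Complex.exp_eq_exp_ℂ] at h
  have e : displacedKernel w w' z z' = Complex.exp ((w + z) * (starRingEnd ℂ) (w' + z')) *
      (Complex.exp (-z * (starRingEnd ℂ) w - (‖w‖ ^ 2 / 2 : ℝ)) *
        (starRingEnd ℂ) (Complex.exp (-z' * (starRingEnd ℂ) w' - (‖w'‖ ^ 2 / 2 : ℝ)))) := by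
    rw [displacedKernel, ← Complex.exp_conj, ← Complex.exp_add, ← Complex.exp_add]
    congr 1
    simp only [map_sub, map_mul, map_neg, Complex.conj_conj, Complex.conj_ofReal]
    ring
  rw [e]
  refine h.congr_fun fun m => ?_
  have hs : ((Real.sqrt (m.factorial : ℝ) : ℝ) : ℂ) * ((Real.sqrt (m.factorial : ℝ) : ℝ) : ℂ) =
      m.factorial := by
    rw [← Complex.ofReal_mul, Real.mul_self_sqrt (by positivity)]; simp
  simp only [displaced, map_mul, map_div₀, map_pow, Complex.conj_ofReal]
  rw [← hs, mul_pow]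
  ring

/-- The covariance of two translates decays like a Gaussian function of the distance. -/
theorem norm_displacedKernel (w w' z z' : ℂ) : ‖displacedKernel w w' z z'‖ =
    Real.exp ((‖z‖ ^ 2 + ‖z'‖ ^ 2) / 2 - ‖w + z - (w' + z')‖ ^ 2 / 2) := by
  rw [displacedKernel, Complex.norm_exp]
  congr 1
  simp only [← Complex.normSq_eq_norm_sq, Complex.normSq_apply]
  simp
  ring

/-- Each translate is again a Gaussian entire function. -/
theorem displacedKernel_self (w z z' : ℂ) :
    displacedKernel w w z z' = Complex.exp ((starRingEnd ℂ) z' * z) := by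
  rw [displacedKernel]
  congr 1
  have : ((‖w‖ ^ 2 / 2 : ℝ) : ℂ) = w * (starRingEnd ℂ) w / 2 := by
    rw [Complex.mul_conj']; push_cast; ring
  rw [this, map_add]
  ring

theorem norm_displaced_le (w : ℂ) (m : ℕ) (z : ℂ) : ‖displaced w m z‖ ≤ Real.exp (‖z‖ ^ 2 / 2) := by
  have h := hasSum_displaced w w z z
  have h1 : HasSum (fun m => ‖displaced w m z‖ ^ 2) (Real.exp (‖z‖ ^ 2)) := by
    have h2 := Complex.hasSum_re h
    have e1 : (displacedKernel w w z z).re = Real.exp (‖z‖ ^ 2) := by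
      rw [displacedKernel_self, Complex.conj_mul', ← Complex.ofReal_pow, ← Complex.ofReal_exp,
        Complex.ofReal_re]
    rw [e1] at h2
    refine h2.congr_fun fun m => ?_
    rw [Complex.mul_conj', ← Complex.ofReal_pow, Complex.ofReal_re]
  have h2 := le_hasSum h1 m fun i _ => by positivity
  refine (sq_le_sq₀ (norm_nonneg _) (Real.exp_nonneg _)).1 (h2.trans (le_of_eq ?_))
  rw [← Real.exp_nat_mul]
  congr 1
  push_cast; ring

/-- `x ^ m / √(m!)` decays geometrically once `m` is large compared with `x²`. -/
theorem pow_div_sqrt_factorial_le {x : ℝ} (hx : 0 ≤ x) (m : ℕ) :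
    x ^ m / Real.sqrt (m.factorial : ℝ) ≤ Real.exp (8 * x ^ 2) * Real.exp (-m : ℝ) := by
  have h1 := Real.pow_div_factorial_le_exp ((Real.exp 1 * x) ^ 2) (by positivity) m
  have h2 : Real.exp ((Real.exp 1 * x) ^ 2) ≤ Real.exp (8 * x ^ 2) ^ 2 := by
    rw [← Real.exp_nat_mul]
    apply Real.exp_le_exp.2
    have := Real.exp_one_lt_d9
    have h3 : Real.exp 1 ^ 2 ≤ 16 := by nlinarith [Real.exp_pos 1]
    push_cast
    nlinarith [sq_nonneg x]
  have h3 : (x ^ m / Real.sqrt (m.factorial : ℝ) * Real.exp m) ^ 2 ≤ Real.exp (8 * x ^ 2) ^ 2 := by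
    refine (le_of_eq ?_).trans (h1.trans h2)
    rw [mul_pow, div_pow, Real.sq_sqrt (by positivity), ← pow_mul, ← pow_mul, mul_pow,
      ← Real.exp_nat_mul, ← Real.exp_nat_mul]
    rw [mul_comm m 2]
    push_cast
    ring_nf
  have h4 := (sq_le_sq₀ (by positivity) (Real.exp_nonneg _)).1 h3
  rw [Real.exp_neg, ← div_eq_mul_inv, le_div_iff₀ (Real.exp_pos _)]
  exact h4

/-- Only `O(R²)` of the coefficients matter near a point at distance `R` from the origin. -/
theorem norm_displaced_le_of_large {R : ℝ} (hR : 6 ≤ R) {w : ℂ} (hw : ‖w‖ = R) {m : ℕ}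
    (hm : 80 * R ^ 2 ≤ m) {z : ℂ} (hz : ‖z‖ ≤ 6) :
    ‖displaced w m z‖ ≤ Real.exp (-R ^ 2) * Real.exp (-m / 2 : ℝ) := by
  rw [displaced, norm_mul, norm_div, norm_pow, Complex.norm_exp, Complex.norm_real,
    Real.norm_of_nonneg (Real.sqrt_nonneg _)]
  have h1 : ‖w + z‖ ≤ 2 * R := (norm_add_le _ _).trans (by linarith)
  have h2 : (-z * (starRingEnd ℂ) w - (‖w‖ ^ 2 / 2 : ℝ)).re ≤ 6 * R := by
    rw [Complex.sub_re, Complex.ofReal_re]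
    have : (-z * (starRingEnd ℂ) w).re ≤ 6 * R := by
      refine (Complex.re_le_norm _).trans ?_
      rw [norm_mul, norm_neg, RCLike.norm_conj, hw]
      gcongr
    nlinarith [sq_nonneg ‖w‖]
  calc _ ≤ (2 * R) ^ m / Real.sqrt (m.factorial : ℝ) * Real.exp (6 * R) := by gcongr
    _ ≤ Real.exp (8 * (2 * R) ^ 2) * Real.exp (-m : ℝ) * Real.exp (6 * R) := by
        gcongr
        exact pow_div_sqrt_factorial_le (by linarith) m
    _ = Real.exp (8 * (2 * R) ^ 2 + -m + 6 * R) := by rw [Real.exp_add, Real.exp_add]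
    _ ≤ Real.exp (-R ^ 2 + -m / 2) := by
        apply Real.exp_le_exp.2
        nlinarith
    _ = _ := Real.exp_add _ _

/-! ### The Taylor coefficients of the translates -/

/-- The normalized monomial `z ^ k / √(k!)` of the Fock space. -/
noncomputable def fockMonomial (k : ℕ) (z : ℂ) : ℂ :=
  z ^ k / ((Real.sqrt (k.factorial : ℝ) : ℝ) : ℂ)

/-- The coordinates with respect to `ζ_0, …, ζ_{D-1}` of the `k`-th normalized Taylor coefficient
of `z ↦ ∑ ζ_m g_m(z)`, where `g_m` are the displaced monomials. -/
noncomputable def displacedCoeff (D : ℕ) (w : ℂ) (k : ℕ) : EuclideanSpace ℂ (Fin D) :=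
  WithLp.toLp 2 fun m => ((Real.sqrt (k.factorial : ℝ) : ℝ) : ℂ) * taylorCoeff (displaced w m) k

/-- If the (truncated) covariance of two translates is close to `κ exp (z̄' z)` on the unit torus, then
the inner products of the normalized Taylor coefficients are close to `κ δ_{k k'}`. -/
theorem norm_displacedCoeff_inner_le {D : ℕ} {w w' : ℂ} {κ τ : ℝ}
    (h : ∀ z z' : ℂ, ‖z‖ = 1 → ‖z'‖ = 1 →
      ‖∑ m ∈ Finset.range D, displaced w m z * (starRingEnd ℂ) (displaced w' m z') -
        κ * Complex.exp ((starRingEnd ℂ) z' * z)‖ ≤ τ) (k k' : ℕ) :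
    ‖inner ℂ (displacedCoeff D w k) (displacedCoeff D w' k') - if k = k' then (κ : ℂ) else 0‖ ≤
      Real.sqrt k.factorial * Real.sqrt k'.factorial * τ := by
  -- Cauchy's estimate in the variable `z`, and then in the variable `z'`
  have h1 : ∀ z' : ℂ, ‖z'‖ = 1 →
      ‖∑ m ∈ Finset.range D, (starRingEnd ℂ) (taylorCoeff (displaced w m) k) * displaced w' m z' -
        (κ / k.factorial) * z' ^ k‖ ≤ τ := by
    intro z' hz'
    have h2 := norm_taylorCoeff_le (f := fun z =>
      ∑ m ∈ Finset.range D, (starRingEnd ℂ) (displaced w' m z') * displaced w m z -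
        κ * Complex.exp ((starRingEnd ℂ) z' * z)) (ρ := 1) (C := τ) (by
          have := differentiable_displaced w
          fun_prop) one_pos
        (fun z hz => by simpa only [mul_comm] using h z z' hz hz') k
    rw [taylorCoeff_sub (by have := differentiable_displaced w; fun_prop) (by fun_prop),
      taylorCoeff_sum_mul _ _ (differentiable_displaced w), taylorCoeff_const_mul,
      taylorCoeff_exp, one_pow, div_one, ← Complex.norm_conj] at h2
    convert h2 using 2
    simp only [map_sub, map_sum, map_mul, Complex.conj_conj, map_div₀, map_pow, Complex.conj_ofReal,
      map_natCast]
    congr 1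
    · exact Finset.sum_congr rfl fun _ _ => mul_comm _ _
    · ring
  have h3 := norm_taylorCoeff_le (f := fun z' =>
      ∑ m ∈ Finset.range D, (starRingEnd ℂ) (taylorCoeff (displaced w m) k) * displaced w' m z' -
        (κ / k.factorial) * z' ^ k) (ρ := 1) (C := τ) (by
          have := differentiable_displaced w'
          fun_prop) one_pos h1 k'
  rw [taylorCoeff_sub (by have := differentiable_displaced w'; fun_prop) (by fun_prop),
    taylorCoeff_sum_mul _ _ (differentiable_displaced w'), taylorCoeff_const_mul_pow, one_pow,
    div_one] at h3
  have h4 : inner ℂ (displacedCoeff D w k) (displacedCoeff D w' k') -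
      (if k = k' then (κ : ℂ) else 0) =
      ((Real.sqrt k.factorial * Real.sqrt k'.factorial : ℝ) : ℂ) *
      (∑ m ∈ Finset.range D, (starRingEnd ℂ) (taylorCoeff (displaced w m) k) *
        taylorCoeff (displaced w' m) k' - if k' = k then (κ / k.factorial : ℂ) else 0) := by
    rw [mul_sub, Finset.mul_sum, Finset.sum_range, PiLp.inner_apply]
    congr 1
    · refine Finset.sum_congr rfl fun m _ => ?_
      simp only [displacedCoeff, RCLike.inner_apply, map_mul, Complex.conj_ofReal]
      push_cast
      ring
    · by_cases hk : k = k'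
      · subst hk
        rw [if_pos rfl, if_pos rfl, Real.mul_self_sqrt (by positivity)]
        have : (k.factorial : ℂ) ≠ 0 := by exact_mod_cast k.factorial_ne_zero
        push_cast
        field_simp
      · rw [if_neg hk, if_neg (Ne.symm hk), mul_zero]
  rw [h4, norm_mul, Complex.norm_real, Real.norm_of_nonneg (by positivity)]
  gcongr

theorem norm_sum_displaced_sub_kernel_le {R : ℝ} (hR : 6 ≤ R) {w w' : ℂ} (hw : ‖w‖ = R)
    (hw' : ‖w'‖ = R) {D : ℕ} (hD : 80 * R ^ 2 ≤ D) {z z' : ℂ} (hz : ‖z‖ ≤ 6) (hz' : ‖z'‖ ≤ 6) :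
    ‖∑ m ∈ Finset.range D, displaced w m z * (starRingEnd ℂ) (displaced w' m z') -
      displacedKernel w w' z z'‖ ≤ 2 * Real.exp (-R ^ 2) := by
  have hs := (hasSum_nat_add_iff' D).2 (hasSum_displaced w w' z z')
  have he : Real.exp (-1) ≤ 1 / 2 := by
    have := Real.exp_one_gt_d9
    rw [Real.exp_neg, one_div]
    exact inv_anti₀ (by norm_num) (by linarith)
  have hg : HasSum (fun i : ℕ => Real.exp (-R ^ 2) * (1 / 2 : ℝ) ^ i)
      (Real.exp (-R ^ 2) * 2) := hasSum_geometric_two.mul_left _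
  rw [norm_sub_rev, ← hs.tsum_eq, mul_comm 2]
  refine tsum_of_norm_bounded hg fun i => ?_
  have hi : 80 * R ^ 2 ≤ ((i + D : ℕ) : ℝ) := by
    push_cast
    have : (0 : ℝ) ≤ i := by positivity
    linarith
  have h1 := norm_displaced_le_of_large hR hw hi hz
  have h2 := norm_displaced_le_of_large hR hw' hi hz'
  rw [norm_mul, RCLike.norm_conj]
  calc _ ≤ (Real.exp (-R ^ 2) * Real.exp (-((i + D : ℕ) : ℝ) / 2)) *
        (Real.exp (-R ^ 2) * Real.exp (-((i + D : ℕ) : ℝ) / 2)) := by gcongr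
    _ = Real.exp (-R ^ 2) * Real.exp (-1) ^ i * (Real.exp (-R ^ 2) * Real.exp (-1) ^ D) := by
        rw [← Real.exp_nat_mul, ← Real.exp_nat_mul]
        simp only [← Real.exp_add]
        congr 1
        push_cast
        ring
    _ ≤ Real.exp (-R ^ 2) * (1 / 2 : ℝ) ^ i * (1 * 1) := by
        gcongr
        · exact Real.exp_le_one_iff.2 (by nlinarith)
        · exact pow_le_one₀ (Real.exp_nonneg _) (by linarith)
    _ = _ := by ring

/-- The normalized Taylor coefficients of the translates of a Gaussian entire function to distant
points are almost orthonormal. -/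
theorem displacedCoeff_almost_orthonormal {R d : ℝ} (hR : 6 ≤ R) (hd : 2 ≤ d) {D N : ℕ}
    (hD : 80 * R ^ 2 ≤ D) {w w' : ℂ} (hw : ‖w‖ = R) (hw' : ‖w'‖ = R)
    (hww' : w = w' ∨ d ≤ ‖w - w'‖) {k k' : ℕ} (hk : k ≤ N) (hk' : k' ≤ N) :
    ‖inner ℂ (displacedCoeff D w k) (displacedCoeff D w' k') -
      if w = w' ∧ k = k' then 1 else 0‖ ≤
      N.factorial * (Real.exp (1 - (d - 2) ^ 2 / 2) + 2 * Real.exp (-R ^ 2)) := by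
  have hfac : Real.sqrt k.factorial * Real.sqrt k'.factorial ≤ N.factorial := by
    have h1 : ∀ {l : ℕ}, l ≤ N → Real.sqrt l.factorial ≤ Real.sqrt N.factorial := fun hl =>
      Real.sqrt_le_sqrt (by exact_mod_cast Nat.factorial_le hl)
    calc _ ≤ Real.sqrt N.factorial * Real.sqrt N.factorial :=
          mul_le_mul (h1 hk) (h1 hk') (Real.sqrt_nonneg _) (Real.sqrt_nonneg _)
      _ = _ := Real.mul_self_sqrt (by positivity)
  have hpos : 0 ≤ Real.exp (1 - (d - 2) ^ 2 / 2) + 2 * Real.exp (-R ^ 2) := by positivity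
  by_cases hc : w = w'
  · subst hc
    have := norm_displacedCoeff_inner_le (D := D) (w := w) (w' := w) (κ := 1)
      (τ := Real.exp (1 - (d - 2) ^ 2 / 2) + 2 * Real.exp (-R ^ 2)) (fun z z' hz hz' => by
        have := norm_sum_displaced_sub_kernel_le hR hw hw hD (z := z) (z' := z') (by linarith)
          (by linarith)
        rw [displacedKernel_self] at this
        rw [Complex.ofReal_one, one_mul]
        linarith [Real.exp_pos (1 - (d - 2) ^ 2 / 2)]) k k'
    simp only [true_and]
    simp only [Complex.ofReal_one] at this
    exact this.trans (by gcongr)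
  · have hdist : d ≤ ‖w - w'‖ := hww'.resolve_left hc
    have := norm_displacedCoeff_inner_le (D := D) (w := w) (w' := w') (κ := 0)
      (τ := Real.exp (1 - (d - 2) ^ 2 / 2) + 2 * Real.exp (-R ^ 2)) (fun z z' hz hz' => by
        have h1 := norm_sum_displaced_sub_kernel_le hR hw hw' hD (z := z) (z' := z') (by linarith)
          (by linarith)
        have h2 : ‖displacedKernel w w' z z'‖ ≤ Real.exp (1 - (d - 2) ^ 2 / 2) := by
          rw [norm_displacedKernel, hz, hz']
          apply Real.exp_le_exp.2
          have h3 : d - 2 ≤ ‖w + z - (w' + z')‖ := by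
            have e : w - w' = (w + z - (w' + z')) - z + z' := by ring
            have h4 := norm_add_le ((w + z - (w' + z')) - z) z'
            have h5 := norm_sub_le (w + z - (w' + z')) z
            rw [← e] at h4
            linarith
          nlinarith
        rw [Complex.ofReal_zero, zero_mul, sub_zero]
        calc _ = ‖(∑ m ∈ Finset.range D, displaced w m z * (starRingEnd ℂ) (displaced w' m z') -
              displacedKernel w w' z z') + displacedKernel w w' z z'‖ := by rw [sub_add_cancel]
          _ ≤ _ := (norm_add_le _ _).trans (by linarith)) k k'
    simp only [Complex.ofReal_zero, ite_self] at this
    simp only [hc, false_and, if_false]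
    exact this.trans (by gcongr)

theorem one_add_le_two_mul_exp_half (k : ℕ) : 1 + (k : ℝ) ≤ 2 * Real.exp (k / 2 : ℝ) := by
  have := Real.add_one_le_exp (k / 2 : ℝ)
  linarith

theorem norm_fockMonomial_le (k : ℕ) {z : ℂ} (hz : ‖z‖ ≤ 6) :
    ‖fockMonomial k z‖ ≤ Real.exp 288 * Real.exp (-k : ℝ) := by
  rw [fockMonomial, norm_div, norm_pow, Complex.norm_real, Real.norm_of_nonneg (Real.sqrt_nonneg _)]
  calc _ ≤ (6 : ℝ) ^ k / Real.sqrt (k.factorial : ℝ) := by gcongr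
    _ ≤ Real.exp (8 * 6 ^ 2) * Real.exp (-k : ℝ) := pow_div_sqrt_factorial_le (by norm_num) k
    _ = _ := by norm_num

theorem summable_and_norm_tsum_le_of_geometric {u : ℕ → ℂ} {A q c : ℝ} (hq0 : 0 ≤ q)
    (hq : q < 1) (hc : (1 - q)⁻¹ ≤ c) (hA : 0 ≤ A) (hu : ∀ i, ‖u i‖ ≤ A * q ^ i) :
    Summable u ∧ ‖∑' i, u i‖ ≤ A * c := by
  have hg : HasSum (fun i : ℕ => A * q ^ i) (A * (1 - q)⁻¹) :=
    (hasSum_geometric_of_lt_one hq0 hq).mul_left _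
  exact ⟨.of_norm_bounded hg.summable hu,
    (tsum_of_norm_bounded hg hu).trans (by gcongr)⟩

theorem exp_neg_half_bounds : Real.exp (-(1 / 2)) < 1 ∧ (1 - Real.exp (-(1 / 2)))⁻¹ ≤ 3 := by
  have h : Real.exp (-(1 / 2)) ≤ 2 / 3 := by
    have := Real.add_one_le_exp (1 / 2 : ℝ)
    rw [Real.exp_neg]
    calc _ ≤ (3 / 2 : ℝ)⁻¹ := inv_anti₀ (by norm_num) (by linarith)
      _ = _ := by norm_num
  refine ⟨by linarith, ?_⟩
  calc _ ≤ (1 / 3 : ℝ)⁻¹ := inv_anti₀ (by norm_num) (by linarith)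
    _ = _ := by norm_num

theorem exp_neg_quarter_bounds : Real.exp (-(1 / 4)) < 1 ∧ (1 - Real.exp (-(1 / 4)))⁻¹ ≤ 5 := by
  have h : Real.exp (-(1 / 4)) ≤ 4 / 5 := by
    have := Real.add_one_le_exp (1 / 4 : ℝ)
    rw [Real.exp_neg]
    calc _ ≤ (5 / 4 : ℝ)⁻¹ := inv_anti₀ (by norm_num) (by linarith)
      _ = _ := by norm_num
  refine ⟨by linarith, ?_⟩
  calc _ ≤ (1 / 5 : ℝ)⁻¹ := inv_anti₀ (by norm_num) (by linarith)
    _ = _ := by norm_num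

/-- If the vectors `e k` are close to the coefficient vectors of the translate to `w`, and the
Gaussian variables have moderate values, then the function with the coefficients `∑ e_{k,m} a_m` is
close to the translate. -/
theorem norm_displaced_sub_series_le {R : ℝ} (hR : 6 ≤ R) {D N : ℕ} (hD : 80 * R ^ 2 ≤ D) {w : ℂ}
    (hw : ‖w‖ = R) {e : Fin (N + 1) → EuclideanSpace ℂ (Fin D)} {κ : ℝ}
    (he : ∀ k : Fin (N + 1), ‖displacedCoeff D w k - e k‖ ≤ κ) {a b : ℕ → ℂ}
    (ha : ∀ m, ‖a m‖ ≤ R + m)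
    (hb : ∀ k, ‖b k‖ ≤ R + k) (hab : ∀ k : Fin (N + 1), b k = ∑ m : Fin D, e k m * a m) {z : ℂ}
    (hz : ‖z‖ ≤ 6) :
    ‖∑' m, a m * displaced w m z - ∑' k, b k * fockMonomial k z‖ ≤
      20 * Real.exp 288 * (D * (R + D) * (Real.exp (-N / 2 : ℝ) + κ) + R * Real.exp (-R ^ 2) +
        R * Real.exp (-N / 2 : ℝ)) := by
  have hκ : 0 ≤ κ := (norm_nonneg _).trans (he 0)
  have hexp : (1 : ℝ) ≤ Real.exp 288 := Real.one_le_exp (by norm_num)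
  -- the tail of the first series
  have hA : Summable (fun i => a (i + D) * displaced w (i + D) z) ∧
      ‖∑' i, a (i + D) * displaced w (i + D) z‖ ≤ 4 * R * Real.exp (-R ^ 2) * 5 := by
    refine summable_and_norm_tsum_le_of_geometric (Real.exp_nonneg _)
      exp_neg_quarter_bounds.1 exp_neg_quarter_bounds.2
      (by positivity) fun i => ?_
    have hi : 80 * R ^ 2 ≤ ((i + D : ℕ) : ℝ) := by
      push_cast
      have : (0 : ℝ) ≤ i := by positivity
      linarith
    have h1 := norm_displaced_le_of_large hR hw hi hz
    have h2 : ‖a (i + D)‖ ≤ R * (4 * Real.exp (((i + D : ℕ) : ℝ) / 4)) := by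
      refine (ha _).trans ?_
      have h3 := Real.add_one_le_exp ((((i + D : ℕ) : ℝ)) / 4)
      have h4 : (0 : ℝ) ≤ ((i + D : ℕ) : ℝ) := by positivity
      nlinarith
    rw [norm_mul]
    calc _ ≤ R * (4 * Real.exp (((i + D : ℕ) : ℝ) / 4)) *
          (Real.exp (-R ^ 2) * Real.exp (-((i + D : ℕ) : ℝ) / 2)) := by gcongr
      _ = 4 * R * Real.exp (-R ^ 2) *
          (Real.exp (((i + D : ℕ) : ℝ) / 4) * Real.exp (-((i + D : ℕ) : ℝ) / 2)) := by ring
      _ ≤ 4 * R * Real.exp (-R ^ 2) * Real.exp (-(1 / 4)) ^ i := by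
          gcongr
          rw [← Real.exp_add, ← Real.exp_nat_mul]
          apply Real.exp_le_exp.2
          push_cast
          have : (0 : ℝ) ≤ D := by positivity
          nlinarith
  -- the tail of the second series
  have hB : Summable (fun i => b (i + (N + 1)) * fockMonomial (i + (N + 1)) z) ∧
      ‖∑' i, b (i + (N + 1)) * fockMonomial (i + (N + 1)) z‖ ≤
        2 * R * Real.exp 288 * Real.exp (-N / 2 : ℝ) * 3 := by
    refine summable_and_norm_tsum_le_of_geometric (Real.exp_nonneg _)
      exp_neg_half_bounds.1 exp_neg_half_bounds.2
      (by positivity) fun i => ?_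
    have h2 : ‖b (i + (N + 1))‖ ≤ R * (2 * Real.exp (((i + (N + 1) : ℕ) : ℝ) / 2)) := by
      refine (hb _).trans ?_
      have h3 := one_add_le_two_mul_exp_half (i + (N + 1))
      have h4 : (0 : ℝ) ≤ ((i + (N + 1) : ℕ) : ℝ) := by positivity
      nlinarith
    rw [norm_mul]
    calc _ ≤ R * (2 * Real.exp (((i + (N + 1) : ℕ) : ℝ) / 2)) *
          (Real.exp 288 * Real.exp (-((i + (N + 1) : ℕ) : ℝ))) := by
          gcongr
          exact norm_fockMonomial_le _ hz
      _ = 2 * R * Real.exp 288 * (Real.exp (((i + (N + 1) : ℕ) : ℝ) / 2) *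
          Real.exp (-((i + (N + 1) : ℕ) : ℝ))) := by ring
      _ ≤ 2 * R * Real.exp 288 * (Real.exp (-N / 2 : ℝ) * Real.exp (-(1 / 2)) ^ i) := by
          refine mul_le_mul_of_nonneg_left ?_ (by positivity)
          rw [← Real.exp_add, ← Real.exp_nat_mul, ← Real.exp_add]
          apply Real.exp_le_exp.2
          push_cast
          nlinarith
      _ = _ := by ring
  have hsA : Summable fun m => a m * displaced w m z := (summable_nat_add_iff D).1 hA.1
  have hsB : Summable fun k => b k * fockMonomial k z := (summable_nat_add_iff (N + 1)).1 hB.1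
  -- the main terms
  have hK : ∀ k : ℕ, displacedCoeff D w k = WithLp.toLp 2 fun m : Fin D =>
      ((Real.sqrt (k.factorial : ℝ) : ℝ) : ℂ) * taylorCoeff (displaced w m) k := fun k => rfl
  have hmain : ∀ m : Fin D, ‖displaced w m z - ∑ k : Fin (N + 1), e k m * fockMonomial k z‖ ≤
      3 * Real.exp 288 * (Real.exp (-N / 2 : ℝ) + κ) := by
    intro m
    -- on the circle of radius `6 e` the displaced monomials are bounded, and each term of the Taylor
    -- series gains a factor `1 / e`
    have h1 := norm_sub_taylor_le (differentiable_displaced w m) (ρ := 6 * Real.exp 1)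
      (C := Real.exp ((6 * Real.exp 1) ^ 2 / 2)) (by positivity)
      (fun z hz => by simpa [hz] using norm_displaced_le w m z) N (z := z) (q := Real.exp (-1))
      (Real.exp_lt_one_iff.2 (by norm_num)) (by
        rw [mul_comm 6, ← mul_assoc, ← Real.exp_add]; simpa using hz)
    have h2 : Real.exp ((6 * Real.exp 1) ^ 2 / 2) * Real.exp (-1) ^ (N + 1) /
        (1 - Real.exp (-1)) ≤ Real.exp 288 * Real.exp (-N / 2 : ℝ) := by
      have e1 := Real.exp_one_lt_d9
      have e2 := Real.exp_one_gt_d9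
      have e3 : Real.exp (-1) ≤ 1 - Real.exp (-1) := by
        have : Real.exp (-1) ≤ 1 / 2 := by
          rw [Real.exp_neg, one_div]
          exact inv_anti₀ (by norm_num) (by linarith)
        linarith
      have e4 : 0 < Real.exp (-1) := Real.exp_pos _
      rw [div_le_iff₀ (by linarith), pow_succ]
      have e5 : Real.exp ((6 * Real.exp 1) ^ 2 / 2) ≤ Real.exp 288 := by
        apply Real.exp_le_exp.2
        nlinarith
      have e6 : Real.exp (-1) ^ N ≤ Real.exp (-N / 2 : ℝ) := by
        rw [← Real.exp_nat_mul]
        apply Real.exp_le_exp.2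
        have : (0 : ℝ) ≤ N := by positivity
        linarith
      calc _ = Real.exp ((6 * Real.exp 1) ^ 2 / 2) * Real.exp (-1) ^ N * Real.exp (-1) := by ring_nf
        _ ≤ _ := by gcongr
    have h3 : ∑ k ∈ Finset.range (N + 1), taylorCoeff (displaced w m) k * z ^ k =
        ∑ k : Fin (N + 1), displacedCoeff D w k m * fockMonomial k z := by
      rw [Finset.sum_range]
      refine Finset.sum_congr rfl fun k _ => ?_
      have : ((Real.sqrt ((k : ℕ).factorial : ℝ) : ℝ) : ℂ) ≠ 0 := by
        have : Real.sqrt ((k : ℕ).factorial : ℝ) ≠ 0 :=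
          (Real.sqrt_pos.2 (by positivity)).ne'
        exact_mod_cast this
      rw [hK, fockMonomial]
      simp only
      field_simp
    have h4 : ‖∑ k : Fin (N + 1), (displacedCoeff D w k m - e k m) * fockMonomial k z‖ ≤
        3 * Real.exp 288 * κ := by
      have hgeo : ∑ k ∈ Finset.range (N + 1), Real.exp (-(1 / 2)) ^ k ≤ 3 :=
        (((hasSum_geometric_of_lt_one (Real.exp_nonneg _)
          exp_neg_half_bounds.1).summable.sum_le_tsum _ fun i _ => by positivity).trans
          (le_of_eq (tsum_geometric_of_lt_one (Real.exp_nonneg _) exp_neg_half_bounds.1))).trans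
          exp_neg_half_bounds.2
      calc _ ≤ ∑ k : Fin (N + 1), κ * (Real.exp 288 * Real.exp (-(1 / 2)) ^ (k : ℕ)) := by
            refine (norm_sum_le _ _).trans (Finset.sum_le_sum fun k _ => ?_)
            rw [norm_mul]
            have g1 : ‖displacedCoeff D w k m - e k m‖ ≤ κ :=
              (PiLp.norm_apply_le (displacedCoeff D w k - e k) m).trans (he k)
            have g2 : ‖fockMonomial k z‖ ≤ Real.exp 288 * Real.exp (-(1 / 2)) ^ (k : ℕ) := by
              refine (norm_fockMonomial_le k hz).trans ?_
              gcongr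
              rw [← Real.exp_nat_mul]
              apply Real.exp_le_exp.2
              have : (0 : ℝ) ≤ ((k : ℕ) : ℝ) := by positivity
              linarith
            gcongr
        _ = κ * Real.exp 288 * ∑ k ∈ Finset.range (N + 1), Real.exp (-(1 / 2)) ^ k := by
            rw [Finset.sum_range, Finset.mul_sum]
            refine Finset.sum_congr rfl fun k _ => by ring
        _ ≤ κ * Real.exp 288 * 3 := by gcongr
        _ = _ := by ring
    have h5 : displaced w m z - ∑ k : Fin (N + 1), e k m * fockMonomial k z =
        (displaced w m z - ∑ k ∈ Finset.range (N + 1), taylorCoeff (displaced w m) k * z ^ k) +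
        ∑ k : Fin (N + 1), (displacedCoeff D w k m - e k m) * fockMonomial k z := by
      rw [h3]
      simp only [sub_mul, Finset.sum_sub_distrib]
      ring
    rw [h5]
    refine (norm_add_le _ _).trans ((add_le_add (h1.trans h2) h4).trans ?_)
    have : 0 ≤ Real.exp 288 * Real.exp (-N / 2 : ℝ) := by positivity
    linarith
  have hsum : ∑ m ∈ Finset.range D, a m * displaced w m z -
      ∑ k ∈ Finset.range (N + 1), b k * fockMonomial k z =
      ∑ m : Fin D, a m * (displaced w m z - ∑ k : Fin (N + 1), e k m * fockMonomial k z) := by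
    simp only [mul_sub, Finset.sum_sub_distrib, Finset.sum_range]
    congr 1
    simp only [hab, Finset.sum_mul, Finset.mul_sum]
    rw [Finset.sum_comm]
    exact Finset.sum_congr rfl fun _ _ => Finset.sum_congr rfl fun _ _ => by ring
  have hsum' : ‖∑ m : Fin D, a m * (displaced w m z -
      ∑ k : Fin (N + 1), e k m * fockMonomial k z)‖ ≤
      D * (R + D) * (3 * Real.exp 288 * (Real.exp (-N / 2 : ℝ) + κ)) := by
    calc _ ≤ ∑ m : Fin D, (R + D) * (3 * Real.exp 288 * (Real.exp (-N / 2 : ℝ) + κ)) := by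
          refine (norm_sum_le _ _).trans (Finset.sum_le_sum fun m _ => ?_)
          rw [norm_mul]
          have : ‖a m‖ ≤ R + D := (ha m).trans (by
            have : ((m : ℕ) : ℝ) ≤ D := by exact_mod_cast m.2.le
            linarith)
          gcongr
          exact hmain m
      _ = _ := by simp; ring
  rw [← hsA.sum_add_tsum_nat_add D, ← hsB.sum_add_tsum_nat_add (N + 1)]
  have hfin : ∀ x y x' y' : ℂ, x + y - (x' + y') = (x - x') + (y - y') := fun _ _ _ _ => by ring
  rw [hfin, hsum]
  refine (norm_add_le _ _).trans ((add_le_add hsum' (norm_sub_le _ _)).trans ?_)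
  have p1 : 0 ≤ D * (R + D) * (Real.exp 288 * (Real.exp (-N / 2 : ℝ) + κ)) := by positivity
  have p2 : R * Real.exp (-R ^ 2) ≤ R * Real.exp (-R ^ 2) * Real.exp 288 :=
    le_mul_of_one_le_right (by positivity) hexp
  have p3 : 0 ≤ R * Real.exp 288 * Real.exp (-N / 2 : ℝ) := by positivity
  linarith [hA.2, hB.2]

/-! ### The orthonormal system -/

open Filter Topology in
/-- `N! ≤ exp (O(log R · log log R))` for `N = O(log R)`, while the covariances are at most
`exp (-c (log R)²)`. -/
theorem eventually_factorial_gauss_le : ∀ᶠ R : ℝ in atTop, ∀ N : ℕ,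
    (N : ℝ) ≤ 60 * Real.log R → (N + 1) * (N.factorial : ℝ) *
      (Real.exp (1 - (2 / Real.pi * Real.log R - 2) ^ 2 / 2) + 2 * Real.exp (-R ^ 2)) ≤
      (R ^ 40)⁻¹ := by
  have hlo : ∀ᶠ L : ℝ in atTop, 61 * Real.log (61 * L) + 40 ≤ L / 16 := by
    have h1 : Tendsto (fun L : ℝ => 61 * L) atTop atTop :=
      tendsto_id.const_mul_atTop (by norm_num)
    have h2 := (Real.isLittleO_log_id_atTop.comp_tendsto h1).bound
      (show (0 : ℝ) < 1 / (61 * 61 * 32) by norm_num)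
    filter_upwards [h2, eventually_ge_atTop 2000] with L hL hL2
    simp only [Function.comp, id] at hL
    rw [Real.norm_of_nonneg (by linarith : (0 : ℝ) ≤ 61 * L)] at hL
    have := (Real.le_norm_self _).trans hL
    linarith
  have hlo' := Real.tendsto_log_atTop.eventually hlo
  filter_upwards [hlo', Real.tendsto_log_atTop.eventually_ge_atTop 2000,
    eventually_ge_atTop 10] with R h1 h2 hR N hN
  set L := Real.log R with hL
  have hRL : R = Real.exp L := (Real.exp_log (by linarith)).symm
  have hpi : Real.pi < 3.15 := Real.pi_lt_d2
  have hpi0 := Real.pi_pos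
  have h3 : L / 2 ≤ 2 / Real.pi * L - 2 := by
    have : 0.6 ≤ 2 / Real.pi := by rw [le_div_iff₀ hpi0]; linarith
    nlinarith
  have hR2 : L ^ 2 ≤ R ^ 2 := by
    have : L ≤ R := by rw [hRL]; linarith [Real.add_one_le_exp L]
    nlinarith
  have h4 : Real.exp (1 - (2 / Real.pi * L - 2) ^ 2 / 2) + 2 * Real.exp (-R ^ 2) ≤
      Real.exp (3 - L ^ 2 / 8) := by
    have e1 : Real.exp (1 - (2 / Real.pi * L - 2) ^ 2 / 2) ≤ Real.exp (1 - L ^ 2 / 8) := by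
      apply Real.exp_le_exp.2; nlinarith
    have e2 : Real.exp (-R ^ 2) ≤ Real.exp (1 - L ^ 2 / 8) := by
      apply Real.exp_le_exp.2; nlinarith
    have e3 : Real.exp (3 - L ^ 2 / 8) = Real.exp 2 * Real.exp (1 - L ^ 2 / 8) := by
      rw [← Real.exp_add]; congr 1; ring
    have e4 : (3 : ℝ) ≤ Real.exp 2 := by linarith [Real.add_one_le_exp (2 : ℝ)]
    rw [e3]
    nlinarith [Real.exp_pos (1 - L ^ 2 / 8)]
  have h5 : ((N : ℝ) + 1) * (N.factorial : ℝ) ≤ Real.exp (61 * L * Real.log (61 * L)) := by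
    have e1 : ((N : ℝ) + 1) * (N.factorial : ℝ) = ((N + 1).factorial : ℝ) := by
      rw [Nat.factorial_succ]; push_cast; ring
    have e2 : ((N + 1).factorial : ℝ) ≤ ((N + 1 : ℕ) : ℝ) ^ (N + 1) := by
      exact_mod_cast Nat.factorial_le_pow (N + 1)
    have e3 : ((N + 1 : ℕ) : ℝ) ≤ 61 * L := by push_cast; linarith
    rw [e1]
    refine e2.trans ?_
    calc ((N + 1 : ℕ) : ℝ) ^ (N + 1) ≤ (61 * L) ^ (N + 1) := by gcongr
      _ = Real.exp (((N + 1 : ℕ) : ℝ) * Real.log (61 * L)) := by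
          rw [Real.exp_nat_mul, Real.exp_log (by linarith)]
      _ ≤ _ := by
          gcongr
          exact Real.log_nonneg (by linarith)
  have h6 : (R ^ 40)⁻¹ = Real.exp (-(40 * L)) := by
    rw [hRL, Real.exp_neg, ← Real.exp_nat_mul]; norm_num
  rw [h6]
  calc _ ≤ Real.exp (61 * L * Real.log (61 * L)) * Real.exp (3 - L ^ 2 / 8) := by
        gcongr
    _ = Real.exp (61 * L * Real.log (61 * L) + (3 - L ^ 2 / 8)) := (Real.exp_add _ _).symm
    _ ≤ _ := by
        apply Real.exp_le_exp.2
        nlinarith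

/-- The coupling of the translates to distant points with independent functions: `e j k` are the
coordinates, with respect to the Gaussian coefficients of the original function, of the first `N + 1`
coefficients of the `j`-th independent function. The field `close` says that the `j`-th function is
close to the `j`-th translate whenever all coefficients are moderate; the field `triangular` says
that the value at the centre of the `j`-th translate is, up to the coefficients of index at least
`D`, a combination of `e j 0` and of the `e i k` with `i < j`. The radius `6` is what the bound for
the increment of the argument along an arc needs. -/
structure Coupling (R : ℝ) {n : ℕ} (w : Fin n → ℂ) (D N : ℕ)
    (e : Fin n → Fin (N + 1) → EuclideanSpace ℂ (Fin D)) : Prop where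
  orthonormal : Orthonormal ℂ fun p : Fin n × Fin (N + 1) => e p.1 p.2
  close : ∀ (a b : ℕ → ℂ) (j : Fin n), (∀ m, ‖a m‖ ≤ R + m) → (∀ k, ‖b k‖ ≤ R + k) →
    (∀ k : Fin (N + 1), b k = ∑ m : Fin D, e j k m * a m) → ∀ z : ℂ, ‖z‖ ≤ 6 →
      ‖∑' m, a m * displaced (w j) m z - ∑' k, b k * fockMonomial k z‖ ≤ (R ^ 22)⁻¹
  triangular : ∀ j, ∃ (s : ℂ) (c : Fin n × Fin (N + 1) → ℂ), 1 / 2 ≤ ‖s‖ ∧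
    (∀ p, j ≤ p.1 → c p = 0) ∧
    ∀ m : Fin D, displaced (w j) m 0 = s * e j 0 m + ∑ p, c p * e p.1 p.2 m
  bounded : ∃ C : ℕ → ℝ, Summable C ∧ (∀ m, 0 ≤ C m) ∧ ∑' m, C m ≤ R ^ 3 ∧
    ∀ j m z, ‖z‖ ≤ 6 → ‖displaced (w j) m z‖ ≤ C m

theorem exists_displaced_majorant {R : ℝ} (hR : 40000000 * Real.exp 288 ≤ R) {n D : ℕ}
    {w : Fin n → ℂ} (hD1 : 80 * R ^ 2 ≤ D) (hD2 : (D : ℝ) ≤ 100 * R ^ 2) (hw : ∀ j, ‖w j‖ = R) :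
    ∃ C : ℕ → ℝ, Summable C ∧ (∀ m, 0 ≤ C m) ∧ ∑' m, C m ≤ R ^ 3 ∧
      ∀ j m z, ‖z‖ ≤ 6 → ‖displaced (w j) m z‖ ≤ C m := by
  have hexp : (1 : ℝ) ≤ Real.exp 288 := Real.one_le_exp (by norm_num)
  have hR1 : (40000000 : ℝ) ≤ R := by nlinarith
  have hR0 : 0 < R := by linarith
  have hg := hasSum_geometric_of_lt_one (Real.exp_nonneg _) exp_neg_half_bounds.1
  have hs1 : Summable fun m : ℕ => if m < D then Real.exp 18 else 0 :=
    summable_of_ne_finset_zero (s := Finset.range D) fun m hm => by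
      rw [Finset.mem_range] at hm; simp [hm]
  refine ⟨fun m => (if m < D then Real.exp 18 else 0) + Real.exp (-(1 / 2)) ^ m,
    hs1.add hg.summable, fun m => ?_, ?_, fun j m z hz => ?_⟩
  · have := pow_nonneg (Real.exp_nonneg (-(1 / 2))) m
    have := Real.exp_nonneg 18
    dsimp only
    split_ifs <;> linarith
  · rw [hs1.tsum_add hg.summable, hg.tsum_eq,
      tsum_eq_sum (s := Finset.range D) (fun m hm => by
        rw [Finset.mem_range] at hm; simp [hm]),
      Finset.sum_congr rfl (fun m hm => if_pos (Finset.mem_range.1 hm)),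
      Finset.sum_const, Finset.card_range, nsmul_eq_mul]
    have h18 : Real.exp 18 ≤ Real.exp 288 := Real.exp_le_exp.2 (by norm_num)
    calc (D : ℝ) * Real.exp 18 + (1 - Real.exp (-(1 / 2)))⁻¹ ≤ 100 * R ^ 2 * Real.exp 288 + 3 :=
          add_le_add (mul_le_mul hD2 h18 (Real.exp_nonneg _) (by positivity))
            exp_neg_half_bounds.2
      _ ≤ R ^ 2 * (101 * Real.exp 288) := by nlinarith [sq_nonneg R]
      _ ≤ R ^ 2 * R := by gcongr; linarith
      _ = R ^ 3 := by ring
  · by_cases hm : m < D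
    · simp only [hm, if_true]
      refine (norm_displaced_le (w j) m z).trans ?_
      have h1 : Real.exp (‖z‖ ^ 2 / 2) ≤ Real.exp 18 := by
        apply Real.exp_le_exp.2; nlinarith [norm_nonneg z]
      have := pow_nonneg (Real.exp_nonneg (-(1 / 2))) m
      linarith
    · simp only [hm, if_false, zero_add]
      have hm' : (D : ℝ) ≤ m := by exact_mod_cast not_lt.1 hm
      refine (norm_displaced_le_of_large (by linarith) (hw j) (hD1.trans hm') hz).trans ?_
      rw [← Real.exp_nat_mul]
      have h1 : Real.exp (-R ^ 2) ≤ 1 := Real.exp_le_one_iff.2 (by nlinarith)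
      have h2 : (m : ℝ) * -(1 / 2) = -m / 2 := by ring
      rw [h2]
      exact mul_le_of_le_one_left (Real.exp_nonneg _) h1

open Filter Topology in
/-- Gram-Schmidt is applied to the Taylor coefficients in the lexicographic order of the pairs
`(j, k)`; this makes the coupling triangular. -/
theorem eventually_exists_coupling : ∀ᶠ R : ℝ in atTop, ∀ (n : ℕ) (w : Fin n → ℂ),
    (n : ℝ) ≤ 8 * R → (∀ j, ‖w j‖ = R) →
    (∀ j k, j ≠ k → 2 / Real.pi * Real.log R ≤ ‖w j - w k‖) →
    ∃ (D N : ℕ) (e : Fin n → Fin (N + 1) → EuclideanSpace ℂ (Fin D)), Coupling R w D N e := by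
  have hK : ∀ᶠ R : ℝ in atTop, 40000000 * Real.exp 288 ≤ R := eventually_ge_atTop _
  filter_upwards [eventually_factorial_gauss_le, hK,
    Real.tendsto_log_atTop.eventually_ge_atTop 10] with R h1 hR hL n w hn hw hsep
  have hexp : (1 : ℝ) ≤ Real.exp 288 := Real.one_le_exp (by norm_num)
  have hR1 : (40000000 : ℝ) ≤ R := by nlinarith
  have hR0 : 0 < R := by linarith
  set L := Real.log R with hLdef
  have hRL : R = Real.exp L := (Real.exp_log hR0).symm
  -- `exp (-N / 2) ≤ R⁻²⁸` controls the tails of the Taylor series, and `D ≥ 80 R²` those in `ζ_m`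
  set N := ⌈56 * L⌉₊ with hN
  set D := ⌈80 * R ^ 2⌉₊ with hD
  have hN1 : 56 * L ≤ N := Nat.le_ceil _
  have hN2 : (N : ℝ) ≤ 60 * L := by
    have := Nat.ceil_lt_add_one (show 0 ≤ 56 * L by linarith)
    linarith
  have hD1 : 80 * R ^ 2 ≤ D := Nat.le_ceil _
  have hD2 : (D : ℝ) ≤ 100 * R ^ 2 := by
    have := Nat.ceil_lt_add_one (show 0 ≤ 80 * R ^ 2 by positivity)
    nlinarith
  set d := 2 / Real.pi * L with hd
  have hd2 : 2 ≤ d := by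
    have : 0.6 ≤ 2 / Real.pi := by
      rw [le_div_iff₀ Real.pi_pos]; linarith [Real.pi_lt_d2]
    nlinarith
  set ε := N.factorial * (Real.exp (1 - (d - 2) ^ 2 / 2) + 2 * Real.exp (-R ^ 2)) with hε
  have hε0 : 0 ≤ ε := by positivity
  have hε1 : (N + 1) * ε ≤ (R ^ 40)⁻¹ := by
    have := h1 N hN2
    rw [hε, ← mul_assoc]; exact this
  let v : Fin (n * (N + 1)) → EuclideanSpace ℂ (Fin D) := fun a =>
    displacedCoeff D (w (finProdFinEquiv.symm a).1) (finProdFinEquiv.symm a).2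
  have hwinj : ∀ i j, w i = w j → i = j := by
    intro i j hij
    by_contra hne
    have := hsep i j hne
    rw [hij, sub_self, norm_zero] at this
    linarith
  have hMε : ((n * (N + 1) : ℕ) : ℝ) * ε ≤ (R ^ 38)⁻¹ := by
    push_cast
    calc (n : ℝ) * (N + 1) * ε = n * ((N + 1) * ε) := by ring
      _ ≤ (8 * R) * (R ^ 40)⁻¹ := by gcongr
      _ = 8 / R * (R ^ 38)⁻¹ := by field_simp
      _ ≤ 1 * (R ^ 38)⁻¹ := by
          gcongr
          rw [div_le_one hR0]; linarith
      _ = _ := one_mul _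
  have hR38 : (R ^ 38)⁻¹ ≤ R⁻¹ := by
    apply inv_anti₀ hR0
    exact le_self_pow₀ (by linarith) (by norm_num)
  have hRinv : R⁻¹ ≤ 1 / 8 := by
    rw [inv_le_comm₀ hR0 (by norm_num)]; linarith
  obtain ⟨e, he, hve⟩ := exists_orthonormal_near v (ε := ε) (by
    have : 8 * ((n * (N + 1) : ℕ) : ℝ) * ε ≤ 8 * (1 / 8) := by
      rw [mul_assoc]; linarith
    linarith) (fun a b => by
      have h2 := displacedCoeff_almost_orthonormal (R := R) (d := d) (by linarith) hd2 hD1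
        (hw (finProdFinEquiv.symm a).1) (hw (finProdFinEquiv.symm b).1) (N := N)
        (k := (finProdFinEquiv.symm a).2) (k' := (finProdFinEquiv.symm b).2) (by
          by_cases h : (finProdFinEquiv.symm a).1 = (finProdFinEquiv.symm b).1
          · left; rw [h]
          · right; exact hsep _ _ h) (Nat.lt_succ_iff.1 (Fin.is_lt _))
          (Nat.lt_succ_iff.1 (Fin.is_lt _))
      have h3 : (w (finProdFinEquiv.symm a).1 = w (finProdFinEquiv.symm b).1 ∧
          ((finProdFinEquiv.symm a).2 : ℕ) = (finProdFinEquiv.symm b).2) ↔ a = b := by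
        constructor
        · rintro ⟨p, q⟩
          exact finProdFinEquiv.symm.injective (Prod.ext (hwinj _ _ p) (Fin.ext q))
        · rintro rfl; exact ⟨rfl, rfl⟩
      simp only [h3] at h2
      exact h2)
  refine ⟨D, N, fun j k => e (finProdFinEquiv (j, k)), ?_, ?_, ?_, ?_⟩
  · exact he.comp (fun p : Fin n × Fin (N + 1) => finProdFinEquiv p) finProdFinEquiv.injective
  · intro a b j ha hb hab z hz
    have hκ : ∀ k : Fin (N + 1), ‖displacedCoeff D (w j) k - e (finProdFinEquiv (j, k))‖ ≤
        5 * (R ^ 38)⁻¹ := by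
      intro k
      have := (hve (finProdFinEquiv (j, k))).1
      simp only [v, Equiv.symm_apply_apply] at this
      refine this.trans ?_
      rw [mul_assoc]
      linarith
    refine (norm_displaced_sub_series_le (by linarith) hD1 (hw j) hκ ha hb hab hz).trans ?_
    have e1 : Real.exp (-N / 2 : ℝ) ≤ (R ^ 28)⁻¹ := by
      rw [hRL, ← Real.exp_nat_mul, ← Real.exp_neg]
      apply Real.exp_le_exp.2
      push_cast
      linarith
    have e2 : Real.exp (-R ^ 2) ≤ (R ^ 28)⁻¹ := by
      have hRL' : (R ^ 28)⁻¹ = Real.exp (-(28 * L)) := by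
        rw [hRL, ← Real.exp_nat_mul, ← Real.exp_neg]; norm_num
      rw [hRL']
      apply Real.exp_le_exp.2
      have : L ≤ R := by
        have := Real.add_one_le_exp L
        rw [← hRL] at this; linarith
      nlinarith
    have e3 : (R ^ 38)⁻¹ ≤ (R ^ 28)⁻¹ :=
      inv_anti₀ (by positivity) (pow_le_pow_right₀ (by linarith) (by norm_num))
    have e4 : (D : ℝ) * (R + D) ≤ 20000 * R ^ 4 := by
      have : R + D ≤ 200 * R ^ 2 := by nlinarith
      calc (D : ℝ) * (R + D) ≤ (100 * R ^ 2) * (200 * R ^ 2) := by gcongr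
        _ = _ := by ring
    have e5 : R ≤ R ^ 4 := le_self_pow₀ (by linarith) (by norm_num)
    calc _ ≤ 20 * Real.exp 288 * (20000 * R ^ 4 * ((R ^ 28)⁻¹ + 5 * (R ^ 28)⁻¹) +
          R ^ 4 * (R ^ 28)⁻¹ + R ^ 4 * (R ^ 28)⁻¹) := by gcongr
      _ = (2400040 * Real.exp 288) * (R ^ 4 * (R ^ 28)⁻¹) := by ring
      _ ≤ R * (R ^ 4 * (R ^ 28)⁻¹) := by gcongr; nlinarith
      _ = (R ^ 23)⁻¹ := by field_simp
      _ ≤ _ := inv_anti₀ (by positivity) (pow_le_pow_right₀ (by linarith) (by norm_num))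
  · intro j
    obtain ⟨c, hc1, hc2, hc3⟩ := (hve (finProdFinEquiv (j, 0))).2
    refine ⟨c (finProdFinEquiv (j, 0)), fun p => if p = (j, 0) then 0 else c (finProdFinEquiv p),
      hc3, ?_, ?_⟩
    · intro p hp
      simp only
      split_ifs with hp0
      · rfl
      · apply hc2
        rw [Fin.lt_def]
        rcases p with ⟨i, k⟩
        simp only [finProdFinEquiv_apply_val, Fin.val_zero, zero_add]
        simp only at hp
        rcases hp.eq_or_lt with rfl | hlt
        · have hk : k ≠ 0 := fun h => hp0 (by rw [h])
          have : 0 < (k : ℕ) := Nat.pos_of_ne_zero fun h => hk (Fin.ext h)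
          omega
        · have : (N + 1) * (j : ℕ) < (N + 1) * (i : ℕ) :=
            Nat.mul_lt_mul_of_pos_left hlt (by omega)
          omega
    · intro m
      have h2 : v (finProdFinEquiv (j, 0)) m = displaced (w j) m 0 := by
        simp only [v, Equiv.symm_apply_apply]
        simp [displacedCoeff, taylorCoeff]
      rw [← h2, hc1]
      rw [← finProdFinEquiv.sum_comp,
        ← Finset.add_sum_erase _ _ (Finset.mem_univ (j, (0 : Fin (N + 1))))]
      rw [← Finset.add_sum_erase Finset.univ (fun p : Fin n × Fin (N + 1) =>
        (if p = (j, 0) then 0 else c (finProdFinEquiv p)) * _)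
        (Finset.mem_univ (j, (0 : Fin (N + 1))))]
      simp only [if_true, zero_mul, zero_add]
      rw [PiLp.add_apply, PiLp.smul_apply, smul_eq_mul]
      congr 1
      rw [WithLp.ofLp_sum, Finset.sum_apply]
      refine Finset.sum_congr rfl fun p hp => ?_
      rw [if_neg (Finset.ne_of_mem_erase hp)]
      rfl
  · exact exists_displaced_majorant (by linarith) hD1 hD2 hw

/-! ### Increments of the argument -/

theorem argIncrement_mul_exp {h : ℝ → ℂ} {a b : ℝ} (hab : a ≤ b) (hc : ContinuousOn h (Icc a b))
    (h0 : ∀ t ∈ Icc a b, h t ≠ 0) {φ : ℝ → ℂ} (hφ : ContinuousOn φ (Icc a b)) :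
    argIncrement (fun t => h t * Complex.exp (φ t)) a b =
      argIncrement h a b + ((φ b).im - (φ a).im) := by
  obtain ⟨θ, hθ⟩ := exists_isArgBranch hab hc h0
  have h2 : IsArgBranch (fun t => h t * Complex.exp (φ t)) a b fun t => θ t + (φ t).im := by
    refine ⟨hθ.1.add (Complex.continuous_im.comp_continuousOn hφ), fun t ht =>
      ⟨mul_ne_zero (h0 t ht) (Complex.exp_ne_zero _), ?_⟩⟩
    have e : Complex.exp (φ t) = (Real.exp (φ t).re : ℂ) * Complex.exp ((φ t).im * Complex.I) := by
      rw [Complex.ofReal_exp, ← Complex.exp_add, Complex.re_add_im]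
    have hh := (hθ.2 t ht).2
    calc h t * Complex.exp (φ t) = ((‖h t‖ : ℂ) * Complex.exp ((θ t : ℂ) * Complex.I)) *
          ((Real.exp (φ t).re : ℂ) * Complex.exp ((φ t).im * Complex.I)) := by rw [← hh, ← e]
      _ = _ := by
          rw [norm_mul, Complex.norm_exp]
          push_cast
          rw [add_mul, Complex.exp_add]
          ring
  rw [argIncrement_eq hab hθ, argIncrement_eq hab h2]
  ring

/-- A relative perturbation `u = (h₂ - h₁) / h₁` of absolute value at most `1 / 2` changes the argument
by the principal argument of `1 + u`. -/
theorem abs_argIncrement_sub_le {h₁ h₂ : ℝ → ℂ} {a b δ η : ℝ} (hab : a ≤ b) (hδ : 0 < δ)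
    (hη : η ≤ δ) (hc₁ : ContinuousOn h₁ (Icc a b)) (hc₂ : ContinuousOn h₂ (Icc a b))
    (h1 : ∀ t ∈ Icc a b, 2 * δ ≤ ‖h₁ t‖) (h2 : ∀ t ∈ Icc a b, ‖h₂ t - h₁ t‖ ≤ η) :
    |argIncrement h₂ a b - argIncrement h₁ a b| ≤ 2 * (η / δ) := by
  have h0 : ∀ t ∈ Icc a b, h₁ t ≠ 0 := fun t ht h => by
    have := h1 t ht
    rw [h, norm_zero] at this
    linarith
  obtain ⟨θ, hθ⟩ := exists_isArgBranch hab hc₁ h0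
  have hη0 : 0 ≤ η := (norm_nonneg _).trans (h2 a (left_mem_Icc.2 hab))
  set u : ℝ → ℂ := fun t => (h₂ t - h₁ t) / h₁ t with hu
  have hun : ∀ t ∈ Icc a b, ‖u t‖ ≤ η / (2 * δ) := fun t ht => by
    rw [hu]; simp only [norm_div]
    exact div_le_div₀ hη0 (h2 t ht) (by positivity) (h1 t ht)
  have hhalf : η / (2 * δ) ≤ 1 / 2 := by
    rw [div_le_iff₀ (by positivity)]; linarith
  have hsl : ∀ t ∈ Icc a b, 1 + u t ∈ Complex.slitPlane := fun t ht =>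
    Complex.mem_slitPlane_of_norm_lt_one ((hun t ht).trans_lt (by linarith))
  have harg : ∀ t ∈ Icc a b, |(1 + u t).arg| ≤ 3 / 2 * (η / (2 * δ)) := fun t ht => by
    rw [← Complex.log_im]
    refine (Complex.abs_im_le_norm _).trans ?_
    refine (Complex.norm_log_one_add_half_le_self ((hun t ht).trans hhalf)).trans ?_
    have := hun t ht
    gcongr
  have hbr : IsArgBranch h₂ a b fun t => θ t + (1 + u t).arg := by
    refine ⟨hθ.1.add (ContinuousOn.comp (t := Complex.slitPlane)
      (fun z hz => (Complex.continuousAt_arg hz).continuousWithinAt)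
      (continuousOn_const.add ((hc₂.sub hc₁).div hc₁ h0)) hsl), fun t ht => ?_⟩
    have he : h₂ t = h₁ t * (1 + u t) := by
      simp only [hu]; field_simp [h0 t ht]; ring
    refine ⟨?_, ?_⟩
    · rw [he]
      exact mul_ne_zero (h0 t ht) (Complex.slitPlane_ne_zero (hsl t ht))
    · rw [he, norm_mul]
      nth_rewrite 1 [(hθ.2 t ht).2, ← Complex.norm_mul_exp_arg_mul_I (1 + u t)]
      push_cast
      rw [add_mul, Complex.exp_add]
      ring
  rw [argIncrement_eq hab hθ, argIncrement_eq hab hbr]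
  have e : θ b + (1 + u b).arg - (θ a + (1 + u a).arg) - (θ b - θ a) =
      (1 + u b).arg - (1 + u a).arg := by ring
  rw [e]
  refine (abs_sub _ _).trans ((add_le_add (harg b (right_mem_Icc.2 hab))
    (harg a (left_mem_Icc.2 hab))).trans ?_)
  have : 0 ≤ η / δ := by positivity
  have e2 : η / (2 * δ) = η / δ / 2 := by field_simp
  rw [e2]; linarith

/-- A bounded holomorphic function has few zeros: each zero in the unit disc costs a factor `2`. -/
theorem two_pow_card_mul_norm_le {s : Finset ℂ} : ∀ {Φ : ℂ → ℂ} {M : ℝ}, Differentiable ℂ Φ →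
    (∀ z, ‖z‖ ≤ 3 → ‖Φ z‖ ≤ M) → (∀ a ∈ s, ‖a‖ ≤ 1 ∧ Φ a = 0) → 2 ^ s.card * ‖Φ 0‖ ≤ M := by
  induction s using Finset.induction_on with
  | empty => intro Φ M _ hM _; simpa using hM 0 (by simp)
  | insert a s ha ih =>
    intro Φ M hΦ hM hs
    have ha1 := (hs a (Finset.mem_insert_self _ _)).1
    have hΦa := (hs a (Finset.mem_insert_self _ _)).2
    have hd : Differentiable ℂ (dslope Φ a) := fun z => by
      have := (Complex.differentiableOn_dslope (s := univ) (c := a) (f := Φ) Filter.univ_mem).2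
        hΦ.differentiableOn
      exact this.differentiableAt Filter.univ_mem
    have hmul : ∀ z, (z - a) * dslope Φ a z = Φ z := fun z => by
      have := sub_smul_dslope Φ a z
      rw [smul_eq_mul, hΦa, sub_zero] at this
      exact this
    have hM' : ∀ z, ‖z‖ ≤ 3 → ‖dslope Φ a z‖ ≤ M / 2 := by
      have hfr : ∀ z ∈ frontier (Metric.ball (0 : ℂ) 3), ‖dslope Φ a z‖ ≤ M / 2 := by
        intro z hz
        rw [frontier_ball _ (by norm_num), mem_sphere_zero_iff_norm] at hz
        have h1 : 2 ≤ ‖z - a‖ := by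
          have := norm_sub_norm_le z a
          linarith
        have h2 := hM z hz.le
        rw [← hmul z, norm_mul] at h2
        rw [le_div_iff₀ (by norm_num)]
        nlinarith [norm_nonneg (dslope Φ a z)]
      intro z hz
      refine Complex.norm_le_of_forall_mem_frontier_norm_le Metric.isBounded_ball
        hd.diffContOnCl hfr ?_
      rw [closure_ball _ (by norm_num)]
      simpa using hz
    have hs' : ∀ b ∈ s, ‖b‖ ≤ 1 ∧ dslope Φ a b = 0 := fun b hb => by
      refine ⟨(hs b (Finset.mem_insert_of_mem hb)).1, ?_⟩
      have h1 := hmul b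
      rw [(hs b (Finset.mem_insert_of_mem hb)).2] at h1
      refine (mul_eq_zero.1 h1).resolve_left (sub_ne_zero.2 ?_)
      rintro rfl; exact ha hb
    have h3 := ih hd hM' hs'
    rw [Finset.card_insert_of_notMem ha, pow_succ]
    have h4 : ‖Φ 0‖ ≤ ‖dslope Φ a 0‖ := by
      rw [← hmul 0, norm_mul, zero_sub, norm_neg]
      exact mul_le_of_le_one_left (norm_nonneg _) ha1
    have h5 : (0 : ℝ) ≤ 2 ^ s.card := by positivity
    nlinarith

theorem differentiable_conj_conj {u : ℂ → ℂ} (hu : Differentiable ℂ u) :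
    Differentiable ℂ fun z => (starRingEnd ℂ) (u ((starRingEnd ℂ) z)) := by
  intro z
  have := (hu ((starRingEnd ℂ) z)).conj_conj
  simpa [Function.comp_def] using this

/-- Backlund's bound for the increment of the argument: the function `u` is multiplied by a
constant so that `u 0 > 0`; whenever the argument changes by `π`, the real part of `u` has a zero,
and the real part of `u` on the real line extends to an entire function, so that Jensen's bound for
the number of its zeros applies. -/
theorem abs_argIncrement_le_log {u : ℂ → ℂ} (hu : Differentiable ℂ u) {M : ℝ}
    (hM : ∀ z, ‖z‖ ≤ 3 → ‖u z‖ ≤ M) {a b : ℝ} (ha : -1 ≤ a) (hab : a ≤ b) (hb : b ≤ 1)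
    (h0 : ∀ t ∈ Icc a b, u t ≠ 0) (hu0 : u 0 ≠ 0) :
    |argIncrement (fun t => u t) a b| ≤ Real.pi * (1 + Real.log (M / ‖u 0‖) / Real.log 2) := by
  obtain ⟨θ, hθ⟩ := exists_isArgBranch (h := fun t : ℝ => u t) hab
    (hu.continuous.comp Complex.continuous_ofReal).continuousOn h0
  rw [argIncrement_eq hab hθ]
  have hpi := Real.pi_pos
  have hun0 : 0 < ‖u 0‖ := norm_pos_iff.2 hu0
  set α := (u 0).arg with hα
  set ρ : ℂ := Complex.exp (-α * Complex.I) with hρ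
  have hρn : ‖ρ‖ = 1 := by
    rw [hρ, ← Complex.ofReal_neg]; exact Complex.norm_exp_ofReal_mul_I _
  have hρu : ρ * u 0 = (‖u 0‖ : ℂ) := by
    rw [hρ]; nth_rewrite 1 [← Complex.norm_mul_exp_arg_mul_I (u 0)]
    rw [mul_left_comm, ← Complex.exp_add, ← hα]; simp
  -- `Φ` is entire and agrees with the real part of `ρ u` on the real line
  set Φ : ℂ → ℂ := fun z => (ρ * u z + (starRingEnd ℂ) (ρ * u ((starRingEnd ℂ) z))) / 2 with hΦ
  have hΦd : Differentiable ℂ Φ := by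
    have h1 : Differentiable ℂ fun z => ρ * u z := hu.const_mul ρ
    exact (h1.add (differentiable_conj_conj h1)).div_const 2
  have hΦ0 : ‖Φ 0‖ = ‖u 0‖ := by
    simp only [hΦ, map_zero, hρu, Complex.conj_ofReal]
    rw [add_self_div_two]; simp
  have hΦM : ∀ z, ‖z‖ ≤ 3 → ‖Φ z‖ ≤ M := fun z hz => by
    have h1 := hM z hz
    have h2 := hM ((starRingEnd ℂ) z) (by rwa [Complex.norm_conj])
    simp only [hΦ, norm_div, Complex.norm_ofNat]
    have h3 := norm_add_le (ρ * u z) ((starRingEnd ℂ) (ρ * u ((starRingEnd ℂ) z)))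
    rw [Complex.norm_conj, norm_mul, norm_mul, hρn] at h3
    rw [div_le_iff₀ (by norm_num)]
    linarith
  have hΦz : ∀ t ∈ Icc a b, Real.cos (θ t - α) = 0 → Φ t = 0 := by
    intro t ht hcos
    have h1 : ρ * u t = (‖u t‖ : ℂ) * Complex.exp (((θ t - α : ℝ) : ℂ) * Complex.I) := by
      have h2 : u t = (‖u t‖ : ℂ) * Complex.exp ((θ t : ℂ) * Complex.I) := (hθ.2 t ht).2
      nth_rewrite 1 [h2]
      rw [hρ, mul_left_comm, ← Complex.exp_add]
      congr 2; push_cast; ring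
    simp only [hΦ, Complex.conj_ofReal]
    rw [h1, map_mul, ← Complex.exp_conj, map_mul, Complex.conj_ofReal, Complex.conj_ofReal,
      Complex.conj_I, ← mul_add]
    have h3 : Complex.exp (((θ t - α : ℝ) : ℂ) * Complex.I) +
        Complex.exp (((θ t - α : ℝ) : ℂ) * -Complex.I) = 2 * Complex.cos ((θ t - α : ℝ) : ℂ) := by
      rw [Complex.cos, mul_neg, neg_mul]; ring
    rw [h3, ← Complex.ofReal_cos, hcos]; simp
  -- the number of zeros of the real part forced by the intermediate value theorem
  set K := ⌊|θ b - θ a| / Real.pi⌋₊ with hK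
  have hKle : (K : ℝ) * Real.pi ≤ |θ b - θ a| := by
    rw [← le_div_iff₀ hpi]
    exact Nat.floor_le (by positivity)
  have hlt : |θ b - θ a| < (K + 1) * Real.pi := by
    rw [← div_lt_iff₀ hpi]
    exact Nat.lt_floor_add_one _
  set lo := min (θ a) (θ b) with hlo
  have hrange : ∀ y, lo ≤ y → y ≤ lo + |θ b - θ a| → ∃ t ∈ Icc a b, θ t = y := by
    intro y hy1 hy2
    rcases le_total (θ a) (θ b) with h | h
    · rw [hlo, min_eq_left h] at hy1 hy2
      rw [abs_of_nonneg (by linarith)] at hy2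
      exact intermediate_value_Icc hab hθ.1 ⟨hy1, by linarith⟩
    · rw [hlo, min_eq_right h] at hy1 hy2
      rw [abs_of_nonpos (by linarith)] at hy2
      exact intermediate_value_Icc' hab hθ.1 ⟨hy1, by linarith⟩
  obtain ⟨m, hm1, hm2⟩ : ∃ m : ℤ, lo ≤ α + Real.pi / 2 + m * Real.pi ∧
      α + Real.pi / 2 + m * Real.pi < lo + Real.pi := by
    refine ⟨⌈(lo - α - Real.pi / 2) / Real.pi⌉, ?_, ?_⟩
    · have := (div_le_iff₀ hpi).1 (Int.le_ceil ((lo - α - Real.pi / 2) / Real.pi))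
      linarith
    · have := Int.ceil_lt_add_one ((lo - α - Real.pi / 2) / Real.pi)
      rw [← sub_lt_iff_lt_add, lt_div_iff₀ hpi] at this
      linarith
  have hex : ∀ i : Fin K, ∃ t ∈ Icc a b, θ t = α + Real.pi / 2 + m * Real.pi + i * Real.pi := by
    intro i
    have hi : ((i : ℕ) : ℝ) + 1 ≤ K := by exact_mod_cast i.2
    refine hrange _ ?_ ?_
    · have : 0 ≤ ((i : ℕ) : ℝ) * Real.pi := by positivity
      linarith
    · nlinarith
  choose t ht hθt using hex
  have htinj : Function.Injective fun i => ((t i : ℝ) : ℂ) := by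
    intro i j hij
    have h1 : t i = t j := Complex.ofReal_injective hij
    have h2 := hθt i
    rw [h1, hθt j] at h2
    have h3 : ((j : ℕ) : ℝ) * Real.pi = ((i : ℕ) : ℝ) * Real.pi := by linarith
    have h4 : ((j : ℕ) : ℝ) = ((i : ℕ) : ℝ) := mul_right_cancel₀ hpi.ne' h3
    exact Fin.ext (by exact_mod_cast h4.symm)
  have hcount := two_pow_card_mul_norm_le (s := Finset.univ.map ⟨_, htinj⟩) hΦd hΦM (by
    intro z hz
    simp only [Finset.mem_map, Finset.mem_univ, true_and, Function.Embedding.coeFn_mk] at hz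
    obtain ⟨i, rfl⟩ := hz
    refine ⟨?_, hΦz _ (ht i) ?_⟩
    · rw [Complex.norm_real, Real.norm_eq_abs, abs_le]
      exact ⟨ha.trans (ht i).1, (ht i).2.trans hb⟩
    · rw [hθt i, Real.cos_eq_zero_iff]
      refine ⟨m + i, ?_⟩
      push_cast; ring)
  rw [Finset.card_map, Finset.card_univ, Fintype.card_fin, hΦ0] at hcount
  have h2 : (K : ℝ) ≤ Real.log (M / ‖u 0‖) / Real.log 2 := by
    rw [le_div_iff₀ (Real.log_pos (by norm_num)), ← Real.log_pow]
    apply Real.log_le_log (by positivity)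
    rwa [le_div_iff₀ hun0]
  nlinarith

open Filter Topology in
/-- The increment of the argument is the limit of the sums of the principal arguments of the
quotients of consecutive values on uniform partitions. -/
theorem tendsto_sum_arg_argIncrement {h : ℝ → ℂ} {a b : ℝ} (hab : a ≤ b)
    (hc : ContinuousOn h (Icc a b)) (h0 : ∀ t ∈ Icc a b, h t ≠ 0) :
    Tendsto (fun N : ℕ => ∑ i ∈ Finset.range (N + 1),
      (h (a + (i + 1 : ℕ) * ((b - a) / (N + 1))) / h (a + i * ((b - a) / (N + 1)))).arg)
      atTop (𝓝 (argIncrement h a b)) := by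
  obtain ⟨θ, hθ⟩ := exists_isArgBranch hab hc h0
  rw [argIncrement_eq hab hθ]
  have huc := isCompact_Icc.uniformContinuousOn_of_continuous hθ.1
  rw [Metric.uniformContinuousOn_iff] at huc
  obtain ⟨d, hd, huc⟩ := huc Real.pi Real.pi_pos
  have hstep : Tendsto (fun N : ℕ => (b - a) / ((N : ℝ) + 1)) atTop (𝓝 0) :=
    Tendsto.div_atTop tendsto_const_nhds
      (tendsto_atTop_add_const_right _ _ tendsto_natCast_atTop_atTop)
  refine tendsto_const_nhds.congr' ?_
  filter_upwards [hstep.eventually (gt_mem_nhds hd)] with N hN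
  set p : ℕ → ℝ := fun i => a + i * ((b - a) / (N + 1)) with hp
  have hN1 : (0 : ℝ) < (N : ℝ) + 1 := by positivity
  have hpm : ∀ i, i ≤ N + 1 → p i ∈ Icc a b := by
    intro i hi
    have h1 : (i : ℝ) ≤ N + 1 := by exact_mod_cast hi
    have h2 : (i : ℝ) * ((b - a) / (N + 1)) ≤ b - a := by
      calc (i : ℝ) * ((b - a) / (N + 1)) ≤ (N + 1) * ((b - a) / (N + 1)) := by
            gcongr
        _ = b - a := by field_simp
    have h3 : 0 ≤ (i : ℝ) * ((b - a) / (N + 1)) :=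
      mul_nonneg (by positivity) (div_nonneg (by linarith) hN1.le)
    exact ⟨by simp only [hp]; linarith, by simp only [hp]; linarith⟩
  have hterm : ∀ i ∈ Finset.range (N + 1), (h (p (i + 1)) / h (p i)).arg =
      θ (p (i + 1)) - θ (p i) := by
    intro i hi
    have hi' := Finset.mem_range.1 hi
    have m1 := hpm (i + 1) hi'
    have m0 := hpm i hi'.le
    have hdist : dist (θ (p (i + 1))) (θ (p i)) < Real.pi := by
      apply huc _ m1 _ m0
      have : p (i + 1) - p i = (b - a) / (N + 1) := by simp only [hp]; push_cast; ring
      rw [Real.dist_eq, this, abs_of_nonneg (div_nonneg (by linarith) hN1.le)]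
      exact hN
    rw [Real.dist_eq, abs_lt] at hdist
    have hq : h (p (i + 1)) / h (p i) = ((‖h (p (i + 1))‖ / ‖h (p i)‖ : ℝ) : ℂ) *
        Complex.exp (((θ (p (i + 1)) - θ (p i) : ℝ) : ℂ) * Complex.I) := by
      nth_rewrite 1 [(hθ.2 _ m1).2, (hθ.2 _ m0).2]
      push_cast
      rw [sub_mul, Complex.exp_sub]
      have n1 : (‖h (p i)‖ : ℂ) ≠ 0 := by simpa using h0 _ m0
      have n2 := Complex.exp_ne_zero ((θ (p i) : ℂ) * Complex.I)
      field_simp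
    have hr : 0 < ‖h (p (i + 1))‖ / ‖h (p i)‖ :=
      div_pos (norm_pos_iff.2 (h0 _ m1)) (norm_pos_iff.2 (h0 _ m0))
    rw [hq, Complex.exp_mul_I, Complex.arg_mul_cos_add_sin_mul_I hr ⟨by linarith, by linarith⟩]
  rw [Finset.sum_congr rfl hterm, Finset.sum_range_sub (fun i => θ (p i))]
  simp only [hp]
  congr 2
  · push_cast; field_simp; ring
  · simp

/-! ### Random series -/

theorem measurable_tsum_mul_const {Ω : Type*} {m : MeasurableSpace Ω} {f : ℕ → Ω → ℂ}
    (hf : ∀ k, Measurable (f k)) (c : ℕ → ℂ) : Measurable fun ω => ∑' k, f k ω * c k :=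
  Measurable.tsum fun k => (hf k).mul_const _

/-- The entire function with the normalized Taylor coefficients `a k`. -/
noncomputable def gefSeries (a : ℕ → ℂ) (z : ℂ) : ℂ := ∑' k, a k * fockMonomial k z

theorem measurable_gefSeries_apply {Ω : Type*} {m : MeasurableSpace Ω} {a : ℕ → Ω → ℂ}
    (ha : ∀ k, Measurable (a k)) (z : ℂ) : Measurable fun ω => gefSeries (fun k => a k ω) z :=
  measurable_tsum_mul_const ha _

theorem norm_fockMonomial_le' {ρ : ℝ} (k : ℕ) {z : ℂ} (hz : ‖z‖ ≤ ρ) :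
    ‖fockMonomial k z‖ ≤ Real.exp (8 * ρ ^ 2) * Real.exp (-k : ℝ) := by
  rw [fockMonomial, norm_div, norm_pow, Complex.norm_real, Real.norm_of_nonneg (Real.sqrt_nonneg _)]
  have hρ : 0 ≤ ρ := (norm_nonneg z).trans hz
  calc _ ≤ ρ ^ k / Real.sqrt (k.factorial : ℝ) := by gcongr
    _ ≤ _ := pow_div_sqrt_factorial_le hρ k

theorem norm_pow_sub_pow_le {z z' : ℂ} {ρ : ℝ} (hρ : 1 ≤ ρ) (hz : ‖z‖ ≤ ρ) (hz' : ‖z'‖ ≤ ρ)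
    (k : ℕ) : ‖z ^ k - z' ^ k‖ ≤ k * ρ ^ k * ‖z - z'‖ := by
  rw [← Commute.mul_geom_sum₂ (Commute.all z z') k, norm_mul, mul_comm]
  gcongr
  calc _ ≤ ∑ i ∈ Finset.range k, ρ ^ k := by
        refine (norm_sum_le _ _).trans (Finset.sum_le_sum fun i hi => ?_)
        have hi' := Finset.mem_range.1 hi
        rw [norm_mul, norm_pow, norm_pow]
        calc _ ≤ ρ ^ i * ρ ^ (k - 1 - i) := by gcongr
          _ = ρ ^ (k - 1) := by rw [← pow_add]; congr 1; omega
          _ ≤ ρ ^ k := pow_le_pow_right₀ hρ (by omega)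
    _ = _ := by simp

/-- Coefficients of size at most `R + k` are absorbed by the decay of the normalized monomials and of
their differences. -/
theorem moderate_mul_exp_le {R : ℝ} (hR : 1 ≤ R) (k : ℕ) :
    (R + k) * k * Real.exp (-k : ℝ) ≤ 8 * R * Real.exp (-(1 / 4)) ^ k := by
  have h1 := one_add_le_two_mul_exp_half k
  have h2 := Real.add_one_le_exp (k / 4 : ℝ)
  have hk : (0 : ℝ) ≤ k := by positivity
  calc (R + k) * k * Real.exp (-k : ℝ) ≤
        (R * (2 * Real.exp (k / 2 : ℝ))) * (4 * Real.exp (k / 4 : ℝ)) * Real.exp (-k : ℝ) := by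
        gcongr
        · nlinarith
        · linarith
    _ = 8 * R * (Real.exp (k / 2 : ℝ) * Real.exp (k / 4 : ℝ) * Real.exp (-k : ℝ)) := by ring
    _ = 8 * R * Real.exp (-(1 / 4)) ^ k := by
        rw [← Real.exp_add, ← Real.exp_add, ← Real.exp_nat_mul]
        congr 2; ring

theorem moderate_mul_exp_le' {R : ℝ} (hR : 1 ≤ R) (k : ℕ) :
    (R + k) * Real.exp (-k : ℝ) ≤ 2 * R * Real.exp (-(1 / 2)) ^ k := by
  have h1 := one_add_le_two_mul_exp_half k
  have hk : (0 : ℝ) ≤ k := by positivity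
  calc (R + k) * Real.exp (-k : ℝ) ≤ (R * (2 * Real.exp (k / 2 : ℝ))) * Real.exp (-k : ℝ) := by
        gcongr
        nlinarith
    _ = 2 * R * (Real.exp (k / 2 : ℝ) * Real.exp (-k : ℝ)) := by ring
    _ = _ := by
        rw [← Real.exp_add, ← Real.exp_nat_mul]
        congr 2; ring

section
variable {a : ℕ → ℂ} {R : ℝ}

theorem norm_mul_fockMonomial_le (hR : 1 ≤ R) (ha : ∀ k, ‖a k‖ ≤ R + k) {ρ : ℝ} {z : ℂ}
    (hz : ‖z‖ ≤ ρ) (k : ℕ) : ‖a k * fockMonomial k z‖ ≤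
      Real.exp (8 * ρ ^ 2) * (2 * R) * Real.exp (-(1 / 2)) ^ k := by
  rw [norm_mul]
  calc _ ≤ (R + k) * (Real.exp (8 * ρ ^ 2) * Real.exp (-k : ℝ)) := by
        gcongr
        · exact ha k
        · exact norm_fockMonomial_le' k hz
    _ = Real.exp (8 * ρ ^ 2) * ((R + k) * Real.exp (-k : ℝ)) := by ring
    _ ≤ Real.exp (8 * ρ ^ 2) * (2 * R * Real.exp (-(1 / 2)) ^ k) :=
        mul_le_mul_of_nonneg_left (moderate_mul_exp_le' hR k) (Real.exp_nonneg _)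
    _ = _ := by ring

theorem summable_mul_fockMonomial (hR : 1 ≤ R) (ha : ∀ k, ‖a k‖ ≤ R + k) (z : ℂ) :
    Summable fun k => a k * fockMonomial k z :=
  .of_norm_bounded ((summable_geometric_of_lt_one (Real.exp_nonneg _)
    exp_neg_half_bounds.1).mul_left _) (norm_mul_fockMonomial_le hR ha le_rfl)

theorem differentiable_gefSeries (hR : 1 ≤ R) (ha : ∀ k, ‖a k‖ ≤ R + k) :
    Differentiable ℂ (gefSeries a) := by
  intro z
  have h : DifferentiableOn ℂ (gefSeries a) (Metric.ball 0 (‖z‖ + 1)) := by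
    refine Complex.differentiableOn_tsum_of_summable_norm
      ((summable_geometric_of_lt_one (Real.exp_nonneg _) exp_neg_half_bounds.1).mul_left
        (Real.exp (8 * (‖z‖ + 1) ^ 2) * (2 * R))) (fun k => ?_) Metric.isOpen_ball
      (fun k w hw => norm_mul_fockMonomial_le hR ha (by simpa using (Metric.mem_ball.1 hw).le) k)
    unfold fockMonomial
    fun_prop
  exact h.differentiableAt (Metric.isOpen_ball.mem_nhds (by simp))

/-- A Lipschitz bound on the disc of radius `ρ` for a function with moderate coefficients. -/
theorem norm_gefSeries_sub_le (hR : 1 ≤ R) (ha : ∀ k, ‖a k‖ ≤ R + k) {ρ : ℝ} (hρ : 1 ≤ ρ)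
    {z z' : ℂ} (hz : ‖z‖ ≤ ρ) (hz' : ‖z'‖ ≤ ρ) :
    ‖gefSeries a z - gefSeries a z'‖ ≤ 40 * R * Real.exp (8 * ρ ^ 2) * ‖z - z'‖ := by
  rw [gefSeries, gefSeries, ← (summable_mul_fockMonomial hR ha z).tsum_sub
    (summable_mul_fockMonomial hR ha z')]
  refine (summable_and_norm_tsum_le_of_geometric
    (A := 8 * R * Real.exp (8 * ρ ^ 2) * ‖z - z'‖) (Real.exp_nonneg _)
    exp_neg_quarter_bounds.1 exp_neg_quarter_bounds.2 (by positivity) fun k => ?_).2.trans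
      (le_of_eq (by ring))
  rw [← mul_sub, norm_mul, fockMonomial, fockMonomial, ← sub_div, norm_div, Complex.norm_real,
    Real.norm_of_nonneg (Real.sqrt_nonneg _)]
  calc _ ≤ (R + k) * (k * ρ ^ k * ‖z - z'‖ / Real.sqrt (k.factorial : ℝ)) := by
        gcongr
        · exact ha k
        · exact norm_pow_sub_pow_le hρ hz hz' k
    _ = (R + k) * k * (ρ ^ k / Real.sqrt (k.factorial : ℝ)) * ‖z - z'‖ := by ring
    _ ≤ (R + k) * k * (Real.exp (8 * ρ ^ 2) * Real.exp (-k : ℝ)) * ‖z - z'‖ := by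
        gcongr
        exact pow_div_sqrt_factorial_le (by linarith) k
    _ = ((R + k) * k * Real.exp (-k : ℝ)) * Real.exp (8 * ρ ^ 2) * ‖z - z'‖ := by ring
    _ ≤ (8 * R * Real.exp (-(1 / 4)) ^ k) * Real.exp (8 * ρ ^ 2) * ‖z - z'‖ :=
        mul_le_mul_of_nonneg_right (mul_le_mul_of_nonneg_right (moderate_mul_exp_le hR k)
          (Real.exp_nonneg _)) (norm_nonneg _)
    _ = _ := by ring

end

section
variable {Ω : Type*} [MeasurableSpace Ω] {μ : Measure Ω} {ζ : ℕ → Ω → ℂ}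

theorem IsStdFamily.measure_exists_norm_gt_le (hζ : IsStdFamily μ ζ) {R : ℝ} (hR : 1 ≤ R) :
    μ {ω | ∃ k : ℕ, R + k < ‖ζ k ω‖} ≤ ENNReal.ofReal (6 * Real.exp (-R ^ 2 / 2)) := by
  have h1 : ∀ k : ℕ, μ {ω | R + k < ‖ζ k ω‖} ≤
      ENNReal.ofReal (2 * Real.exp (-R ^ 2 / 2) * Real.exp (-(1 / 2)) ^ k) := by
    intro k
    have h2 : μ {ω | R + k < ‖ζ k ω‖} = stdComplexGaussian {w | R + k < ‖w‖} := by
      rw [← hζ.map_eq k, Measure.map_apply (hζ.measurable k)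
        (measurableSet_lt measurable_const measurable_norm)]
      rfl
    rw [h2]
    refine (stdComplexGaussian_norm_gt_le _).trans (ENNReal.ofReal_le_ofReal ?_)
    rw [mul_assoc, ← Real.exp_nat_mul, ← Real.exp_add]
    have hk : (0 : ℝ) ≤ k := by positivity
    gcongr
    rw [abs_of_nonneg (by positivity)]
    nlinarith
  have hg := hasSum_geometric_of_lt_one (Real.exp_nonneg _) exp_neg_half_bounds.1
  calc _ = μ (⋃ k : ℕ, {ω | R + k < ‖ζ k ω‖}) := by congr 1; ext; simp
    _ ≤ ∑' k : ℕ, μ {ω | R + k < ‖ζ k ω‖} := measure_iUnion_le _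
    _ ≤ ∑' k : ℕ, ENNReal.ofReal (2 * Real.exp (-R ^ 2 / 2) * Real.exp (-(1 / 2)) ^ k) :=
        ENNReal.tsum_le_tsum h1
    _ = ENNReal.ofReal (2 * Real.exp (-R ^ 2 / 2) * (1 - Real.exp (-(1 / 2)))⁻¹) := by
        rw [← ENNReal.ofReal_tsum_of_nonneg (fun k => by positivity) (hg.summable.mul_left _),
          (hg.mul_left _).tsum_eq]
    _ ≤ _ := by
        apply ENNReal.ofReal_le_ofReal
        have := exp_neg_half_bounds.2
        have h0 := Real.exp_pos (-R ^ 2 / 2)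
        nlinarith

theorem IsStdFamily.ae_moderate (hζ : IsStdFamily μ ζ) :
    ∀ᵐ ω ∂μ, ∃ R : ℕ, 1 ≤ R ∧ ∀ k, ‖ζ k ω‖ ≤ (R : ℝ) + k := by
  rw [ae_iff]
  refine le_antisymm (ge_of_tendsto (x := Filter.atTop)
    (f := fun R : ℕ => ENNReal.ofReal (6 * Real.exp (-(R : ℝ) ^ 2 / 2))) ?_ ?_) zero_le
  · have h1 : Filter.Tendsto (fun R : ℕ => 6 * Real.exp (-(R : ℝ) ^ 2 / 2)) Filter.atTop
        (nhds (6 * 0)) := by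
      refine Filter.Tendsto.const_mul _ (Real.tendsto_exp_atBot.comp ?_)
      have h2 : Filter.Tendsto (fun R : ℕ => (R : ℝ) ^ 2) Filter.atTop Filter.atTop :=
        (Filter.tendsto_pow_atTop two_ne_zero).comp tendsto_natCast_atTop_atTop
      have h3 := Filter.tendsto_neg_atTop_atBot.comp (h2.atTop_div_const two_pos)
      refine h3.congr fun R => ?_
      simp only [Function.comp, neg_div]
    rw [mul_zero] at h1
    have h2 := (ENNReal.continuous_ofReal.tendsto 0).comp h1
    rwa [ENNReal.ofReal_zero] at h2
  · filter_upwards [Filter.eventually_ge_atTop 1] with R hR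
    refine (measure_mono fun ω hω => ?_).trans
      (hζ.measure_exists_norm_gt_le (R := R) (by exact_mod_cast hR))
    simp only [not_exists, not_and, mem_ofPred_eq] at hω ⊢
    by_contra hcon
    push Not at hcon
    exact hω R hR hcon

theorem IsStdFamily.isGEF (hζ : IsStdFamily μ ζ) : IsGEF μ fun ω => gefSeries fun k => ζ k ω := by
  refine ⟨ζ, fun k => ⟨(hζ.measurable k).aemeasurable, hζ.map_eq k⟩, hζ.indep, ?_⟩
  filter_upwards [hζ.ae_moderate] with ω hω z
  obtain ⟨R, hR, hω⟩ := hω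
  exact (summable_mul_fockMonomial (by exact_mod_cast hR) hω z).hasSum

/-- The value at a point has a density bounded by `1 / π`, since this is so conditionally on all the
coefficients but the first. -/
theorem IsStdFamily.measure_norm_gefSeries_le (hζ : IsStdFamily μ ζ) (z : ℂ) {x : ℝ} (hx : 0 ≤ x) :
    μ {ω | ‖gefSeries (fun k => ζ k ω) z‖ ≤ x} ≤ ENNReal.ofReal (4 * x ^ 2) := by
  have := hζ.isProbabilityMeasure
  have hb : Measurable[⨆ l ∈ ({0}ᶜ : Set ℕ), MeasurableSpace.comap (ζ l) inferInstance]
      fun ω => ∑' k, ζ (k + 1) ω * fockMonomial (k + 1) z := by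
    refine measurable_tsum_mul_const (fun k => ?_) _
    exact (comap_measurable (ζ (k + 1))).mono (le_iSup₂_of_le (k + 1) (by simp) le_rfl) le_rfl
  have hψm : MeasurableSet {w : ℂ | ‖w‖ ≤ x} := measurableSet_le measurable_norm measurable_const
  have h := hζ.lintegral_mul_shift_le (i := 0) (S := {0}ᶜ) (by simp) (Z := fun _ => 1) (b := fun ω =>
    ∑' k, ζ (k + 1) ω * fockMonomial (k + 1) z) measurable_const hb
    (ψ := {w : ℂ | ‖w‖ ≤ x}.indicator 1) (measurable_one.indicator hψm) 1
    (C := ENNReal.ofReal (4 * x ^ 2)) (fun c => by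
      have h1 := stdComplexGaussian_shift_le c 1 (by norm_num) hx
      have h2 : MeasurableSet {w : ℂ | ‖c + 1 * w‖ ≤ x} :=
        measurableSet_le (by fun_prop) measurable_const
      rw [← lintegral_indicator_one h2] at h1
      exact h1)
  simp only [one_mul, lintegral_one, measure_univ, mul_one] at h
  refine le_trans ?_ h
  have hms : MeasurableSet {ω | ‖gefSeries (fun k => ζ k ω) z‖ ≤ x} :=
    measurableSet_le (measurable_gefSeries_apply hζ.measurable z).norm measurable_const
  rw [← lintegral_indicator_one hms]
  refine le_of_eq (lintegral_congr_ae ?_)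
  filter_upwards [hζ.ae_moderate] with ω hω
  obtain ⟨R, hR, hω⟩ := hω
  have hs := summable_mul_fockMonomial (by exact_mod_cast hR) hω z
  have h3 : gefSeries (fun k => ζ k ω) z =
      ∑' k, ζ (k + 1) ω * fockMonomial (k + 1) z + ζ 0 ω := by
    rw [gefSeries, hs.tsum_eq_zero_add, add_comm]
    simp [fockMonomial]
  simp only [indicator_apply, mem_ofPred_eq, h3, Pi.one_apply]

/-- Independent families of coefficients form independent blocks. -/
theorem IsStdFamily.indep_blocks {ι κ : Type*} {X : ι × κ → Ω → ℂ} (h : IsStdFamily μ X) :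
    iIndepFun (fun (i : ι) ω (k : κ) => X (i, k) ω) μ := by
  have := h.isProbabilityMeasure
  have hm := h.measurable
  have hX := (iIndepFun_iff_map_fun_eq_infinitePi_map h.measurable).1 h.indep
  have hblock : ∀ i, μ.map (fun ω (k : κ) => X (i, k) ω) =
      Measure.infinitePi fun _ : κ => stdComplexGaussian := fun i => by
    have h1 : iIndepFun (fun k => X (i, k)) μ := h.indep.precomp (Prod.mk_right_injective i)
    rw [(iIndepFun_iff_map_fun_eq_infinitePi_map (fun k => h.measurable (i, k))).1 h1]
    simp only [h.map_eq]
  refine (iIndepFun_iff_map_fun_eq_infinitePi_map (by fun_prop)).2 ?_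
  simp only [h.map_eq] at hX
  simp only [hblock]
  rw [← Measure.infinitePi_map_curry (ι := ι) (κ := κ) (X := ℂ) (fun _ _ => stdComplexGaussian),
    ← hX, Measure.map_map (by fun_prop) (by fun_prop)]
  rfl

end

/-! ### Arcs -/

theorem continuous_circleArc (R θ : ℝ) : Continuous (circleArc R θ) := by
  unfold circleArc; fun_prop

theorem continuous_centredArc (R θ : ℝ) : Continuous (centredArc R θ) :=
  (continuous_circleArc R θ).sub continuous_const

theorem norm_circleArc {R : ℝ} (hR : 0 < R) (θ s : ℝ) : ‖circleArc R θ s‖ = R := by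
  rw [circleArc, norm_mul, Complex.norm_exp_ofReal_mul_I, mul_one, Complex.norm_real,
    Real.norm_of_nonneg hR.le]

theorem norm_circleArc_sub_le {R : ℝ} (hR : 0 < R) (θ s s' : ℝ) :
    ‖circleArc R θ s - circleArc R θ s'‖ ≤ |s - s'| := by
  have h : circleArc R θ s - circleArc R θ s' =
      circleArc R θ s' * (Complex.exp (Complex.I * (((s - s') / R : ℝ) : ℂ)) - 1) := by
    rw [circleArc, circleArc, mul_sub, mul_one, mul_assoc (R : ℂ), ← Complex.exp_add]
    congr 3
    push_cast
    ring
  rw [h, norm_mul, norm_circleArc hR]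
  have := Real.norm_exp_I_mul_ofReal_sub_one_le (x := (s - s') / R)
  rw [Real.norm_eq_abs, abs_div, abs_of_pos hR] at this
  calc _ ≤ R * (|s - s'| / R) := by gcongr
    _ = _ := by field_simp

theorem norm_centredArc_le {R : ℝ} (hR : 0 < R) (θ s : ℝ) : ‖centredArc R θ s‖ ≤ |s| := by
  simpa [centredArc] using norm_circleArc_sub_le hR θ s 0

/-- The entire extension of the parametrization `centredArc`. -/
noncomputable def centredArcExt (R θ : ℝ) (t : ℂ) : ℂ :=
  circleArc R θ 0 * (Complex.exp (Complex.I * t / R) - 1)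

theorem differentiable_centredArcExt (R θ : ℝ) : Differentiable ℂ (centredArcExt R θ) := by
  unfold centredArcExt; fun_prop

theorem centredArcExt_ofReal (R θ s : ℝ) : centredArcExt R θ s = centredArc R θ s := by
  rw [centredArcExt, centredArc, circleArc, circleArc, mul_sub, mul_one, mul_assoc (R : ℂ),
    ← Complex.exp_add]
  congr 3
  push_cast
  ring

theorem norm_centredArcExt_le {R : ℝ} (hR : 3 ≤ R) (θ : ℝ) {t : ℂ} (ht : ‖t‖ ≤ 3) :
    ‖centredArcExt R θ t‖ ≤ 6 := by
  have hR0 : 0 < R := by linarith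
  have h1 : ‖Complex.I * t / R‖ = ‖t‖ / R := by
    rw [norm_div, norm_mul, Complex.norm_I, one_mul, Complex.norm_real, Real.norm_of_nonneg hR0.le]
  have h2 := Complex.norm_exp_sub_one_le (x := Complex.I * t / R) (by
    rw [h1, div_le_one hR0]; linarith)
  rw [centredArcExt, norm_mul, norm_circleArc hR0]
  rw [h1] at h2
  calc _ ≤ R * (2 * (‖t‖ / R)) := by gcongr
    _ = 2 * ‖t‖ := by field_simp
    _ ≤ 6 := by linarith

/-- Backlund's bound is applied to `F` composed with the entire extension of the parametrization, which
maps the disc of radius `3` into the disc of radius `6`. -/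
theorem abs_argIncrement_centredArc_le {R θ a b M : ℝ} (hR : 3 ≤ R) (ha : -1 ≤ a) (ha0 : a ≤ 0)
    (hb0 : 0 ≤ b) (hb : b ≤ 1) {F : ℂ → ℂ} (hF : Differentiable ℂ F)
    (hM : ∀ z, ‖z‖ ≤ 6 → ‖F z‖ ≤ M) (h0 : ∀ t ∈ Icc a b, F (centredArc R θ t) ≠ 0) :
    |argIncrement (fun t => F (centredArc R θ t)) a b| ≤
      Real.pi * (1 + Real.log (M / ‖F 0‖) / Real.log 2) := by
  have hz : centredArcExt R θ 0 = 0 := by simp [centredArcExt]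
  have hz' : centredArc R θ 0 = 0 := by simp [centredArc]
  have h := abs_argIncrement_le_log (u := fun t => F (centredArcExt R θ t))
    (hF.comp (differentiable_centredArcExt R θ))
    (fun t ht => hM _ (norm_centredArcExt_le hR θ ht)) ha (ha0.trans hb0) hb
    (fun t ht => by simp only [centredArcExt_ofReal]; exact h0 t ht) (by
      simp only [hz]
      have := h0 0 ⟨ha0, hb0⟩
      rwa [hz'] at this)
  simpa only [centredArcExt_ofReal, hz] using h

/-! ### The chords and the number of separated arcs -/

/-- Jordan's inequality for the chord of an arc; the polar angles are compared modulo `2 π`. -/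
theorem chord_le_of_arcsSeparated {n : ℕ} {R r d : ℝ} (hR : 0 < R) (hr : 0 ≤ r) {θ : Fin n → ℝ}
    (h : ArcsSeparated R r d θ) {j k : Fin n} (hjk : j ≠ k) :
    2 / Real.pi * d ≤ ‖circleArc R (θ j) 0 - circleArc R (θ k) 0‖ := by
  have hpi := Real.pi_pos
  set m := toIocDiv Real.two_pi_pos (-Real.pi) (θ j - θ k) with hm
  set φ := toIocMod Real.two_pi_pos (-Real.pi) (θ j - θ k) with hφ
  have hφm : φ = θ j - θ k - m • (2 * Real.pi) := rfl
  have hφI := toIocMod_mem_Ioc Real.two_pi_pos (-Real.pi) (θ j - θ k)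
  rw [← hφ] at hφI
  have hs := h j k hjk 0 ⟨by linarith, by linarith⟩ 0 ⟨by linarith, by linarith⟩ (-m)
  have h1 : R * θ j + 0 - (R * θ k + 0) + 2 * Real.pi * R * ((-m : ℤ) : ℝ) = R * φ := by
    rw [hφm, zsmul_eq_mul]; push_cast; ring
  rw [h1, abs_mul, abs_of_pos hR] at hs
  have h2 : circleArc R (θ j) 0 - circleArc R (θ k) 0 =
      circleArc R (θ k) 0 * (Complex.exp (Complex.I * (φ : ℂ)) - 1) := by
    rw [circleArc, circleArc, mul_sub, mul_one, mul_assoc (R : ℂ), ← Complex.exp_add]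
    congr 2
    rw [Complex.exp_eq_exp_iff_exists_int]
    refine ⟨m, ?_⟩
    rw [hφm, zsmul_eq_mul]
    push_cast
    ring
  rw [h2, norm_mul, norm_circleArc hR, Complex.norm_exp_I_mul_ofReal_sub_one, norm_mul,
    Real.norm_two, Real.norm_eq_abs]
  have h3 : 2 / Real.pi * |φ / 2| ≤ |Real.sin (φ / 2)| := by
    refine Real.mul_abs_le_abs_sin ?_
    rw [abs_le]
    constructor <;> linarith [hφI.1, hφI.2]
  rw [abs_div, abs_two] at h3
  calc 2 / Real.pi * d ≤ 2 / Real.pi * (R * |φ|) := by gcongr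
    _ = R * (2 * (2 / Real.pi * (|φ| / 2))) := by ring
    _ ≤ _ := by gcongr

/-- The positions of the centres on a circle of length `2 π R < 7 R` are at distance at least `1` from
each other, so that their integer parts are distinct. -/
theorem card_le_of_arcsSeparated {n : ℕ} {R r d : ℝ} (hR : 1 ≤ R) (hr : 0 ≤ r) (hd : 1 ≤ d)
    {θ : Fin n → ℝ} (h : ArcsSeparated R r d θ) : (n : ℝ) ≤ 8 * R := by
  have hpi := Real.pi_pos
  have hp : 0 < 2 * Real.pi * R := by positivity
  set φ : Fin n → ℝ := fun j => toIcoMod hp 0 (R * θ j) with hφ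
  have hφI : ∀ j, φ j ∈ Ico 0 (2 * Real.pi * R) := fun j => by
    simpa using toIcoMod_mem_Ico hp 0 (R * θ j)
  have hsep : ∀ j k, j ≠ k → 1 ≤ |φ j - φ k| := by
    intro j k hjk
    have hs := h j k hjk 0 ⟨by linarith, by linarith⟩ 0 ⟨by linarith, by linarith⟩
      (toIcoDiv hp 0 (R * θ k) - toIcoDiv hp 0 (R * θ j))
    refine hd.trans (hs.trans (le_of_eq ?_))
    simp only [hφ, toIcoMod, zsmul_eq_mul]
    congr 1
    push_cast
    ring
  have hinj : Function.Injective fun j => ⌊φ j⌋₊ := by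
    intro j k hjk
    by_contra hne
    have h1 := hsep j k hne
    have a1 := Nat.floor_le (hφI j).1
    have a2 := Nat.lt_floor_add_one (φ j)
    have b1 := Nat.floor_le (hφI k).1
    have b2 := Nat.lt_floor_add_one (φ k)
    simp only at hjk
    rw [hjk] at a1 a2
    have : |φ j - φ k| < 1 := by rw [abs_lt]; constructor <;> linarith
    linarith
  have hcard : n ≤ ⌊2 * Real.pi * R⌋₊ + 1 := by
    have := Finset.card_le_card_of_injOn (s := Finset.univ)
      (t := Finset.range (⌊2 * Real.pi * R⌋₊ + 1)) (fun j => ⌊φ j⌋₊) (fun j _ => by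
        simp only [Finset.coe_range, mem_Iio]
        exact Nat.lt_succ_of_le (Nat.floor_le_floor (hφI j).2.le)) hinj.injOn
    simpa using this
  have h1 : (n : ℝ) ≤ (⌊2 * Real.pi * R⌋₊ : ℝ) + 1 := by exact_mod_cast hcard
  have h2 := Nat.floor_le hp.le
  have h3 := Real.pi_lt_d2
  nlinarith

/-! ### Uniform partitions -/

theorem exists_grid_near {a b t : ℝ} (ht : t ∈ Icc a b) {N : ℕ} (hN : 0 < N) :
    ∃ i ∈ Finset.range (N + 1), a + i * ((b - a) / N) ∈ Icc a b ∧
      |t - (a + i * ((b - a) / N))| ≤ (b - a) / N := by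
  have hab : a ≤ b := ht.1.trans ht.2
  have hN' : (0 : ℝ) < N := by exact_mod_cast hN
  rcases hab.eq_or_lt with rfl | hab
  · have : t = a := le_antisymm ht.2 ht.1
    exact ⟨0, by simp, by simp [this]⟩
  set q := (b - a) / N with hq
  have hq0 : 0 < q := div_pos (by linarith) hN'
  have hNq : N * q = b - a := by rw [hq]; field_simp
  have h0 : 0 ≤ (t - a) / q := div_nonneg (by linarith [ht.1]) hq0.le
  have h1 := Nat.floor_le h0
  have h2 := Nat.lt_floor_add_one ((t - a) / q)
  rw [le_div_iff₀ hq0] at h1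
  rw [div_lt_iff₀ hq0] at h2
  refine ⟨⌊(t - a) / q⌋₊, ?_, ⟨?_, ?_⟩, ?_⟩
  · rw [Finset.mem_range, Nat.lt_succ_iff]
    apply Nat.floor_le_of_le
    rw [div_le_iff₀ hq0, hNq]
    linarith [ht.2]
  · have : 0 ≤ (⌊(t - a) / q⌋₊ : ℝ) * q := by positivity
    linarith
  · linarith [ht.2]
  · rw [abs_le]; constructor <;> linarith

/-! ### Nonvanishing and measurability -/

section
variable {Ω : Type*} [MeasurableSpace Ω] {μ : Measure Ω} {ζ : ℕ → Ω → ℂ}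

theorem IsStdFamily.measure_exists_norm_gefSeries_le (hζ : IsStdFamily μ ζ) (z : ℕ → ℂ) (N : ℕ)
    {x : ℝ} (hx : 0 ≤ x) :
    μ {ω | ∃ i ∈ Finset.range (N + 1), ‖gefSeries (fun k => ζ k ω) (z i)‖ ≤ x} ≤
      ENNReal.ofReal ((N + 1) * (4 * x ^ 2)) := by
  calc _ = μ (⋃ i ∈ Finset.range (N + 1), {ω | ‖gefSeries (fun k => ζ k ω) (z i)‖ ≤ x}) := by
        congr 1; ext; simp
    _ ≤ ∑ i ∈ Finset.range (N + 1), μ {ω | ‖gefSeries (fun k => ζ k ω) (z i)‖ ≤ x} :=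
        measure_biUnion_finset_le _ _
    _ ≤ ∑ i ∈ Finset.range (N + 1), ENNReal.ofReal (4 * x ^ 2) :=
        Finset.sum_le_sum fun i _ => hζ.measure_norm_gefSeries_le _ hx
    _ = _ := by
        rw [Finset.sum_const, Finset.card_range, nsmul_eq_mul,
          ENNReal.ofReal_mul (by positivity : (0 : ℝ) ≤ N + 1), ← ENNReal.ofReal_natCast,
          Nat.cast_add_one]

/-- A Gaussian entire function has no zeros on a Lipschitz curve: on a partition of mesh `1 / N`, a
zero forces a value `O(1 / N)` at one of the `N + 1` points, and this has probability
`O(N · N⁻²)`. -/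
theorem IsStdFamily.ae_gefSeries_ne_zero (hζ : IsStdFamily μ ζ) {γ : ℝ → ℂ} {a b ρ : ℝ}
    (hρ : 1 ≤ ρ) (hγ : ∀ s t, ‖γ s - γ t‖ ≤ |s - t|) (hγρ : ∀ t ∈ Icc a b, ‖γ t‖ ≤ ρ) :
    ∀ᵐ ω ∂μ, ∀ t ∈ Icc a b, gefSeries (fun k => ζ k ω) (γ t) ≠ 0 := by
  rcases lt_or_ge b a with hab | hab
  · simp [Icc_eq_empty_of_lt hab]
  have hnull : ∀ R : ℕ, 1 ≤ R → ∀ᵐ ω ∂μ, (∀ k, ‖ζ k ω‖ ≤ (R : ℝ) + k) →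
      ∀ t ∈ Icc a b, gefSeries (fun k => ζ k ω) (γ t) ≠ 0 := by
    intro R hR
    have hR' : (1 : ℝ) ≤ R := by exact_mod_cast hR
    set L := 40 * R * Real.exp (8 * ρ ^ 2) * (b - a) with hL
    have hL0 : 0 ≤ L := mul_nonneg (by positivity) (by linarith)
    rw [ae_iff]
    refine le_antisymm (ge_of_tendsto (x := Filter.atTop) (f := fun N : ℕ =>
      ENNReal.ofReal ((N + 1) * (4 * (L / N) ^ 2))) ?_ ?_) zero_le
    · have h1 : Filter.Tendsto (fun N : ℕ => ((N : ℝ) + 1) * (4 * (L / N) ^ 2)) Filter.atTop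
          (nhds 0) := by
        have h2 : Filter.Tendsto (fun N : ℕ => (1 + 1 / (N : ℝ)) * (4 * L ^ 2) * (1 / (N : ℝ)))
            Filter.atTop (nhds ((1 + 0) * (4 * L ^ 2) * 0)) := by
          have := tendsto_one_div_atTop_nhds_zero_nat (𝕜 := ℝ)
          exact ((tendsto_const_nhds.add this).mul_const _).mul this
        rw [mul_zero] at h2
        refine h2.congr' ?_
        filter_upwards [Filter.eventually_gt_atTop 0] with N hN
        have : (N : ℝ) ≠ 0 := by exact_mod_cast hN.ne'
        field_simp
      have h2 := (ENNReal.continuous_ofReal.tendsto 0).comp h1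
      rwa [ENNReal.ofReal_zero] at h2
    · filter_upwards [Filter.eventually_gt_atTop 0] with N hN
      refine le_trans (measure_mono fun ω hω => ?_)
        (hζ.measure_exists_norm_gefSeries_le (fun i => γ (a + i * ((b - a) / N))) N
          (x := L / N) (by positivity))
      simp only [mem_ofPred_eq, Classical.not_imp, not_forall, not_not] at hω ⊢
      obtain ⟨hω, t, ht, h0⟩ := hω
      obtain ⟨i, hi, hiI, hit⟩ := exists_grid_near ht hN
      refine ⟨i, hi, ?_⟩
      have := norm_gefSeries_sub_le hR' hω hρ (hγρ _ hiI) (hγρ t ht)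
      rw [h0, sub_zero] at this
      refine this.trans ?_
      rw [hL, mul_div_assoc]
      gcongr
      exact (hγ _ _).trans (by rw [abs_sub_comm]; exact hit)
  have hall := ae_all_iff.2 fun R : ℕ => hnull (R + 1) (Nat.le_add_left 1 R)
  filter_upwards [hall, hζ.ae_moderate] with ω h1 h2
  obtain ⟨R, hR, h2⟩ := h2
  obtain ⟨R, rfl⟩ := Nat.exists_eq_add_of_le' hR
  exact h1 R h2

theorem aemeasurable_curveArgIncrement {F : Ω → ℂ → ℂ} {γ : ℝ → ℂ} {a b : ℝ} (hab : a ≤ b)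
    (hF : ∀ z, AEMeasurable (fun ω => F ω z) μ)
    (hc : ∀ᵐ ω ∂μ, ContinuousOn (fun t => F ω (γ t)) (Icc a b))
    (h0 : ∀ᵐ ω ∂μ, ∀ t ∈ Icc a b, F ω (γ t) ≠ 0) :
    AEMeasurable (curveArgIncrement F γ a b) μ := by
  refine aemeasurable_of_tendsto_metrizable_ae Filter.atTop (f := fun (N : ℕ) ω =>
    ∑ i ∈ Finset.range (N + 1), (F ω (γ (a + (i + 1 : ℕ) * ((b - a) / (N + 1)))) /
      F ω (γ (a + i * ((b - a) / (N + 1))))).arg) (fun N => ?_) ?_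
  · refine Finset.aemeasurable_fun_sum _ fun i _ => ?_
    exact Complex.measurable_arg.comp_aemeasurable ((hF _).div (hF _))
  · filter_upwards [hc, h0] with ω h1 h2
    exact tendsto_sum_arg_argIncrement (h := fun t => F ω (γ t)) hab h1 h2

end

/-! ### The coupled family of Gaussian coefficients -/

/-- The translate by `w` of the function with coefficients `a`, with the normalization that makes
it a Gaussian entire function when the coefficients are Gaussian. -/
noncomputable def translatedSeries (a : ℕ → ℂ) (w z : ℂ) : ℂ := ∑' m, a m * displaced w m z

theorem translatedSeries_eq (a : ℕ → ℂ) (w z : ℂ) : translatedSeries a w z =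
    gefSeries a (w + z) * Complex.exp (-z * (starRingEnd ℂ) w - (‖w‖ ^ 2 / 2 : ℝ)) := by
  rw [translatedSeries, gefSeries, ← tsum_mul_right]
  refine tsum_congr fun m => ?_
  rw [displaced, fockMonomial, mul_assoc]

/-- The coordinates with respect to the original coefficients of the coefficients of the coupled
functions: those of index at most `N` are given by `e`, the other ones are distinct original
coefficients of index at least `D`. -/
noncomputable def couplingVector {n D N : ℕ} (e : Fin n → Fin (N + 1) → EuclideanSpace ℂ (Fin D))
    (p : Fin n × ℕ) : ℕ →₀ ℂ :=
  if h : p.2 < N + 1 then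
    Finsupp.onFinset (Finset.range D) (fun m => if hm : m < D then e p.1 ⟨p.2, h⟩ ⟨m, hm⟩ else 0)
      (fun m hm => by
        rw [Finset.mem_range]
        by_contra h'
        exact hm (dif_neg h'))
  else Finsupp.single (D + (n * (p.2 - (N + 1)) + p.1)) 1

section
variable {n D N : ℕ} {e : Fin n → Fin (N + 1) → EuclideanSpace ℂ (Fin D)}

theorem couplingVector_apply (p : Fin n × ℕ) (h : p.2 < N + 1) (m : Fin D) :
    couplingVector e p m = e p.1 ⟨p.2, h⟩ m := by
  rw [couplingVector, dif_pos h, Finsupp.onFinset_apply, dif_pos m.2]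

theorem couplingVector_apply_of_le (p : Fin n × ℕ) (h : p.2 < N + 1) {m : ℕ} (hm : D ≤ m) :
    couplingVector e p m = 0 := by
  rw [couplingVector, dif_pos h, Finsupp.onFinset_apply, dif_neg (not_lt.2 hm)]

theorem support_couplingVector_subset (p : Fin n × ℕ) (h : p.2 < N + 1) :
    (couplingVector e p).support ⊆ Finset.range D := by
  rw [couplingVector, dif_pos h]
  exact Finsupp.support_onFinset_subset

theorem couplingVector_of_le (p : Fin n × ℕ) (h : ¬ p.2 < N + 1) :
    couplingVector e p = Finsupp.single (D + (n * (p.2 - (N + 1)) + p.1)) 1 := by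
  rw [couplingVector, dif_neg h]

/-- The coupling vectors are orthonormal. -/
theorem sum_couplingVector_mul_conj
    (he : Orthonormal ℂ fun p : Fin n × Fin (N + 1) => e p.1 p.2) (p q : Fin n × ℕ) :
    ((couplingVector e p).sum fun m c => c * (starRingEnd ℂ) (couplingVector e q m)) =
      if p = q then 1 else 0 := by
  by_cases hp : p.2 < N + 1
  · rw [Finsupp.sum_of_support_subset _ (support_couplingVector_subset p hp) _ (by simp),
      Finset.sum_range]
    by_cases hq : q.2 < N + 1
    · simp only [couplingVector_apply p hp, couplingVector_apply q hq]
      have h := (orthonormal_iff_ite.1 he) (q.1, ⟨q.2, hq⟩) (p.1, ⟨p.2, hp⟩)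
      rw [PiLp.inner_apply] at h
      simp only [RCLike.inner_apply] at h
      rw [h]
      congr 1
      simp only [Prod.ext_iff, Fin.mk.injEq, eq_iff_iff]
      exact ⟨fun h => ⟨h.1.symm, h.2.symm⟩, fun h => ⟨h.1.symm, h.2.symm⟩⟩
    · have hpq : p ≠ q := by rintro rfl; exact hq hp
      rw [if_neg hpq]
      refine Finset.sum_eq_zero fun m _ => ?_
      rw [couplingVector_of_le q hq, Finsupp.single_eq_of_ne (by omega), map_zero, mul_zero]
  · rw [couplingVector_of_le p hp, Finsupp.sum_single_index (by simp), one_mul]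
    by_cases hq : q.2 < N + 1
    · have hpq : p ≠ q := by rintro rfl; exact hp hq
      rw [couplingVector_apply_of_le q hq (by omega), if_neg hpq, map_zero]
    · rw [couplingVector_of_le q hq, Finsupp.single_apply]
      have h : D + (n * (q.2 - (N + 1)) + q.1) = D + (n * (p.2 - (N + 1)) + p.1) ↔ p = q := by
        constructor
        · intro h
          have h0 := Nat.add_left_cancel h
          have h1 := congrArg (· % n) h0
          simp only [Nat.mul_add_mod, Nat.mod_eq_of_lt q.1.2, Nat.mod_eq_of_lt p.1.2] at h1
          rw [h1] at h0
          have h2 := Nat.eq_of_mul_eq_mul_left p.1.pos (Nat.add_right_cancel h0)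
          exact Prod.ext (Fin.ext h1.symm) (by omega)
        · rintro rfl; rfl
      simp only [h]
      split_ifs <;> simp

end

/-- Gaussian coefficients `ζ`, together with independent families `ξ (j, ·)` of Gaussian coefficients
such that the function with coefficients `ξ (j, ·)` is close to the translate by `w j` of the
function with coefficients `ζ`, when all coefficients are moderate, and such that the value at `0` of
the `j`-th translate is `b + s ξ (j, 0)`, where `b` does not depend on `ξ (i, 0)` for `i ≥ j`. -/
structure CoupledFamily {Ω : Type*} [MeasurableSpace Ω] (μ : Measure Ω) (R : ℝ) {n : ℕ}
    (w : Fin n → ℂ) (ζ : ℕ → Ω → ℂ) (ξ : Fin n × ℕ → Ω → ℂ) : Prop where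
  std_orig : IsStdFamily μ ζ
  std_new : IsStdFamily μ ξ
  close : ∀ ω j, (∀ m, ‖ζ m ω‖ ≤ R + m) → (∀ k, ‖ξ (j, k) ω‖ ≤ R + k) → ∀ z, ‖z‖ ≤ 6 →
    ‖translatedSeries (fun m => ζ m ω) (w j) z - gefSeries (fun k => ξ (j, k) ω) z‖ ≤ (R ^ 22)⁻¹
  triangular : ∀ j, ∃ (s : ℂ) (b : Ω → ℂ), 1 / 2 ≤ ‖s‖ ∧
    Measurable[⨆ l ∈ {p : Fin n × ℕ | p.2 ≠ 0 ∨ p.1 < j},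
      MeasurableSpace.comap (ξ l) inferInstance] b ∧
    ∀ᵐ ω ∂μ, translatedSeries (fun m => ζ m ω) (w j) 0 = b ω + s * ξ (j, 0) ω
  bounded : ∃ C : ℕ → ℝ, Summable C ∧ (∀ m, 0 ≤ C m) ∧ ∑' m, C m ≤ R ^ 3 ∧
    ∀ j m z, ‖z‖ ≤ 6 → ‖displaced (w j) m z‖ ≤ C m

section
variable {Ω : Type*} [MeasurableSpace Ω] {μ : Measure Ω} {ζ : ℕ → Ω → ℂ}

theorem IsStdFamily.ae_summable_norm_mul (hζ : IsStdFamily μ ζ) {c : ℕ → ℝ} (hc : ∀ k, 0 ≤ c k)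
    (hs : Summable c) : (∀ᵐ ω ∂μ, Summable fun k => ‖ζ k ω‖ * c k) ∧
      ∫⁻ ω, ENNReal.ofReal (∑' k, ‖ζ k ω‖ * c k) ∂μ ≤ ENNReal.ofReal (2 * ∑' k, c k) := by
  have hm : ∀ k, Measurable fun ω => ENNReal.ofReal (‖ζ k ω‖ * c k) := fun k =>
    ENNReal.measurable_ofReal.comp ((hζ.measurable k).norm.mul_const _)
  have h1 : ∫⁻ ω, ∑' k, ENNReal.ofReal (‖ζ k ω‖ * c k) ∂μ ≤ ENNReal.ofReal (2 * ∑' k, c k) := by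
    rw [lintegral_tsum fun k => (hm k).aemeasurable]
    calc ∑' k, ∫⁻ ω, ENNReal.ofReal (‖ζ k ω‖ * c k) ∂μ ≤ ∑' k, 2 * ENNReal.ofReal (c k) := by
          refine ENNReal.tsum_le_tsum fun k => ?_
          simp only [ENNReal.ofReal_mul (norm_nonneg _)]
          rw [lintegral_mul_const (f := fun ω => ENNReal.ofReal ‖ζ k ω‖) _ (by
            have := hζ.measurable k
            fun_prop)]
          gcongr
          exact (hζ.lintegral_comp k (ψ := fun w => ENNReal.ofReal ‖w‖) (by fun_prop)).trans_le
            lintegral_norm_stdComplexGaussian_le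
      _ = _ := by
          rw [ENNReal.tsum_mul_left, ENNReal.ofReal_mul two_pos.le,
            ENNReal.ofReal_tsum_of_nonneg hc hs]
          norm_num
  have h2 : ∀ᵐ ω ∂μ, Summable fun k => ‖ζ k ω‖ * c k := by
    filter_upwards [ae_lt_top (Measurable.tsum hm) (h1.trans_lt ENNReal.ofReal_lt_top).ne]
      with ω hω
    have h3 := ENNReal.summable_toReal hω.ne
    refine h3.congr fun k => ?_
    rw [ENNReal.toReal_ofReal (mul_nonneg (norm_nonneg _) (hc k))]
  refine ⟨h2, le_trans (le_of_eq (lintegral_congr_ae ?_)) h1⟩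
  filter_upwards [h2] with ω hω
  exact ENNReal.ofReal_tsum_of_nonneg (fun k => mul_nonneg (norm_nonneg _) (hc k)) hω

theorem Coupling.exists_coupledFamily {R : ℝ} {n D N : ℕ} {w : Fin n → ℂ}
    {e : Fin n → Fin (N + 1) → EuclideanSpace ℂ (Fin D)} (H : Coupling R w D N e)
    (hζ : IsStdFamily μ ζ) : ∃ ξ : Fin n × ℕ → Ω → ℂ, CoupledFamily μ R w ζ ξ := by
  classical
  have hlow : ∀ (j : Fin n) (k : Fin (N + 1)) ω, finComb ζ (couplingVector e (j, k)) ω =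
      ∑ m : Fin D, e j k m * ζ m ω := fun j k ω => by
    rw [finComb_eq_sum_range ζ _ ω (support_couplingVector_subset (j, (k : ℕ)) k.2),
      Finset.sum_range]
    exact Finset.sum_congr rfl fun m _ => by rw [couplingVector_apply _ k.2]
  have hhigh : ∀ (_ : Fin n) (i : ℕ), ∃ p : Fin n × ℕ, p.2 ≠ 0 ∧
      ζ (D + i) = finComb ζ (couplingVector e p) := by
    intro j i
    refine ⟨(⟨i % n, Nat.mod_lt _ j.pos⟩, N + 1 + i / n), by simp, ?_⟩
    funext ω
    rw [couplingVector_of_le _ (not_lt.2 (Nat.le_add_right _ _)), finComb,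
      Finsupp.sum_single_index (by simp), one_mul]
    simp only [Nat.add_sub_cancel_left]
    rw [Nat.div_add_mod]
  have hξ := hζ.finComb (couplingVector e) (sum_couplingVector_mul_conj H.orthonormal)
  refine ⟨fun p => finComb ζ (couplingVector e p), hζ, hξ, fun ω j ha hb z hz => ?_, fun j => ?_,
    H.bounded⟩
  · exact H.close (fun m => ζ m ω) (fun k => finComb ζ (couplingVector e (j, k)) ω) j ha hb
      (fun k => hlow j k ω) z hz
  · obtain ⟨s, c, hs, hc, htri⟩ := H.triangular j
    obtain ⟨C, hCs, hC0, -, hC⟩ := H.bounded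
    set S : Set (Fin n × ℕ) := {p | p.2 ≠ 0 ∨ p.1 < j} with hS
    have hmS : ∀ p ∈ S, Measurable[⨆ l ∈ S,
        MeasurableSpace.comap (finComb ζ (couplingVector e l)) inferInstance]
          (finComb ζ (couplingVector e p)) := fun p hp =>
      (comap_measurable _).mono (le_iSup₂_of_le p hp le_rfl) le_rfl
    refine ⟨s, fun ω => (∑ p : Fin n × Fin (N + 1), c p *
      finComb ζ (couplingVector e (p.1, (p.2 : ℕ))) ω) + ∑' i, ζ (D + i) ω *
        displaced (w j) (D + i) 0, hs, ?_, ?_⟩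
    · refine Measurable.add ?_ (measurable_tsum_mul_const (fun i => ?_) _)
      · refine Finset.measurable_fun_sum _ fun p _ => ?_
        by_cases hp : p.1 < j
        · exact (hmS _ (Or.inr hp)).const_mul _
        · simp only [hc p (not_lt.1 hp), zero_mul]
          exact measurable_const
      · obtain ⟨p, hp, hpi⟩ := hhigh j i
        rw [hpi]
        exact hmS p (Or.inl hp)
    · filter_upwards [(hζ.ae_summable_norm_mul hC0 hCs).1] with ω hω
      have hsum : Summable fun m => ζ m ω * displaced (w j) m 0 := by
        refine hω.of_norm_bounded fun m => ?_
        rw [norm_mul]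
        gcongr
        exact hC j m 0 (by simp)
      rw [translatedSeries, ← hsum.sum_add_tsum_nat_add D, Finset.sum_range]
      simp only [htri, hlow, mul_add, Finset.sum_add_distrib, Finset.mul_sum,
        add_comm _ D]
      have e1 : finComb ζ (couplingVector e (j, 0)) ω = ∑ m : Fin D, e j 0 m * ζ m ω := hlow j 0 ω
      rw [e1, Finset.mul_sum, Finset.sum_comm]
      have e2 : ∀ x : Fin D, ζ x ω * (s * e j 0 x) = s * (e j 0 x * ζ x ω) := fun x => by ring
      have e3 : ∀ (p : Fin n × Fin (N + 1)) (x : Fin D), ζ x ω * (c p * e p.1 p.2 x) =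
          c p * (e p.1 p.2 x * ζ x ω) := fun p x => by ring
      simp only [e2, e3]
      ring

end

/-! ### Products of functions of triangular combinations -/

/-- The factors are integrated one after the other, from the last one to the first one: the variable
`X (idx j)` occurs in none of the preceding factors. -/
theorem IsStdFamily.lintegral_prod_triangular_le {Ω ι : Type*} [MeasurableSpace Ω] {μ : Measure Ω}
    {X : ι → Ω → ℂ} (hX : IsStdFamily μ X) {ψ : ℂ → ℝ≥0∞} (hψ : Measurable ψ) {C : ℝ≥0∞}
    (hC : ∀ s c : ℂ, 1 / 2 ≤ ‖s‖ → ∫⁻ w, ψ (c + s * w) ∂stdComplexGaussian ≤ C) {n : ℕ} :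
    ∀ {idx : Fin n → ι} {S : Fin n → Set ι} {s : Fin n → ℂ} {b : Fin n → Ω → ℂ},
    (∀ j, idx j ∉ S j) → (∀ l j, l < j → S l ⊆ S j ∧ idx l ∈ S j) → (∀ j, 1 / 2 ≤ ‖s j‖) →
    (∀ j, Measurable[⨆ l ∈ S j, MeasurableSpace.comap (X l) inferInstance] (b j)) →
    ∫⁻ ω, ∏ j, ψ (b j ω + s j * X (idx j) ω) ∂μ ≤ C ^ n := by
  have := hX.isProbabilityMeasure
  induction n with
  | zero => intro idx S s b _ _ _ _; simp
  | succ n ih =>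
    intro idx S s b hi hmono hs hb
    simp only [Fin.prod_univ_castSucc]
    have hZ : Measurable[⨆ l ∈ S (Fin.last n), MeasurableSpace.comap (X l) inferInstance]
        fun ω => ∏ j : Fin n, ψ (b j.castSucc ω + s j.castSucc * X (idx j.castSucc) ω) := by
      refine Finset.measurable_fun_prod _ fun j _ => hψ.comp ?_
      obtain ⟨h1, h2⟩ := hmono j.castSucc (Fin.last n) (Fin.castSucc_lt_last j)
      exact ((hb j.castSucc).mono (biSup_mono h1) le_rfl).add
        (((comap_measurable _).mono (le_iSup₂_of_le _ h2 le_rfl) le_rfl).const_mul _)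
    calc _ ≤ C * ∫⁻ ω, ∏ j : Fin n, ψ (b j.castSucc ω + s j.castSucc * X (idx j.castSucc) ω) ∂μ :=
          hX.lintegral_mul_shift_le (hi (Fin.last n)) hZ (hb (Fin.last n)) hψ _
            fun c => hC _ c (hs _)
      _ ≤ C * C ^ n := by
          gcongr
          exact ih (fun j => hi _) (fun l j hlj => hmono _ _ (by simpa using hlj)) (fun j => hs _)
            fun j => hb _
      _ = C ^ (n + 1) := by rw [pow_succ']

theorem CoupledFamily.lintegral_prod_le {Ω : Type*} [MeasurableSpace Ω] {μ : Measure Ω} {R : ℝ}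
    {n : ℕ} {w : Fin n → ℂ} {ζ : ℕ → Ω → ℂ} {ξ : Fin n × ℕ → Ω → ℂ} (H : CoupledFamily μ R w ζ ξ)
    {ψ : ℂ → ℝ≥0∞} (hψ : Measurable ψ) {C : ℝ≥0∞}
    (hC : ∀ s c : ℂ, 1 / 2 ≤ ‖s‖ → ∫⁻ w, ψ (c + s * w) ∂stdComplexGaussian ≤ C) :
    ∫⁻ ω, ∏ j, ψ (translatedSeries (fun m => ζ m ω) (w j) 0) ∂μ ≤ C ^ n := by
  choose s b hs hb hae using H.triangular
  refine le_trans (le_of_eq (lintegral_congr_ae ?_))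
    (H.std_new.lintegral_prod_triangular_le hψ hC (idx := fun j => (j, 0))
      (S := fun j => {p : Fin n × ℕ | p.2 ≠ 0 ∨ p.1 < j}) (s := s) (b := b) (by simp)
      (fun l j hlj => ⟨fun p hp => hp.imp_right fun h => h.trans hlj, Or.inr hlj⟩) hs hb)
  filter_upwards [ae_all_iff.2 hae] with ω hω
  exact Finset.prod_congr rfl fun j _ => by rw [hω j]

/-! ### Bounds for the increments along one arc -/

theorem abs_argIncrement_centredArc_le_log_add {R θ a b M : ℝ} (hR : 3 ≤ R) (ha : -1 ≤ a)
    (ha0 : a ≤ 0) (hb0 : 0 ≤ b) (hb : b ≤ 1) {F : ℂ → ℂ} (hF : Differentiable ℂ F) (hM1 : 1 ≤ M)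
    (hM : ∀ z, ‖z‖ ≤ 6 → ‖F z‖ ≤ M) (h0 : ∀ t ∈ Icc a b, F (centredArc R θ t) ≠ 0) :
    |argIncrement (fun t => F (centredArc R θ t)) a b| ≤
      4 + 5 * (Real.log M + Real.log (1 + ‖F 0‖⁻¹)) := by
  refine (abs_argIncrement_centredArc_le hR ha ha0 hb0 hb hF hM h0).trans ?_
  have hF0 : 0 < ‖F 0‖ := by
    have := h0 0 ⟨ha0, hb0⟩
    rw [show centredArc R θ 0 = 0 by simp [centredArc]] at this
    exact norm_pos_iff.2 this
  have hp := Real.pi_pos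
  have hpi := Real.pi_lt_d2
  have hl := Real.log_two_gt_d9
  have hi : 0 < ‖F 0‖⁻¹ := inv_pos.2 hF0
  have h1 : Real.log (M / ‖F 0‖) ≤ Real.log M + Real.log (1 + ‖F 0‖⁻¹) := by
    rw [div_eq_mul_inv, Real.log_mul (by positivity) hi.ne']
    gcongr
    linarith
  have h2 : 0 ≤ Real.log M + Real.log (1 + ‖F 0‖⁻¹) :=
    add_nonneg (Real.log_nonneg hM1) (Real.log_nonneg (by linarith))
  set ℓ := Real.log M + Real.log (1 + ‖F 0‖⁻¹)
  have h3 : Real.log (M / ‖F 0‖) / Real.log 2 ≤ ℓ / Real.log 2 := by gcongr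
  have h4 : ℓ / Real.log 2 ≤ ℓ * 1.5 := by
    rw [div_le_iff₀ (by linarith)]; nlinarith
  nlinarith

theorem abs_argIncrement_sub_centredArc_le {R θ a b M : ℝ} (hR : 3 ≤ R) (ha : -1 ≤ a)
    (ha0 : a ≤ 0) (hb0 : 0 ≤ b) (hb : b ≤ 1) {F₁ F₂ : ℂ → ℂ} (hF₁ : Differentiable ℂ F₁)
    (hF₂ : Differentiable ℂ F₂) (hM1 : 1 ≤ M)
    (hM₁ : ∀ z, ‖z‖ ≤ 6 → ‖F₁ z‖ ≤ M) (hM₂ : ∀ z, ‖z‖ ≤ 6 → ‖F₂ z‖ ≤ M)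
    (h₁ : ∀ t ∈ Icc a b, F₁ (centredArc R θ t) ≠ 0)
    (h₂ : ∀ t ∈ Icc a b, F₂ (centredArc R θ t) ≠ 0) :
    |argIncrement (fun t => F₂ (centredArc R θ t)) a b -
      argIncrement (fun t => F₁ (centredArc R θ t)) a b| ≤
      8 + 5 * (2 * Real.log M + Real.log (1 + ‖F₁ 0‖⁻¹) + Real.log (1 + ‖F₂ 0‖⁻¹)) := by
  have e1 := abs_argIncrement_centredArc_le_log_add hR ha ha0 hb0 hb hF₁ hM1 hM₁ h₁
  have e2 := abs_argIncrement_centredArc_le_log_add hR ha ha0 hb0 hb hF₂ hM1 hM₂ h₂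
  refine (abs_sub _ _).trans ?_
  linarith

theorem log_sq_le {y : ℝ} (hy : 1 ≤ y) : Real.log y ^ 2 ≤ 4 * y := by
  have h1 := Real.log_le_sub_one_of_pos (Real.sqrt_pos.2 (by linarith : 0 < y))
  rw [Real.log_sqrt (by linarith)] at h1
  have h2 := Real.sq_sqrt (by linarith : 0 ≤ y)
  have h3 := Real.log_nonneg hy
  have h4 := Real.sqrt_nonneg y
  nlinarith

theorem sq_le_of_le_log {M a t Y : ℝ} (hM : 1 ≤ M) (ha : 1 ≤ a) (ht : 1 ≤ t) (hY0 : 0 ≤ Y)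
    (hY : Y ≤ 8 + 5 * (2 * Real.log M + Real.log a + Real.log t)) :
    Y ^ 2 ≤ 1800 * (M + a + t) := by
  have h1 := log_sq_le hM
  have h2 := log_sq_le ha
  have h3 := log_sq_le ht
  have h4 : Y ^ 2 ≤ (8 + 5 * (2 * Real.log M + Real.log a + Real.log t)) ^ 2 :=
    pow_le_pow_left₀ hY0 hY 2
  set p := Real.log M
  set q := Real.log a
  set s := Real.log t
  nlinarith [sq_nonneg (8 - 5 * (2 * p + q + s)), sq_nonneg (p - q), sq_nonneg (p - s),
    sq_nonneg (q - s)]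

/-- The constant `80` is such that the four logarithms contribute at most
`4 · 5 · log (max u a t) / 40`, that is, a square root of the maximum. -/
theorem exp_sq_le_of_le_log {u a t Y : ℝ} (hu : 1 ≤ u) (ha : 1 ≤ a) (ht : 1 ≤ t)
    (hY : Y ≤ 8 + 5 * (2 * Real.log u + Real.log a + Real.log t)) :
    Real.exp (Y / 80) ^ 2 ≤ 2 * (Real.sqrt u + Real.sqrt a + Real.sqrt t) := by
  set m := max u (max a t) with hm
  have hum : u ≤ m := le_max_left _ _
  have ham : a ≤ m := (le_max_left _ _).trans (le_max_right _ _)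
  have htm : t ≤ m := (le_max_right _ _).trans (le_max_right _ _)
  have hm0 : 0 < m := by linarith
  have l1 := Real.log_le_log (by linarith) hum
  have l2 := Real.log_le_log (by linarith) ham
  have l3 := Real.log_le_log (by linarith) htm
  have h1 : Real.sqrt m ≤ Real.sqrt u + Real.sqrt a + Real.sqrt t := by
    have := Real.sqrt_nonneg u
    have := Real.sqrt_nonneg a
    have := Real.sqrt_nonneg t
    rcases max_choice u (max a t) with h | h
    · rw [hm, h]; linarith
    · rcases max_choice a t with h' | h'
      · rw [hm, h, h']; linarith
      · rw [hm, h, h']; linarith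
  have h2 : Real.exp (1 / 5) ≤ 2 := by
    have h3 : Real.exp (1 / 5) ^ 5 ≤ 2 ^ 5 := by
      rw [← Real.exp_nat_mul]
      norm_num
      have := Real.exp_one_lt_d9
      linarith
    exact le_of_pow_le_pow_left₀ (by norm_num) (by norm_num) h3
  calc Real.exp (Y / 80) ^ 2 = Real.exp (Y / 40) := by
        rw [← Real.exp_nat_mul]; congr 1; push_cast; ring
    _ ≤ Real.exp (1 / 5 + Real.log (Real.sqrt m)) := by
        apply Real.exp_le_exp.2
        rw [Real.log_sqrt hm0.le]
        linarith
    _ = Real.exp (1 / 5) * Real.sqrt m := by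
        rw [Real.exp_add, Real.exp_log (Real.sqrt_pos.2 hm0)]
    _ ≤ _ := by gcongr

/-- A product of mixed factors is bounded by a sum of two products that do not mix `t` with `v`, `u` and
`a`. By `v s ≤ x v + s² / x` each factor is at most a product `P Q` of the two kinds, and
`∏ P · ∏ Q ≤ ∏ P² + ∏ Q²`; the square roots in the hypothesis allow for the squares. -/
theorem prod_one_add_mul_le {ι : Type*} (A : Finset ι) {v s u a t : ι → ℝ} {x : ℝ} (hx : 1 ≤ x)
    (hv : ∀ i ∈ A, v i = 0 ∨ v i = 1) (hs0 : ∀ i ∈ A, 0 ≤ s i)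
    (hu : ∀ i ∈ A, 1 ≤ u i) (ha : ∀ i ∈ A, 1 ≤ a i) (ht : ∀ i ∈ A, 1 ≤ t i)
    (hs : ∀ i ∈ A, s i ^ 2 ≤ 2 * (Real.sqrt (u i) + Real.sqrt (a i) + Real.sqrt (t i))) :
    ∏ i ∈ A, (1 + v i * s i) ≤ ∏ i ∈ A, (1 + 4 * x ^ 2 * v i + 24 / x * (u i + a i)) +
      ∏ i ∈ A, (1 + 12 / x * t i) := by
  have hx0 : 0 < x := by linarith
  set P : ι → ℝ := fun i => 1 + x * v i + 2 / x * (Real.sqrt (u i) + Real.sqrt (a i)) with hP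
  set Q : ι → ℝ := fun i => 1 + 2 / x * Real.sqrt (t i) with hQ
  have hv0 : ∀ i ∈ A, 0 ≤ v i := fun i hi => by rcases hv i hi with h | h <;> rw [h] <;> norm_num
  have hP0 : ∀ i ∈ A, 0 ≤ P i := fun i hi => by
    have := hv0 i hi
    simp only [hP]; positivity
  have hQ0 : ∀ i ∈ A, 0 ≤ Q i := fun i hi => by simp only [hQ]; positivity
  have hinv : 1 / x ≤ 1 := by rw [div_le_one hx0]; exact hx
  have hinv0 : 0 < 1 / x := by positivity
  have h1 : ∏ i ∈ A, (1 + v i * s i) ≤ (∏ i ∈ A, P i) * ∏ i ∈ A, Q i := by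
    rw [← Finset.prod_mul_distrib]
    refine Finset.prod_le_prod (fun i hi => ?_) fun i hi => ?_
    · have := hv0 i hi
      have := hs0 i hi
      positivity
    · have h2 : v i * s i ≤ x * v i + 1 / x * s i ^ 2 := by
        have hvv : v i ^ 2 = v i := by rcases hv i hi with h | h <;> rw [h] <;> norm_num
        have h3 : 0 ≤ (x * v i - s i) ^ 2 / x := by positivity
        have h4 : (x * v i - s i) ^ 2 / x = x * v i ^ 2 - 2 * (v i * s i) + 1 / x * s i ^ 2 := by
          field_simp
          ring
        rw [h4, hvv] at h3
        have := mul_nonneg (hv0 i hi) (hs0 i hi)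
        linarith
      have h5 : 1 / x * s i ^ 2 ≤
          2 / x * (Real.sqrt (u i) + Real.sqrt (a i)) + 2 / x * Real.sqrt (t i) := by
        calc _ ≤ 1 / x * (2 * (Real.sqrt (u i) + Real.sqrt (a i) + Real.sqrt (t i))) := by
              gcongr; exact hs i hi
          _ = _ := by ring
      have h6 : 0 ≤ (x * v i + 2 / x * (Real.sqrt (u i) + Real.sqrt (a i))) *
          (2 / x * Real.sqrt (t i)) := by
        have := hv0 i hi
        positivity
      simp only [hP, hQ]
      nlinarith
  have h2 : ∏ i ∈ A, P i ^ 2 ≤ ∏ i ∈ A, (1 + 4 * x ^ 2 * v i + 24 / x * (u i + a i)) := by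
    refine Finset.prod_le_prod (fun i hi => by positivity) fun i hi => ?_
    have hvv : v i ^ 2 = v i := by rcases hv i hi with h | h <;> rw [h] <;> norm_num
    have e1 := Real.sq_sqrt (by linarith [hu i hi] : 0 ≤ u i)
    have e2 := Real.sq_sqrt (by linarith [ha i hi] : 0 ≤ a i)
    have e3 := Real.one_le_sqrt.2 (hu i hi)
    have e4 := Real.one_le_sqrt.2 (ha i hi)
    set p := Real.sqrt (u i)
    set q := Real.sqrt (a i)
    have f1 : p + q ≤ p ^ 2 + q ^ 2 := by nlinarith
    have f2 : (2 / x * (p + q)) ^ 2 ≤ 8 / x * (p ^ 2 + q ^ 2) := by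
      have g1 : (p + q) ^ 2 ≤ 2 * (p ^ 2 + q ^ 2) := by nlinarith [sq_nonneg (p - q)]
      have g2 : (2 / x) ^ 2 ≤ 4 / x := by
        have : (2 / x) ^ 2 = 4 * (1 / x) * (1 / x) := by ring
        rw [this]
        have : 4 / x = 4 * (1 / x) * 1 := by ring
        rw [this]
        gcongr
      calc _ = (2 / x) ^ 2 * (p + q) ^ 2 := by ring
        _ ≤ 4 / x * (2 * (p ^ 2 + q ^ 2)) := by gcongr
        _ = _ := by ring
    have f3 : 2 / x * (p + q) ≤ 2 / x * (p ^ 2 + q ^ 2) := by gcongr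
    have f4 : (x * v i) ^ 2 = x ^ 2 * v i := by rw [mul_pow, hvv]
    have f5 : x * v i ≤ x ^ 2 * v i := by
      have := hv0 i hi
      gcongr
      nlinarith
    have f6 : 0 ≤ 1 / x * (p ^ 2 + q ^ 2) := by positivity
    have f7 : P i ^ 2 ≤ 1 + 2 * (x * v i) + 2 * (2 / x * (p + q)) + 2 * (x * v i) ^ 2 +
        2 * (2 / x * (p + q)) ^ 2 := by
      simp only [hP]
      nlinarith [sq_nonneg (x * v i - 2 / x * (p + q))]
    rw [← e1, ← e2]
    refine f7.trans ?_
    have g3 : 8 / x * (p ^ 2 + q ^ 2) = 8 * (1 / x * (p ^ 2 + q ^ 2)) := by ring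
    have g4 : 2 / x * (p ^ 2 + q ^ 2) = 2 * (1 / x * (p ^ 2 + q ^ 2)) := by ring
    have g5 : 24 / x * (p ^ 2 + q ^ 2) = 24 * (1 / x * (p ^ 2 + q ^ 2)) := by ring
    rw [g3] at f2
    rw [g4] at f3
    rw [g5, f4]
    linarith
  have h3 : ∏ i ∈ A, Q i ^ 2 ≤ ∏ i ∈ A, (1 + 12 / x * t i) := by
    refine Finset.prod_le_prod (fun i hi => by positivity) fun i hi => ?_
    have e1 := Real.sq_sqrt (by linarith [ht i hi] : 0 ≤ t i)
    have e3 := Real.one_le_sqrt.2 (ht i hi)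
    simp only [hQ]
    set p := Real.sqrt (t i)
    rw [← e1]
    have g1 : (1 / x) * p ≤ (1 / x) * p ^ 2 := by gcongr; nlinarith
    have g2 : (1 / x) ^ 2 * p ^ 2 ≤ (1 / x) * p ^ 2 := by gcongr; nlinarith
    have g0 : 0 ≤ (1 / x) * p ^ 2 := by positivity
    have g3 : (1 + 2 / x * p) ^ 2 = 1 + 4 * (1 / x * p) + 4 * ((1 / x) ^ 2 * p ^ 2) := by ring
    have g4 : 12 / x * p ^ 2 = 12 * (1 / x * p ^ 2) := by ring
    rw [g3, g4]
    linarith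
  rw [Finset.prod_pow] at h2 h3
  have hPn : 0 ≤ ∏ i ∈ A, P i := Finset.prod_nonneg hP0
  have hQn : 0 ≤ ∏ i ∈ A, Q i := Finset.prod_nonneg hQ0
  nlinarith [sq_nonneg ((∏ i ∈ A, P i) - ∏ i ∈ A, Q i), mul_nonneg hPn hQn]

/-! ### Bounds for means -/

section
variable {Ω : Type*} [MeasurableSpace Ω] {μ : Measure Ω}

/-- The measurable function `f` has mean at most `p`, in the sense of the upper integral of its
positive part. -/
structure MeanLE (μ : Measure Ω) (f : Ω → ℝ) (p : ℝ) : Prop where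
  measurable : Measurable f
  nonneg : 0 ≤ p
  lintegral_le : ∫⁻ ω, ENNReal.ofReal (f ω) ∂μ ≤ ENNReal.ofReal p

theorem MeanLE.const [IsProbabilityMeasure μ] {c : ℝ} (hc : 0 ≤ c) : MeanLE μ (fun _ => c) c :=
  ⟨measurable_const, hc, by simp⟩

theorem MeanLE.add {f g : Ω → ℝ} {p q : ℝ} (hf : MeanLE μ f p) (hg : MeanLE μ g q) :
    MeanLE μ (fun ω => f ω + g ω) (p + q) := by
  refine ⟨hf.measurable.add hg.measurable, add_nonneg hf.nonneg hg.nonneg, ?_⟩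
  calc _ ≤ ∫⁻ ω, (ENNReal.ofReal (f ω) + ENNReal.ofReal (g ω)) ∂μ :=
        lintegral_mono fun ω => ENNReal.ofReal_add_le
    _ = ∫⁻ ω, ENNReal.ofReal (f ω) ∂μ + ∫⁻ ω, ENNReal.ofReal (g ω) ∂μ :=
        lintegral_add_left (ENNReal.measurable_ofReal.comp hf.measurable) _
    _ ≤ ENNReal.ofReal p + ENNReal.ofReal q := add_le_add hf.lintegral_le hg.lintegral_le
    _ = _ := (ENNReal.ofReal_add hf.nonneg hg.nonneg).symm

theorem MeanLE.const_mul {f : Ω → ℝ} {p c : ℝ} (hf : MeanLE μ f p) (hc : 0 ≤ c) :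
    MeanLE μ (fun ω => c * f ω) (c * p) := by
  refine ⟨hf.measurable.const_mul c, mul_nonneg hc hf.nonneg, ?_⟩
  simp only [ENNReal.ofReal_mul hc]
  rw [lintegral_const_mul' _ _ ENNReal.ofReal_ne_top]
  gcongr
  exact hf.lintegral_le

theorem MeanLE.indicator {s : Set Ω} (hs : MeasurableSet s) {p : ℝ} (hp : 0 ≤ p)
    (h : μ s ≤ ENNReal.ofReal p) : MeanLE μ (s.indicator 1) p := by
  refine ⟨measurable_one.indicator hs, hp, le_trans (le_of_eq ?_) h⟩
  rw [← lintegral_indicator_one hs]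
  refine lintegral_congr fun ω => ?_
  by_cases hω : ω ∈ s <;> simp [hω]

theorem MeanLE.integrable {f F : Ω → ℝ} {p : ℝ} (hf : MeanLE μ f p)
    (hF : AEStronglyMeasurable F μ) (h : ∀ᵐ ω ∂μ, |F ω| ≤ f ω) :
    Integrable F μ ∧ |∫ ω, F ω ∂μ| ≤ p := by
  have h1 : ∫⁻ ω, ‖F ω‖ₑ ∂μ ≤ ENNReal.ofReal p := by
    refine (lintegral_mono_ae ?_).trans hf.lintegral_le
    filter_upwards [h] with ω hω
    rw [Real.enorm_eq_ofReal_abs]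
    exact ENNReal.ofReal_le_ofReal hω
  refine ⟨⟨hF, h1.trans_lt ENNReal.ofReal_lt_top⟩, ?_⟩
  rw [← Real.norm_eq_abs, ← ENNReal.ofReal_le_ofReal_iff hf.nonneg, ofReal_norm]
  exact (enorm_integral_le_lintegral_enorm _).trans h1

end

/-! ### Majorants on the disc of radius `6` -/

/-- A bound on the disc of radius `6` for the function with normalized Taylor coefficients `c k`. -/
noncomputable def discMajorant (c : ℕ → ℂ) : ℝ :=
  ∑' k, ‖c k‖ * (Real.exp 288 * Real.exp (-k : ℝ))

/-- A bound for the mean of the majorant of a Gaussian entire function. -/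
noncomputable def discMajorantMean : ℝ := 2 * ∑' k : ℕ, Real.exp 288 * Real.exp (-k : ℝ)

theorem summable_discMajorant_weight : Summable fun k : ℕ => Real.exp 288 * Real.exp (-k : ℝ) :=
  Real.summable_exp_neg_nat.mul_left _

theorem discMajorant_nonneg (c : ℕ → ℂ) : 0 ≤ discMajorant c := tsum_nonneg fun _ => by positivity

theorem discMajorantMean_nonneg : 0 ≤ discMajorantMean :=
  mul_nonneg two_pos.le (tsum_nonneg fun _ => by positivity)

theorem measurable_discMajorant : Measurable discMajorant :=
  Measurable.tsum fun k => (measurable_pi_apply k).norm.mul_const _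

theorem norm_gefSeries_le_discMajorant {c : ℕ → ℂ}
    (hs : Summable fun k => ‖c k‖ * (Real.exp 288 * Real.exp (-k : ℝ))) {z : ℂ} (hz : ‖z‖ ≤ 6) :
    ‖gefSeries c z‖ ≤ discMajorant c :=
  tsum_of_norm_bounded hs.hasSum fun k => by
    rw [norm_mul]
    gcongr
    exact norm_fockMonomial_le k hz

theorem norm_translatedSeries_le {a : ℕ → ℂ} {w : ℂ} {C : ℕ → ℝ}
    (hs : Summable fun m => ‖a m‖ * C m) {z : ℂ} (hC : ∀ m, ‖displaced w m z‖ ≤ C m) :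
    ‖translatedSeries a w z‖ ≤ ∑' m, ‖a m‖ * C m :=
  tsum_of_norm_bounded hs.hasSum fun m => by
    rw [norm_mul]
    gcongr
    exact hC m

/-! ### Small values on the arc -/

/-- The function with normalized Taylor coefficients `c k` is small somewhere on a fine partition
of the curve `γ` on `[a, b]`. The mesh is so fine that otherwise the function is not small anywhere
on the curve, if its coefficients are moderate. -/
def NearZero (R : ℝ) (γ : ℝ → ℂ) (a b : ℝ) (c : ℕ → ℂ) : Prop :=
  ∃ i ∈ Finset.range (⌈R ^ 22⌉₊ + 1),
    ‖gefSeries c (γ (a + i * ((b - a) / ⌈R ^ 22⌉₊)))‖ ≤ 3 * (R ^ 20)⁻¹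

theorem measurableSet_nearZero (R : ℝ) (γ : ℝ → ℂ) (a b : ℝ) :
    MeasurableSet {c : ℕ → ℂ | NearZero R γ a b c} := by
  unfold NearZero
  have h : ∀ i : ℕ, MeasurableSet {c : ℕ → ℂ |
      ‖gefSeries c (γ (a + i * ((b - a) / ⌈R ^ 22⌉₊)))‖ ≤ 3 * (R ^ 20)⁻¹} := fun i =>
    measurableSet_le (measurable_gefSeries_apply (fun k => measurable_pi_apply k) _).norm
      measurable_const
  have h2 := Finset.measurableSet_biUnion (Finset.range (⌈R ^ 22⌉₊ + 1)) fun i _ => h i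
  convert h2 using 1
  ext c
  simp

theorem two_mul_le_norm_of_not_nearZero {R : ℝ} (hR1 : 1 ≤ R) (hR : 80 * Real.exp 8 ≤ R)
    {γ : ℝ → ℂ} {a b : ℝ} (hab : b - a ≤ 2) (hγ : ∀ s t, ‖γ s - γ t‖ ≤ |s - t|)
    (hγ1 : ∀ t ∈ Icc a b, ‖γ t‖ ≤ 1) {c : ℕ → ℂ} (hc : ∀ k, ‖c k‖ ≤ R + k)
    (h : ¬ NearZero R γ a b c) {t : ℝ} (ht : t ∈ Icc a b) :
    2 * (R ^ 20)⁻¹ ≤ ‖gefSeries c (γ t)‖ := by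
  have hR0 : 0 < R := by linarith
  have hN : 0 < ⌈R ^ 22⌉₊ := Nat.ceil_pos.2 (by positivity)
  have hN' := Nat.le_ceil (R ^ 22)
  obtain ⟨i, hi, hiI, hit⟩ := exists_grid_near ht hN
  set q := a + i * ((b - a) / ⌈R ^ 22⌉₊) with hq
  have h1 := norm_gefSeries_sub_le hR1 hc le_rfl (hγ1 q hiI) (hγ1 t ht)
  have h2 : 3 * (R ^ 20)⁻¹ < ‖gefSeries c (γ q)‖ := by
    by_contra hcon
    exact h ⟨i, hi, not_lt.1 hcon⟩
  have h3 : 40 * R * Real.exp (8 * 1 ^ 2) * ‖γ q - γ t‖ ≤ (R ^ 20)⁻¹ := by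
    have e1 : ‖γ q - γ t‖ ≤ 2 / R ^ 22 := by
      refine (hγ q t).trans ?_
      rw [abs_sub_comm]
      refine hit.trans ?_
      gcongr
    calc _ ≤ 40 * R * Real.exp (8 * 1 ^ 2) * (2 / R ^ 22) := by gcongr
      _ = (80 * Real.exp 8) * (R / R ^ 22) := by norm_num; ring
      _ ≤ R * (R / R ^ 22) := by gcongr
      _ = _ := by field_simp
  have h4 := (norm_sub_norm_le (gefSeries c (γ q)) (gefSeries c (γ t))).trans (h1.trans h3)
  linarith

section
variable {Ω : Type*} [MeasurableSpace Ω] {μ : Measure Ω}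

/-- About `R²²` points, with a probability of order `(R⁻²⁰)²` for each. -/
theorem IsStdFamily.measure_nearZero_le {ζ : ℕ → Ω → ℂ} (hζ : IsStdFamily μ ζ) {R : ℝ}
    (hR : 72 ≤ R) (γ : ℝ → ℂ) (a b : ℝ) :
    μ {ω | NearZero R γ a b fun k => ζ k ω} ≤ ENNReal.ofReal (R ^ 17)⁻¹ := by
  refine (hζ.measure_exists_norm_gefSeries_le (fun i => γ (a + i * ((b - a) / ⌈R ^ 22⌉₊)))
    ⌈R ^ 22⌉₊ (x := 3 * (R ^ 20)⁻¹) (by positivity)).trans (ENNReal.ofReal_le_ofReal ?_)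
  have hN := (Nat.ceil_lt_add_one (a := R ^ 22) (by positivity)).le
  have h1 : 2 ≤ R ^ 22 := by
    have : R ≤ R ^ 22 := le_self_pow₀ (by linarith) (by norm_num)
    linarith
  calc ((⌈R ^ 22⌉₊ : ℝ) + 1) * (4 * (3 * (R ^ 20)⁻¹) ^ 2) ≤
        (R ^ 22 + R ^ 22) * (4 * (3 * (R ^ 20)⁻¹) ^ 2) :=
        mul_le_mul_of_nonneg_right (by linarith) (by positivity)
    _ = 72 * (R ^ 18)⁻¹ := by field_simp; ring
    _ ≤ R * (R ^ 18)⁻¹ := by gcongr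
    _ = _ := by field_simp

/-! ### Estimates for the coupled functions -/

variable {R : ℝ} {n : ℕ} {w : Fin n → ℂ} {ζ : ℕ → Ω → ℂ} {ξ : Fin n × ℕ → Ω → ℂ}

theorem CoupledFamily.std_block (H : CoupledFamily μ R w ζ ξ) (j : Fin n) :
    IsStdFamily μ fun k => ξ (j, k) :=
  H.std_new.precomp (Prod.mk_right_injective j)

/-- The event that all coefficients of the original and of the coupled functions are moderate. -/
def moderateEvent (R : ℝ) {n : ℕ} (ζ : ℕ → Ω → ℂ) (ξ : Fin n × ℕ → Ω → ℂ) : Set Ω :=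
  {ω | (∀ m : ℕ, ‖ζ m ω‖ ≤ R + m) ∧ ∀ (j : Fin n) (k : ℕ), ‖ξ (j, k) ω‖ ≤ R + k}

theorem CoupledFamily.measurableSet_moderateEvent (H : CoupledFamily μ R w ζ ξ) :
    MeasurableSet (moderateEvent R ζ ξ) := by
  have h1 := H.std_orig.measurable
  have h2 := H.std_new.measurable
  refine MeasurableSet.inter (s₁ := {ω | ∀ m : ℕ, ‖ζ m ω‖ ≤ R + m})
    (s₂ := {ω | ∀ (j : Fin n) (k : ℕ), ‖ξ (j, k) ω‖ ≤ R + k}) ?_ ?_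
  · simp only [ofPred_forall]
    exact MeasurableSet.iInter fun m => measurableSet_le (h1 m).norm measurable_const
  · simp only [ofPred_forall]
    exact MeasurableSet.iInter fun j => MeasurableSet.iInter fun k =>
      measurableSet_le (h2 (j, k)).norm measurable_const

theorem CoupledFamily.measure_compl_moderateEvent_le (H : CoupledFamily μ R w ζ ξ) (hR : 1 ≤ R) :
    μ (moderateEvent R ζ ξ)ᶜ ≤ ENNReal.ofReal ((n + 1) * (6 * Real.exp (-R ^ 2 / 2))) := by
  calc _ ≤ μ ({ω | ∃ m : ℕ, R + m < ‖ζ m ω‖} ∪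
        ⋃ j : Fin n, {ω | ∃ k : ℕ, R + k < ‖ξ (j, k) ω‖}) := by
        refine measure_mono fun ω hω => ?_
        simp only [moderateEvent, mem_compl_iff, mem_ofPred_eq, not_and_or, not_forall,
          not_le] at hω
        simpa using hω
    _ ≤ μ {ω | ∃ m : ℕ, R + m < ‖ζ m ω‖} +
        ∑ j : Fin n, μ {ω | ∃ k : ℕ, R + k < ‖ξ (j, k) ω‖} :=
        (measure_union_le _ _).trans (by gcongr; exact measure_iUnion_fintype_le _ _)
    _ ≤ ENNReal.ofReal (6 * Real.exp (-R ^ 2 / 2)) +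
        ∑ _j : Fin n, ENNReal.ofReal (6 * Real.exp (-R ^ 2 / 2)) := by
        gcongr with j
        · exact H.std_orig.measure_exists_norm_gt_le hR
        · exact (H.std_block j).measure_exists_norm_gt_le hR
    _ = _ := by
        rw [Finset.sum_const, Finset.card_univ, Fintype.card_fin, nsmul_eq_mul,
          ENNReal.ofReal_mul (by positivity : (0 : ℝ) ≤ n + 1), ← Nat.cast_add_one,
          ENNReal.ofReal_natCast, Nat.cast_add_one, add_mul, one_mul, add_comm]

theorem CoupledFamily.meanLE_discMajorant (H : CoupledFamily μ R w ζ ξ) (j : Fin n) :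
    MeanLE μ (fun ω => discMajorant fun k => ξ (j, k) ω) discMajorantMean := by
  refine ⟨measurable_discMajorant.comp (measurable_pi_lambda _ fun k =>
    (H.std_block j).measurable k), discMajorantMean_nonneg, ?_⟩
  exact ((H.std_block j).ae_summable_norm_mul (fun k => by positivity)
    summable_discMajorant_weight).2

theorem CoupledFamily.meanLE_inv_norm (H : CoupledFamily μ R w ζ ξ) (j : Fin n) :
    MeanLE μ (fun ω => ‖gefSeries (fun k => ξ (j, k) ω) 0‖⁻¹) 17 := by
  refine ⟨(measurable_gefSeries_apply (H.std_block j).measurable 0).norm.inv, by norm_num, ?_⟩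
  have h0 : ∀ ω, gefSeries (fun k => ξ (j, k) ω) 0 = 0 + 1 * ξ (j, 0) ω := fun ω => by
    rw [gefSeries, tsum_eq_single 0 (fun k hk => by simp [fockMonomial, hk])]
    simp [fockMonomial]
  simp only [h0]
  rw [H.std_new.lintegral_comp (j, 0) (ψ := fun x => ENNReal.ofReal ‖0 + 1 * x‖⁻¹) (by fun_prop)]
  simpa using lintegral_inv_norm_shift_le 0 1 (by norm_num)

theorem CoupledFamily.meanLE_inv_norm_translated (H : CoupledFamily μ R w ζ ξ) (j : Fin n) :
    MeanLE μ (fun ω => ‖translatedSeries (fun m => ζ m ω) (w j) 0‖⁻¹) 17 := by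
  have := H.std_new.isProbabilityMeasure
  refine ⟨(measurable_tsum_mul_const H.std_orig.measurable _).norm.inv, by norm_num, ?_⟩
  obtain ⟨s, b, hs, hb, hae⟩ := H.triangular j
  have h := H.std_new.lintegral_mul_shift_le (i := (j, 0)) (by simp) (Z := fun _ => 1)
    measurable_const hb (ψ := fun x => ENNReal.ofReal ‖x‖⁻¹) (by fun_prop) s
    (fun c => lintegral_inv_norm_shift_le c s hs)
  simp only [one_mul, lintegral_one, measure_univ, mul_one] at h
  refine le_trans (le_of_eq (lintegral_congr_ae ?_)) (h.trans (by simp))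
  filter_upwards [hae] with ω hω
  rw [hω]

end

/-! ### The increments of the coupled functions -/

/-- The increment of the argument along the centred arc of the translated original function. -/
noncomputable def origIncrement {Ω : Type*} (R a b : ℝ) (ζ : ℕ → Ω → ℂ) {n : ℕ} (θ : Fin n → ℝ)
    (j : Fin n) (ω : Ω) : ℝ :=
  argIncrement (fun t => translatedSeries (fun m => ζ m ω) (circleArc R (θ j) 0)
    (centredArc R (θ j) t)) a b

/-- The increment of the argument along the centred arc of the coupled function. -/
noncomputable def newIncrement {Ω : Type*} (R a b : ℝ) {n : ℕ} (ξ : Fin n × ℕ → Ω → ℂ)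
    (θ : Fin n → ℝ) (j : Fin n) (ω : Ω) : ℝ :=
  argIncrement (fun t => gefSeries (fun k => ξ (j, k) ω) (centredArc R (θ j) t)) a b

/-- The numerical inequalities that hold for large radii. -/
structure IsLarge (R : ℝ) : Prop where
  million_le : 1000000 ≤ R
  exp_le : 80 * Real.exp 8 ≤ R
  mean_le : 8 * (4 + 24 * (discMajorantMean + 19)) ≤ R
  tail_le : (8 * R + 1) * (6 * Real.exp (-R ^ 2 / 2)) ≤ Real.exp (-R)
  pow_le : Real.exp (-R) ≤ (R ^ 17)⁻¹

theorem eventually_isLarge : ∀ᶠ R : ℝ in Filter.atTop, IsLarge R := by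
  filter_upwards [Filter.eventually_ge_atTop 1000000, Filter.eventually_ge_atTop (80 * Real.exp 8),
    Filter.eventually_ge_atTop (8 * (4 + 24 * (discMajorantMean + 19))),
    (Real.tendsto_exp_div_pow_atTop 17).eventually_ge_atTop 1] with R h1 h2 h3 h4
  have hR0 : 0 < R := by linarith
  have h5 : R ^ 17 ≤ Real.exp R := by
    rwa [one_le_div (by positivity)] at h4
  refine ⟨h1, h2, h3, ?_, ?_⟩
  · have e1 : 48 * R + 6 ≤ Real.exp R := by
      have : 48 * R + 6 ≤ R ^ 2 := by nlinarith
      have : R ^ 2 ≤ R ^ 17 := pow_le_pow_right₀ (by linarith) (by norm_num)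
      linarith
    calc _ = (48 * R + 6) * Real.exp (-R ^ 2 / 2) := by ring
      _ ≤ Real.exp R * Real.exp (-R ^ 2 / 2) := by gcongr
      _ = Real.exp (R + -R ^ 2 / 2) := (Real.exp_add _ _).symm
      _ ≤ _ := by
          apply Real.exp_le_exp.2
          nlinarith
  · rw [Real.exp_neg]
    gcongr

section
variable {Ω : Type*} [MeasurableSpace Ω] {μ : Measure Ω} {R a b : ℝ} {n : ℕ} {θ : Fin n → ℝ}
  {ζ : ℕ → Ω → ℂ} {ξ : Fin n × ℕ → Ω → ℂ}

theorem circleArc_zero_add_centredArc (R θ t : ℝ) :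
    circleArc R θ 0 + centredArc R θ t = circleArc R θ t := by
  rw [centredArc]; ring

theorem norm_centredArc_sub_le (hR : 0 < R) (θ s t : ℝ) :
    ‖centredArc R θ s - centredArc R θ t‖ ≤ |s - t| := by
  simpa [centredArc] using norm_circleArc_sub_le hR θ s t

theorem norm_centredArc_le_one (hR : 0 < R) (ha : -1 ≤ a) (hb : b ≤ 1) (θ : ℝ) :
    ∀ t ∈ Icc a b, ‖centredArc R θ t‖ ≤ 1 := fun t ht =>
  (norm_centredArc_le hR θ t).trans (abs_le.2 ⟨ha.trans ht.1, ht.2.trans hb⟩)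

theorem IsStdFamily.ae_differentiable_gefSeries (hζ : IsStdFamily μ ζ) :
    ∀ᵐ ω ∂μ, Differentiable ℂ (gefSeries fun k => ζ k ω) := by
  filter_upwards [hζ.ae_moderate] with ω ⟨R, hR, h⟩
  exact differentiable_gefSeries (by exact_mod_cast hR) h

theorem IsStdFamily.ae_gefSeries_circleArc_ne_zero (hζ : IsStdFamily μ ζ) (hR : 1 ≤ R) (θ : ℝ) :
    ∀ᵐ ω ∂μ, ∀ t ∈ Icc a b, gefSeries (fun k => ζ k ω) (circleArc R θ t) ≠ 0 :=
  hζ.ae_gefSeries_ne_zero hR (norm_circleArc_sub_le (by linarith) θ)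
    fun t _ => (norm_circleArc (by linarith) θ t).le

theorem IsStdFamily.ae_gefSeries_centredArc_ne_zero (hζ : IsStdFamily μ ζ) (hR : 0 < R)
    (ha : -1 ≤ a) (hb : b ≤ 1) (θ : ℝ) :
    ∀ᵐ ω ∂μ, ∀ t ∈ Icc a b, gefSeries (fun k => ζ k ω) (centredArc R θ t) ≠ 0 :=
  hζ.ae_gefSeries_ne_zero le_rfl (norm_centredArc_sub_le hR θ) (norm_centredArc_le_one hR ha hb θ)

theorem CoupledFamily.ae_regular
    (H : CoupledFamily μ R (fun j => circleArc R (θ j) 0) ζ ξ) (hR : 1 ≤ R)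
    (ha : -1 ≤ a) (hb : b ≤ 1) : ∀ᵐ ω ∂μ, ∀ j,
    Differentiable ℂ (gefSeries fun k => ξ (j, k) ω) ∧
    Differentiable ℂ (translatedSeries (fun m => ζ m ω) (circleArc R (θ j) 0)) ∧
    (∀ t ∈ Icc a b, gefSeries (fun k => ξ (j, k) ω) (centredArc R (θ j) t) ≠ 0) ∧
    ∀ t ∈ Icc a b, translatedSeries (fun m => ζ m ω) (circleArc R (θ j) 0)
      (centredArc R (θ j) t) ≠ 0 := by
  rw [ae_all_iff]
  intro j
  filter_upwards [(H.std_block j).ae_differentiable_gefSeries,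
    H.std_orig.ae_differentiable_gefSeries,
    (H.std_block j).ae_gefSeries_centredArc_ne_zero (R := R) (by linarith) ha hb (θ j),
    H.std_orig.ae_gefSeries_circleArc_ne_zero (a := a) (b := b) hR (θ j)] with ω h1 h2 h3 h4
  refine ⟨h1, ?_, h3, fun t ht => ?_⟩
  · have : translatedSeries (fun m => ζ m ω) (circleArc R (θ j) 0) = _ :=
      funext (translatedSeries_eq _ _)
    rw [this]
    fun_prop
  · rw [translatedSeries_eq, circleArc_zero_add_centredArc]
    exact mul_ne_zero (h4 t ht) (Complex.exp_ne_zero _)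

/-- The increments are at most `Y`, where `Y ^ 2` has a mean that grows only polynomially in `R`. No
event is excluded here, so that the translated function is bounded by means of its own coefficients
and not by means of the coupled function. -/
theorem CoupledFamily.ae_increment_le
    (H : CoupledFamily μ R (fun j => circleArc R (θ j) 0) ζ ξ) (hR : 3 ≤ R)
    (ha : -1 ≤ a) (ha0 : a ≤ 0) (hb0 : 0 ≤ b)
    (hb : b ≤ 1) : ∃ Φ : Fin n → Ω → ℝ,
      (∀ j, MeanLE μ (Φ j) (1800 * ((1 + discMajorantMean + 2 * R ^ 3) + (1 + 17) + (1 + 17)))) ∧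
      ∀ᵐ ω ∂μ, ∀ j, ∃ Y, 0 ≤ Y ∧ Y ^ 2 ≤ Φ j ω ∧ |newIncrement R a b ξ θ j ω| ≤ Y ∧
        |origIncrement R a b ζ θ j ω| ≤ Y ∧
        |origIncrement R a b ζ θ j ω - newIncrement R a b ξ θ j ω| ≤ Y := by
  have := H.std_new.isProbabilityMeasure
  obtain ⟨C, hCs, hC0, hCR, hC⟩ := H.bounded
  have hB : MeanLE μ (fun ω => ∑' m, ‖ζ m ω‖ * C m) (2 * R ^ 3) := by
    refine ⟨Measurable.tsum fun m => (H.std_orig.measurable m).norm.mul_const _, by positivity,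
      (H.std_orig.ae_summable_norm_mul hC0 hCs).2.trans (ENNReal.ofReal_le_ofReal ?_)⟩
    gcongr
  refine ⟨fun j ω => 1800 * ((1 + discMajorant (fun k => ξ (j, k) ω) + ∑' m, ‖ζ m ω‖ * C m) +
    (1 + ‖gefSeries (fun k => ξ (j, k) ω) 0‖⁻¹) +
    (1 + ‖translatedSeries (fun m => ζ m ω) (circleArc R (θ j) 0) 0‖⁻¹)), fun j => ?_, ?_⟩
  · exact (((((MeanLE.const zero_le_one).add (H.meanLE_discMajorant j)).add hB).add
      ((MeanLE.const zero_le_one).add (H.meanLE_inv_norm j))).add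
      ((MeanLE.const zero_le_one).add (H.meanLE_inv_norm_translated j))).const_mul (by norm_num)
  filter_upwards [H.ae_regular (by linarith) ha hb, (H.std_orig.ae_summable_norm_mul hC0 hCs).1,
    ae_all_iff.2 fun j => ((H.std_block j).ae_summable_norm_mul (fun k => by positivity)
      summable_discMajorant_weight).1] with ω h1 h2 h3 j
  obtain ⟨d1, d2, n1, n2⟩ := h1 j
  set G := discMajorant (fun k => ξ (j, k) ω)
  set B := ∑' m, ‖ζ m ω‖ * C m
  have hG0 : 0 ≤ G := discMajorant_nonneg _
  have hB0 : 0 ≤ B := tsum_nonneg fun m => mul_nonneg (norm_nonneg _) (hC0 m)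
  have hM1 : 1 ≤ 1 + G + B := by linarith
  have m1 : ∀ z : ℂ, ‖z‖ ≤ 6 → ‖gefSeries (fun k => ξ (j, k) ω) z‖ ≤ 1 + G + B := fun z hz =>
    (norm_gefSeries_le_discMajorant (h3 j) hz).trans (by linarith)
  have m2 : ∀ z : ℂ, ‖z‖ ≤ 6 →
      ‖translatedSeries (fun m => ζ m ω) (circleArc R (θ j) 0) z‖ ≤ 1 + G + B := fun z hz =>
    (norm_translatedSeries_le h2 fun m => hC j m z hz).trans (by linarith)
  have b1 := abs_argIncrement_centredArc_le_log_add hR ha ha0 hb0 hb d1 hM1 m1 n1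
  have b2 := abs_argIncrement_centredArc_le_log_add hR ha ha0 hb0 hb d2 hM1 m2 n2
  have b3 := abs_argIncrement_sub_centredArc_le hR ha ha0 hb0 hb d1 d2 hM1 m1 m2 n1 n2
  have i1 : 1 ≤ 1 + ‖gefSeries (fun k => ξ (j, k) ω) 0‖⁻¹ := by
    have := inv_nonneg.2 (norm_nonneg (gefSeries (fun k => ξ (j, k) ω) 0))
    linarith
  have i2 : 1 ≤ 1 + ‖translatedSeries (fun m => ζ m ω) (circleArc R (θ j) 0) 0‖⁻¹ := by
    have := inv_nonneg.2 (norm_nonneg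
      (translatedSeries (fun m => ζ m ω) (circleArc R (θ j) 0) 0))
    linarith
  have l0 := Real.log_nonneg hM1
  have l1 := Real.log_nonneg i1
  have l2 := Real.log_nonneg i2
  refine ⟨_, ?_, sq_le_of_le_log hM1 i1 i2 ?_ le_rfl, ?_, ?_, b3⟩
  · positivity
  · positivity
  · exact b1.trans (by linarith)
  · exact b2.trans (by linarith)

theorem CoupledFamily.abs_origIncrement_sub_newIncrement_le
    (H : CoupledFamily μ R (fun j => circleArc R (θ j) 0) ζ ξ) (hR : IsLarge R) (ha : -1 ≤ a)
    (hab : a ≤ b) (hb : b ≤ 1) {ω : Ω} (hω : ω ∈ moderateEvent R ζ ξ) {j : Fin n}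
    (hT : Differentiable ℂ (translatedSeries (fun m => ζ m ω) (circleArc R (θ j) 0)))
    (h : ¬ NearZero R (centredArc R (θ j)) a b fun k => ξ (j, k) ω) :
    |origIncrement R a b ζ θ j ω - newIncrement R a b ξ θ j ω| ≤ 2 / R ^ 2 := by
  have hR1 := hR.million_le
  have hR0 : 0 < R := by linarith
  have hγ1 := norm_centredArc_le_one hR0 ha hb (θ j)
  have h1 := abs_argIncrement_sub_le (δ := (R ^ 20)⁻¹) (η := (R ^ 22)⁻¹) hab (by positivity)
    (inv_anti₀ (by positivity) (pow_le_pow_right₀ (by linarith) (by norm_num)))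
    (h₁ := fun t => gefSeries (fun k => ξ (j, k) ω) (centredArc R (θ j) t))
    (h₂ := fun t => translatedSeries (fun m => ζ m ω) (circleArc R (θ j) 0)
      (centredArc R (θ j) t))
    ((differentiable_gefSeries (by linarith) (hω.2 j)).continuous.comp
      (continuous_centredArc R (θ j))).continuousOn
    (hT.continuous.comp (continuous_centredArc R (θ j))).continuousOn
    (fun t ht => two_mul_le_norm_of_not_nearZero (by linarith) hR.exp_le (by linarith)
      (norm_centredArc_sub_le hR0 (θ j)) hγ1 (hω.2 j) h ht)
    (fun t ht => H.close ω j hω.1 (hω.2 j) _ ((hγ1 t ht).trans (by norm_num)))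
  refine h1.trans (le_of_eq ?_)
  field_simp

/-- The mean of the difference of the increments is negligible: off an event of probability `O(R⁻¹⁷)`
the difference is at most `2 R⁻²`, and on this event `Y ≤ R⁸ + R⁻⁸ Y ^ 2`, where the mean of `Y ^ 2`
is `O(R³)`. -/
theorem CoupledFamily.abs_integral_sub_le
    (H : CoupledFamily μ R (fun j => circleArc R (θ j) 0) ζ ξ) (hR : IsLarge R)
    (hn : (n : ℝ) ≤ 8 * R) (ha : -1 ≤ a)
    (ha0 : a ≤ 0) (hb0 : 0 ≤ b) (hb : b ≤ 1) (j : Fin n)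
    (hmT : AEMeasurable (origIncrement R a b ζ θ j) μ)
    (hmg : AEMeasurable (newIncrement R a b ξ θ j) μ) :
    Integrable (origIncrement R a b ζ θ j) μ ∧ Integrable (newIncrement R a b ξ θ j) μ ∧
      |∫ ω, (origIncrement R a b ζ θ j ω - newIncrement R a b ξ θ j ω) ∂μ| ≤ 1 / R := by
  have := H.std_new.isProbabilityMeasure
  have hR1 := hR.million_le
  have hR0 : 0 < R := by linarith
  obtain ⟨Φ, hΦ, hae⟩ := H.ae_increment_le (by linarith) ha ha0 hb0 hb
  have hΦ1 := (MeanLE.const zero_le_one).add (hΦ j)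
  refine ⟨(hΦ1.integrable hmT.aestronglyMeasurable ?_).1,
    (hΦ1.integrable hmg.aestronglyMeasurable ?_).1, ?_⟩
  · filter_upwards [hae] with ω hω
    obtain ⟨Y, h0, h1, h2, h3, h4⟩ := hω j
    nlinarith [sq_nonneg (Y - 1)]
  · filter_upwards [hae] with ω hω
    obtain ⟨Y, h0, h1, h2, h3, h4⟩ := hω j
    nlinarith [sq_nonneg (Y - 1)]
  set N : Set Ω := {ω | NearZero R (centredArc R (θ j)) a b fun k => ξ (j, k) ω} with hN
  have hNm : MeasurableSet N := (measurableSet_nearZero R (centredArc R (θ j)) a b).preimage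
    (measurable_pi_lambda _ fun k => (H.std_block j).measurable k)
  have hNp : MeanLE μ (N.indicator 1) (R ^ 17)⁻¹ := MeanLE.indicator hNm (by positivity)
    ((H.std_block j).measure_nearZero_le (by linarith) _ a b)
  have hcp : MeanLE μ ((moderateEvent R ζ ξ)ᶜ.indicator 1) (R ^ 17)⁻¹ := by
    refine MeanLE.indicator H.measurableSet_moderateEvent.compl (by positivity)
      ((H.measure_compl_moderateEvent_le (by linarith)).trans (ENNReal.ofReal_le_ofReal ?_))
    refine le_trans ?_ (hR.tail_le.trans hR.pow_le)
    gcongr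
  have hmean := ((MeanLE.const (μ := μ) (c := 2 / R ^ 2) (by positivity)).add
    ((hNp.add hcp).const_mul (c := R ^ 8) (by positivity))).add
    ((hΦ j).const_mul (c := (R ^ 8)⁻¹) (by positivity))
  refine (hmean.integrable (hmT.sub hmg).aestronglyMeasurable ?_).2.trans ?_
  · filter_upwards [hae, H.ae_regular (by linarith) ha hb] with ω hω hreg
    obtain ⟨Y, h0, h1, h2, h3, h4⟩ := hω j
    have hΦ0 : 0 ≤ Φ j ω := (sq_nonneg Y).trans h1
    have hN0 : 0 ≤ N.indicator (1 : Ω → ℝ) ω := indicator_nonneg (by simp) ω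
    have hc0 : 0 ≤ (moderateEvent R ζ ξ)ᶜ.indicator (1 : Ω → ℝ) ω := indicator_nonneg (by simp) ω
    by_cases hgood : ω ∈ moderateEvent R ζ ξ ∧ ω ∉ N
    · refine (H.abs_origIncrement_sub_newIncrement_le hR ha (ha0.trans hb0) hb hgood.1
        (hreg j).2.1 hgood.2).trans ?_
      have : 0 ≤ R ^ 8 * (N.indicator (1 : Ω → ℝ) ω +
        (moderateEvent R ζ ξ)ᶜ.indicator (1 : Ω → ℝ) ω) := by positivity
      have : 0 ≤ (R ^ 8)⁻¹ * Φ j ω := by positivity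
      linarith
    · have h5 : 1 ≤ N.indicator (1 : Ω → ℝ) ω +
          (moderateEvent R ζ ξ)ᶜ.indicator (1 : Ω → ℝ) ω := by
        by_cases h : ω ∈ moderateEvent R ζ ξ
        · have : ω ∈ N := by
            by_contra hcon
            exact hgood ⟨h, hcon⟩
          rw [indicator_of_mem this] at *
          simp only [Pi.one_apply] at *
          linarith
        · rw [indicator_of_mem (show ω ∈ (moderateEvent R ζ ξ)ᶜ from h)] at *
          simp only [Pi.one_apply] at *
          linarith
      have h6 : Y ≤ R ^ 8 + (R ^ 8)⁻¹ * Y ^ 2 := by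
        have h7 : 0 < R ^ 8 := by positivity
        have h8 : 0 ≤ (R ^ 8)⁻¹ * (R ^ 8 - Y) ^ 2 := by positivity
        have h9 : (R ^ 8)⁻¹ * (R ^ 8 - Y) ^ 2 = R ^ 8 - 2 * Y + (R ^ 8)⁻¹ * Y ^ 2 := by
          field_simp; ring
        linarith
      have h10 : R ^ 8 * 1 ≤ R ^ 8 * (N.indicator (1 : Ω → ℝ) ω +
          (moderateEvent R ζ ξ)ᶜ.indicator (1 : Ω → ℝ) ω) := by gcongr
      have h11 : (R ^ 8)⁻¹ * Y ^ 2 ≤ (R ^ 8)⁻¹ * Φ j ω := by gcongr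
      have h12 : 0 ≤ 2 / R ^ 2 := by positivity
      refine h4.trans ?_
      linarith
  · have hK := hR.mean_le
    have hK0 := discMajorantMean_nonneg
    have e1 : 2 / R ^ 2 ≤ 1 / 4 * (1 / R) := by
      have : 2 / R ^ 2 = 2 / R * (1 / R) := by field_simp
      rw [this]
      refine mul_le_mul_of_nonneg_right ?_ (by positivity)
      rw [div_le_iff₀ hR0]; linarith
    have e2 : R ^ 8 * ((R ^ 17)⁻¹ + (R ^ 17)⁻¹) ≤ 1 / 4 * (1 / R) := by
      have : R ^ 8 * ((R ^ 17)⁻¹ + (R ^ 17)⁻¹) = 2 / R ^ 8 * (1 / R) := by field_simp; ring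
      rw [this]
      refine mul_le_mul_of_nonneg_right ?_ (by positivity)
      rw [div_le_iff₀ (by positivity)]
      have : R ≤ R ^ 8 := le_self_pow₀ (by linarith) (by norm_num)
      linarith
    have e3 : (R ^ 8)⁻¹ * (1800 * ((1 + discMajorantMean + 2 * R ^ 3) + (1 + 17) + (1 + 17))) ≤
        1 / 4 * (1 / R) := by
      have f1 : R ≤ R ^ 3 := le_self_pow₀ (by linarith) (by norm_num)
      calc _ ≤ (R ^ 8)⁻¹ * (1800 * (4 * R ^ 3)) := by gcongr; linarith
        _ = 7200 / R ^ 4 * (1 / R) := by field_simp; ring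
        _ ≤ _ := by
          refine mul_le_mul_of_nonneg_right ?_ (by positivity)
          rw [div_le_iff₀ (by positivity)]
          have : R ≤ R ^ 4 := le_self_pow₀ (by linarith) (by norm_num)
          linarith
    have e4 : 0 < 1 / R := by positivity
    linarith

end

/-! ### Exponential moments -/

theorem pow_one_add_le_three {R κ : ℝ} {n : ℕ} (hR : 0 < R) (hn : (n : ℝ) ≤ 8 * R) (hκ : 0 ≤ κ)
    (h : 8 * κ ≤ R) : (1 + κ / R ^ 2) ^ n ≤ 3 := by
  calc (1 + κ / R ^ 2) ^ n ≤ Real.exp (κ / R ^ 2) ^ n := by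
        gcongr
        linarith [Real.add_one_le_exp (κ / R ^ 2)]
    _ = Real.exp (n * (κ / R ^ 2)) := (Real.exp_nat_mul _ _).symm
    _ ≤ Real.exp 1 := by
        apply Real.exp_le_exp.2
        calc (n : ℝ) * (κ / R ^ 2) ≤ 8 * R * (κ / R ^ 2) := by gcongr
          _ = 8 * κ / R := by field_simp
          _ ≤ 1 := by rwa [div_le_one hR]
    _ ≤ 3 := by linarith [Real.exp_one_lt_d9]

/-- The function of one block of coefficients that enters the bound for the exponential moment. -/
noncomputable def blockWeight (R : ℝ) (γ : ℝ → ℂ) (a b : ℝ) (c : ℕ → ℂ) : ℝ :=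
  1 + 4 * (R ^ 2) ^ 2 * {c | NearZero R γ a b c}.indicator 1 c +
    24 / R ^ 2 * ((1 + discMajorant c) + (1 + ‖gefSeries c 0‖⁻¹))

theorem measurable_blockWeight (R : ℝ) (γ : ℝ → ℂ) (a b : ℝ) :
    Measurable (blockWeight R γ a b) := by
  have h1 : Measurable ({c | NearZero R γ a b c}.indicator (1 : (ℕ → ℂ) → ℝ)) :=
    measurable_one.indicator (measurableSet_nearZero R γ a b)
  have h2 := measurable_discMajorant
  have h3 : Measurable fun c : ℕ → ℂ => ‖gefSeries c 0‖⁻¹ :=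
    (measurable_gefSeries_apply (fun k => measurable_pi_apply k) 0).norm.inv
  unfold blockWeight
  fun_prop

section
variable {Ω : Type*} [MeasurableSpace Ω] {μ : Measure Ω} {R a b : ℝ} {n : ℕ} {θ : Fin n → ℝ}
  {ζ : ℕ → Ω → ℂ} {ξ : Fin n × ℕ → Ω → ℂ}

/-- The blocks are independent. -/
theorem CoupledFamily.lintegral_prod_blockWeight_le {w : Fin n → ℂ}
    (H : CoupledFamily μ R w ζ ξ) (hR : IsLarge R) (hn : (n : ℝ) ≤ 8 * R) (γ : Fin n → ℝ → ℂ) :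
    ∫⁻ ω, ∏ j, ENNReal.ofReal (blockWeight R (γ j) a b fun k => ξ (j, k) ω) ∂μ ≤ 3 := by
  have := H.std_new.isProbabilityMeasure
  have hR1 := hR.million_le
  have hR0 : 0 < R := by linarith
  have hK0 := discMajorantMean_nonneg
  have hmb : ∀ j, Measurable fun ω (k : ℕ) => ξ (j, k) ω := fun j =>
    measurable_pi_lambda _ fun k => (H.std_block j).measurable k
  have hΨ : ∀ j, Measurable fun c => ENNReal.ofReal (blockWeight R (γ j) a b c) := fun j =>
    ENNReal.measurable_ofReal.comp (measurable_blockWeight R (γ j) a b)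
  rw [lintegral_prod_eq_prod_lintegral_of_indepFun Finset.univ
    (fun j ω => ENNReal.ofReal (blockWeight R (γ j) a b fun k => ξ (j, k) ω))
    (H.std_new.indep_blocks.comp (fun j c => ENNReal.ofReal (blockWeight R (γ j) a b c)) hΨ)
    fun j => (hΨ j).comp (hmb j)]
  have hone : ∀ j, ∫⁻ ω, ENNReal.ofReal (blockWeight R (γ j) a b fun k => ξ (j, k) ω) ∂μ ≤
      ENNReal.ofReal (1 + (4 + 24 * (discMajorantMean + 19)) / R ^ 2) := by
    intro j
    have h1 : MeanLE μ (({c | NearZero R (γ j) a b c}.indicator (1 : (ℕ → ℂ) → ℝ)) ∘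
        fun ω k => ξ (j, k) ω) (R ^ 17)⁻¹ :=
      MeanLE.indicator ((measurableSet_nearZero R (γ j) a b).preimage (hmb j)) (by positivity)
        ((H.std_block j).measure_nearZero_le (by linarith) _ a b)
    have h2 := ((MeanLE.const zero_le_one).add (h1.const_mul (c := 4 * (R ^ 2) ^ 2)
      (by positivity))).add ((((MeanLE.const zero_le_one).add (H.meanLE_discMajorant j)).add
        ((MeanLE.const zero_le_one).add (H.meanLE_inv_norm j))).const_mul (c := 24 / R ^ 2)
          (by positivity))
    refine h2.lintegral_le.trans (ENNReal.ofReal_le_ofReal ?_)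
    have e1 : 4 * (R ^ 2) ^ 2 * (R ^ 17)⁻¹ ≤ 4 / R ^ 2 := by
      rw [div_eq_mul_inv, mul_assoc]
      gcongr
      rw [← div_eq_mul_inv, div_le_iff₀ (by positivity)]
      calc (R ^ 2) ^ 2 = R ^ 4 := by ring
        _ ≤ R ^ 15 := pow_le_pow_right₀ (by linarith) (by norm_num)
        _ = _ := by field_simp
    calc _ ≤ 1 + 4 / R ^ 2 + 24 / R ^ 2 * ((1 + discMajorantMean) + (1 + 17)) := by gcongr
      _ = _ := by ring
  calc _ ≤ ∏ _j : Fin n, ENNReal.ofReal (1 + (4 + 24 * (discMajorantMean + 19)) / R ^ 2) :=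
        Finset.prod_le_prod' fun j _ => hone j
    _ = ENNReal.ofReal ((1 + (4 + 24 * (discMajorantMean + 19)) / R ^ 2) ^ n) := by
        rw [Finset.prod_const, Finset.card_univ, Fintype.card_fin, ENNReal.ofReal_pow (by positivity)]
    _ ≤ ENNReal.ofReal 3 := ENNReal.ofReal_le_ofReal
        (pow_one_add_le_three hR0 hn (by positivity) hR.mean_le)
    _ = 3 := by norm_num

/-- The values of the translates at the centres are triangular combinations. -/
theorem CoupledFamily.lintegral_prod_inv_norm_le {w : Fin n → ℂ}
    (H : CoupledFamily μ R w ζ ξ) (hR : IsLarge R) (hn : (n : ℝ) ≤ 8 * R) :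
    ∫⁻ ω, ∏ j, ENNReal.ofReal
      (1 + 12 / R ^ 2 * (1 + ‖translatedSeries (fun m => ζ m ω) (w j) 0‖⁻¹)) ∂μ ≤ 3 := by
  have hR1 := hR.million_le
  have hR0 : 0 < R := by linarith
  refine (H.lintegral_prod_le (ψ := fun x => ENNReal.ofReal (1 + 12 / R ^ 2 * (1 + ‖x‖⁻¹)))
    (by fun_prop) (C := ENNReal.ofReal (1 + 216 / R ^ 2)) fun s c hs => ?_).trans ?_
  · have h1 : MeanLE stdComplexGaussian (fun x => ‖c + s * x‖⁻¹) 17 :=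
      ⟨by fun_prop, by norm_num, (lintegral_inv_norm_shift_le c s hs).trans (by simp)⟩
    have h2 := (MeanLE.const zero_le_one).add
      (((MeanLE.const zero_le_one).add h1).const_mul (c := 12 / R ^ 2) (by positivity))
    refine h2.lintegral_le.trans (ENNReal.ofReal_le_ofReal (le_of_eq ?_))
    ring
  · rw [← ENNReal.ofReal_pow (by positivity)]
    refine (ENNReal.ofReal_le_ofReal
      (pow_one_add_le_three hR0 hn (by norm_num) (by linarith))).trans (by norm_num)

/-- The pointwise bound on the event that all coefficients are moderate. On this event the translated
function is bounded by one plus the majorant of the coupled function. -/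
theorem CoupledFamily.ae_exp_le (H : CoupledFamily μ R (fun j => circleArc R (θ j) 0) ζ ξ)
    (hR : IsLarge R) (hn : (n : ℝ) ≤ 8 * R) (ha : -1 ≤ a) (ha0 : a ≤ 0) (hb0 : 0 ≤ b)
    (hb : b ≤ 1) : ∀ᵐ ω ∂μ, ω ∈ moderateEvent R ζ ξ →
      Real.exp ((∑ j, |origIncrement R a b ζ θ j ω - newIncrement R a b ξ θ j ω| - 1) / 80) ≤
        ∏ j, blockWeight R (centredArc R (θ j)) a b (fun k => ξ (j, k) ω) +
        ∏ j, (1 + 12 / R ^ 2 *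
          (1 + ‖translatedSeries (fun m => ζ m ω) (circleArc R (θ j) 0) 0‖⁻¹)) := by
  have hR1 := hR.million_le
  have hR0 : 0 < R := by linarith
  filter_upwards [H.ae_regular (by linarith) ha hb,
    ae_all_iff.2 fun j => ((H.std_block j).ae_summable_norm_mul (fun k => by positivity)
      summable_discMajorant_weight).1] with ω h1 h3 hω
  have i1 : ∀ z : ℂ, 1 ≤ 1 + ‖z‖⁻¹ := fun z => by
    have := inv_nonneg.2 (norm_nonneg z)
    linarith
  set v : Fin n → ℝ := fun j =>
    {c | NearZero R (centredArc R (θ j)) a b c}.indicator 1 fun k => ξ (j, k) ω with hv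
  set Y : Fin n → ℝ := fun j => 8 + 5 * (2 * Real.log (1 + discMajorant fun k => ξ (j, k) ω) +
    Real.log (1 + ‖gefSeries (fun k => ξ (j, k) ω) 0‖⁻¹) +
    Real.log (1 + ‖translatedSeries (fun m => ζ m ω) (circleArc R (θ j) 0) 0‖⁻¹)) with hY
  have hv01 : ∀ j, v j = 0 ∨ v j = 1 := fun j => indicator_eq_zero_or_self _ _ _
  have hbound : ∀ j, |origIncrement R a b ζ θ j ω - newIncrement R a b ξ θ j ω| ≤
      2 / R ^ 2 + v j * Y j := by
    intro j
    obtain ⟨d1, d2, n1, n2⟩ := h1 j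
    by_cases hN : NearZero R (centredArc R (θ j)) a b fun k => ξ (j, k) ω
    · have hvj : v j = 1 := indicator_of_mem (s := {c | NearZero R (centredArc R (θ j)) a b c}) hN _
      have hG0 := discMajorant_nonneg fun k => ξ (j, k) ω
      have hinv : (R ^ 22)⁻¹ ≤ 1 := inv_le_one_of_one_le₀ (one_le_pow₀ (by linarith))
      have h2 : 0 ≤ 2 / R ^ 2 := by positivity
      refine (abs_argIncrement_sub_centredArc_le (M := 1 + discMajorant fun k => ξ (j, k) ω)
        (by linarith) ha ha0 hb0 hb d1 d2
        (by linarith) (fun z hz => ?_) (fun z hz => ?_) n1 n2).trans (by rw [hvj]; linarith)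
      · linarith [norm_gefSeries_le_discMajorant (h3 j) hz]
      · have e1 := H.close ω j hω.1 (hω.2 j) z hz
        have e2 := norm_le_norm_add_norm_sub' (translatedSeries (fun m => ζ m ω)
          (circleArc R (θ j) 0) z) (gefSeries (fun k => ξ (j, k) ω) z)
        linarith [norm_gefSeries_le_discMajorant (h3 j) hz]
    · have hvj : v j = 0 :=
        indicator_of_notMem (s := {c | NearZero R (centredArc R (θ j)) a b c}) hN _
      rw [hvj, zero_mul, add_zero]
      exact H.abs_origIncrement_sub_newIncrement_le hR ha (ha0.trans hb0) hb hω d2 hN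
  have hsum : ∑ j, |origIncrement R a b ζ θ j ω - newIncrement R a b ξ θ j ω| - 1 ≤
      ∑ j, v j * Y j := by
    have e1 := Finset.sum_le_sum fun j (_ : j ∈ Finset.univ) => hbound j
    rw [Finset.sum_add_distrib, Finset.sum_const, Finset.card_univ, Fintype.card_fin,
      nsmul_eq_mul] at e1
    have e2 : (n : ℝ) * (2 / R ^ 2) ≤ 1 := by
      calc (n : ℝ) * (2 / R ^ 2) ≤ 8 * R * (2 / R ^ 2) := by gcongr
        _ = 16 / R := by field_simp; norm_num
        _ ≤ 1 := by rw [div_le_one hR0]; linarith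
    linarith
  calc _ ≤ Real.exp (∑ j, v j * Y j / 80) := by
        rw [← Finset.sum_div]
        gcongr
    _ = ∏ j, Real.exp (v j * Y j / 80) := Real.exp_sum _ _
    _ ≤ ∏ j, (1 + v j * Real.exp (Y j / 80)) := by
        refine Finset.prod_le_prod (fun j _ => (Real.exp_pos _).le) fun j _ => ?_
        rcases hv01 j with h | h <;> rw [h]
        · simp
        · simp
    _ ≤ _ := by
        refine prod_one_add_mul_le Finset.univ (x := R ^ 2) (one_le_pow₀ (by linarith))
          (fun j _ => hv01 j) (fun j _ => (Real.exp_pos _).le)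
          (u := fun j => 1 + discMajorant fun k => ξ (j, k) ω)
          (a := fun j => 1 + ‖gefSeries (fun k => ξ (j, k) ω) 0‖⁻¹)
          (t := fun j => 1 + ‖translatedSeries (fun m => ζ m ω) (circleArc R (θ j) 0) 0‖⁻¹)
          (fun j _ => ?_) (fun j _ => i1 _) (fun j _ => i1 _) fun j _ => ?_
        · linarith [discMajorant_nonneg fun k => ξ (j, k) ω]
        · exact exp_sq_le_of_le_log (by linarith [discMajorant_nonneg fun k => ξ (j, k) ω])
            (i1 _) (i1 _) le_rfl

theorem CoupledFamily.measure_sum_ge_le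
    (H : CoupledFamily μ R (fun j => circleArc R (θ j) 0) ζ ξ)
    (hR : IsLarge R) (hn : (n : ℝ) ≤ 8 * R) (ha : -1 ≤ a) (ha0 : a ≤ 0) (hb0 : 0 ≤ b)
    (hb : b ≤ 1) (y : ℝ) :
    μ {ω | y ≤ ∑ j, |origIncrement R a b ζ θ j ω - newIncrement R a b ξ θ j ω|} ≤
      ENNReal.ofReal (Real.exp (-R) + 6 * Real.exp (-((y - 1) / 80))) := by
  have hR1 := hR.million_le
  have hR0 : 0 < R := by linarith
  set A : Ω → ℝ≥0∞ := fun ω =>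
    ∏ j, ENNReal.ofReal (blockWeight R (centredArc R (θ j)) a b fun k => ξ (j, k) ω) with hA
  set B : Ω → ℝ≥0∞ := fun ω => ∏ j, ENNReal.ofReal
    (1 + 12 / R ^ 2 * (1 + ‖translatedSeries (fun m => ζ m ω) (circleArc R (θ j) 0) 0‖⁻¹)) with hB
  have hmb : ∀ j, Measurable fun ω (k : ℕ) => ξ (j, k) ω := fun j =>
    measurable_pi_lambda _ fun k => (H.std_block j).measurable k
  have hAm : Measurable A := Finset.measurable_fun_prod _ fun j _ =>
    ENNReal.measurable_ofReal.comp ((measurable_blockWeight R (centredArc R (θ j)) a b).comp (hmb j))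
  have hBm : Measurable B := Finset.measurable_fun_prod _ fun j _ => by
    have : Measurable fun ω => translatedSeries (fun m => ζ m ω) (circleArc R (θ j) 0) 0 :=
      measurable_tsum_mul_const H.std_orig.measurable _
    fun_prop
  have hint : ∫⁻ ω, (A ω + B ω) ∂μ ≤ 6 := by
    rw [lintegral_add_left hAm]
    calc _ ≤ (3 : ℝ≥0∞) + 3 := add_le_add (H.lintegral_prod_blockWeight_le hR hn _)
          (H.lintegral_prod_inv_norm_le hR hn)
      _ = 6 := by norm_num
  have hmarkov := meas_ge_le_lintegral_div (hAm.add hBm).aemeasurable (μ := μ)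
    (ε := ENNReal.ofReal (Real.exp ((y - 1) / 80)))
    (ENNReal.ofReal_pos.2 (Real.exp_pos _)).ne' ENNReal.ofReal_ne_top
  calc _ ≤ μ ((moderateEvent R ζ ξ)ᶜ ∪
        {ω | ENNReal.ofReal (Real.exp ((y - 1) / 80)) ≤ (A + B) ω}) := by
        refine measure_mono_ae ?_
        filter_upwards [H.ae_exp_le hR hn ha ha0 hb0 hb] with ω hω hy
        by_cases hmod : ω ∈ moderateEvent R ζ ξ
        · right
          have h1 := hω hmod
          have h2 : Real.exp ((y - 1) / 80) ≤ _ := (Real.exp_le_exp.2 (by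
            have : y ≤ _ := hy
            gcongr)).trans h1
          refine (ENNReal.ofReal_le_ofReal h2).trans (ENNReal.ofReal_add_le.trans (le_of_eq ?_))
          have hp : ∀ c, 0 ≤ discMajorant c := discMajorant_nonneg
          rw [ENNReal.ofReal_prod_of_nonneg (fun j _ => by
              have := hp fun k => ξ (j, k) ω
              have : (0 : ℝ) ≤ {c | NearZero R (centredArc R (θ j)) a b c}.indicator 1
                (fun k => ξ (j, k) ω) := indicator_nonneg (by simp) _
              rw [blockWeight]
              positivity),
            ENNReal.ofReal_prod_of_nonneg (fun j _ => by positivity)]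
          rfl
        · exact Or.inl hmod
    _ ≤ μ (moderateEvent R ζ ξ)ᶜ +
        μ {ω | ENNReal.ofReal (Real.exp ((y - 1) / 80)) ≤ (A + B) ω} := measure_union_le _ _
    _ ≤ ENNReal.ofReal (Real.exp (-R)) + ENNReal.ofReal (6 * Real.exp (-((y - 1) / 80))) := by
        gcongr
        · refine (H.measure_compl_moderateEvent_le (by linarith)).trans
            (ENNReal.ofReal_le_ofReal (le_trans ?_ hR.tail_le))
          gcongr
        · refine hmarkov.trans ((ENNReal.div_le_div_right hint _).trans (le_of_eq ?_))
          rw [Real.exp_neg, ← div_eq_mul_inv, ENNReal.ofReal_div_of_pos (Real.exp_pos _)]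
          norm_num
    _ = _ := (ENNReal.ofReal_add (by positivity) (by positivity)).symm

end

/-! ### Deviations of the increments -/

/-- The variables of a Gaussian entire function may be taken measurable. -/
theorem IsGEF.exists_isStdFamily {Ω : Type*} [MeasurableSpace Ω] {μ : Measure Ω} {f : Ω → ℂ → ℂ}
    (hf : IsGEF μ f) : ∃ ζ : ℕ → Ω → ℂ, IsStdFamily μ ζ ∧
      ∀ᵐ ω ∂μ, ∀ z, f ω z = gefSeries (fun k => ζ k ω) z := by
  obtain ⟨X, hX, hind, hsum⟩ := hf
  have hae : ∀ k, X k =ᵐ[μ] (hX k).aemeasurable.mk (X k) := fun k => (hX k).aemeasurable.ae_eq_mk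
  refine ⟨fun k => (hX k).aemeasurable.mk (X k), ⟨fun k => (hX k).aemeasurable.measurable_mk,
    fun k => ?_, hind.congr hae⟩, ?_⟩
  · rw [← Measure.map_congr (hae k)]
    exact (hX k).map_eq
  · filter_upwards [hsum, ae_all_iff.2 hae] with ω h1 h2 z
    rw [← (h1 z).tsum_eq, gefSeries]
    exact tsum_congr fun k => by rw [h2 k]; rfl

section
variable {Ω : Type*} [MeasurableSpace Ω] {μ : Measure Ω} {R a b : ℝ} {n : ℕ} {θ : Fin n → ℝ}
  {ζ : ℕ → Ω → ℂ} {ξ : Fin n × ℕ → Ω → ℂ}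

theorem IsStdFamily.aemeasurable_curveArgIncrement (hζ : IsStdFamily μ ζ) {F : Ω → ℂ → ℂ}
    (hF : ∀ᵐ ω ∂μ, ∀ z, F ω z = gefSeries (fun k => ζ k ω) z) {γ : ℝ → ℂ} (hab : a ≤ b)
    (hγ : Continuous γ) (h0 : ∀ᵐ ω ∂μ, ∀ t ∈ Icc a b, gefSeries (fun k => ζ k ω) (γ t) ≠ 0) :
    AEMeasurable (curveArgIncrement F γ a b) μ := by
  refine _root_.aemeasurable_curveArgIncrement hab (fun z => ?_) ?_ ?_
  · refine ⟨fun ω => gefSeries (fun k => ζ k ω) z, measurable_gefSeries_apply hζ.measurable z, ?_⟩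
    filter_upwards [hF] with ω hω
    exact hω z
  · filter_upwards [hF, hζ.ae_differentiable_gefSeries] with ω h1 h2
    simp only [h1]
    exact (h2.continuous.comp hγ).continuousOn
  · filter_upwards [hF, h0] with ω h1 h2
    simpa only [h1] using h2

/-- The translated function differs from the original one by a nonvanishing deterministic factor, so
that the increments of the argument differ by a constant. -/
theorem IsStdFamily.ae_curveArgIncrement_circleArc (hζ : IsStdFamily μ ζ) {F : Ω → ℂ → ℂ}
    (hF : ∀ᵐ ω ∂μ, ∀ z, F ω z = gefSeries (fun k => ζ k ω) z) (hR : 1 ≤ R) (hab : a ≤ b)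
    (j : Fin n) : ∃ κ : ℝ, ∀ᵐ ω ∂μ, origIncrement R a b ζ θ j ω =
      curveArgIncrement F (circleArc R (θ j)) a b ω + κ := by
  set φ : ℝ → ℂ := fun t => -centredArc R (θ j) t * (starRingEnd ℂ) (circleArc R (θ j) 0) -
    (‖circleArc R (θ j) 0‖ ^ 2 / 2 : ℝ) with hφ
  refine ⟨(φ b).im - (φ a).im, ?_⟩
  filter_upwards [hF, hζ.ae_differentiable_gefSeries,
    hζ.ae_gefSeries_circleArc_ne_zero (a := a) (b := b) hR (θ j)] with ω h1 h2 h3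
  have hφc : Continuous φ := by
    have := continuous_centredArc R (θ j)
    fun_prop
  have h := argIncrement_mul_exp hab
    (h := fun t => gefSeries (fun k => ζ k ω) (circleArc R (θ j) t))
    (h2.continuous.comp (continuous_circleArc R (θ j))).continuousOn h3 hφc.continuousOn
  rw [origIncrement, curveArgIncrement]
  simp only [translatedSeries_eq, circleArc_zero_add_centredArc, h1]
  exact h

end

theorem exp_neg_add_le {R Λ : ℝ} (hR : 1000000 ≤ R) (h1 : 3 * Real.sqrt R ≤ Λ) (h2 : Λ ≤ R) :
    Real.exp (-R) + 6 * Real.exp (-((Λ - 8 - 1) / 80)) ≤ Real.exp (-(1 / 160) * Λ) := by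
  have hs : 1000 ≤ Real.sqrt R := Real.le_sqrt_of_sq_le (by linarith)
  have hΛ : 3000 ≤ Λ := by linarith
  have e1 : Real.exp (-R) ≤ Real.exp (-(Λ / 80)) := Real.exp_le_exp.2 (by linarith)
  have e2 : Real.exp (-((Λ - 8 - 1) / 80)) ≤ 2 * Real.exp (-(Λ / 80)) := by
    have e3 : Real.exp (9 / 80) ≤ 2 := by
      have h3 : Real.exp (9 / 80) ^ 5 ≤ 2 ^ 5 := by
        rw [← Real.exp_nat_mul]
        have := Real.exp_one_lt_d9
        have : Real.exp ((5 : ℕ) * (9 / 80)) ≤ Real.exp 1 := Real.exp_le_exp.2 (by norm_num)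
        linarith
      exact le_of_pow_le_pow_left₀ (by norm_num) (by norm_num) h3
    calc _ = Real.exp (9 / 80) * Real.exp (-(Λ / 80)) := by rw [← Real.exp_add]; congr 1; ring
      _ ≤ _ := by gcongr
  have e4 : 13 ≤ Real.exp (Λ / 160) := by linarith [Real.add_one_le_exp (Λ / 160)]
  calc _ ≤ 13 * Real.exp (-(Λ / 80)) := by linarith
    _ ≤ Real.exp (Λ / 160) * Real.exp (-(Λ / 80)) := by gcongr
    _ = _ := by rw [← Real.exp_add]; congr 1; ring

theorem lemma3p3 :
    ∃ b₂ : ℝ, 0 < b₂ ∧ ∃ R₀ : ℝ, 0 < R₀ ∧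
      ∀ R : ℝ, R₀ ≤ R → ∀ r : ℝ, 1 ≤ r → r ≤ 2 →
      ∀ Λ : ℝ, 3 * Real.sqrt R ≤ Λ → Λ ≤ R →
      ∀ (n : ℕ) (θ : Fin n → ℝ),
        (∀ j k, j ≠ k →
          Disjoint (circleArc R (θ j) '' Icc (-(r / 2)) (r / 2))
            (circleArc R (θ k) '' Icc (-(r / 2)) (r / 2))) →
        ArcsSeparated R r (Real.log R) θ →
      ∀ (Ω : Type*) [MeasurableSpace Ω] (μ : Measure Ω) [IsProbabilityMeasure μ]
        (f : Ω → ℂ → ℂ), IsGEF μ f →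
      ∃ g : Fin n → Ω → ℂ → ℂ,
        (∀ j, IsGEF μ (g j)) ∧
        iIndepFun g μ ∧
        (∀ j, HasArgDeviation μ f (circleArc R (θ j)) (-(r / 2)) (r / 2) ∧
          HasArgDeviation μ (g j) (centredArc R (θ j)) (-(r / 2)) (r / 2)) ∧
        μ {ω | Λ ≤ |∑ j, argDeviation μ f (circleArc R (θ j)) (-(r / 2)) (r / 2) ω -
              ∑ j, argDeviation μ (g j) (centredArc R (θ j)) (-(r / 2)) (r / 2) ω|}
          ≤ ENNReal.ofReal (Real.exp (-b₂ * Λ)) := by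
  obtain ⟨R₁, hR₁⟩ := Filter.eventually_atTop.1 (eventually_exists_coupling.and eventually_isLarge)
  -- `8` bounds the sum of the means; the exponential moment `1 / 80` is halved to absorb the constants
  refine ⟨1 / 160, by norm_num, max R₁ 1, by positivity, fun R hRR r hr1 hr2 Λ hΛ1 hΛ2 n θ _ hsep
    Ω _ μ _ f hf => ?_⟩
  obtain ⟨hcoup, hR⟩ := hR₁ R ((le_max_left _ _).trans hRR)
  have hRm := hR.million_le
  have hR0 : 0 < R := by linarith
  set a := -(r / 2) with ha_def
  set b := r / 2 with hb_def
  have ha : -1 ≤ a := by linarith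
  have ha0 : a ≤ 0 := by linarith
  have hb0 : 0 ≤ b := by linarith
  have hb : b ≤ 1 := by linarith
  have hab : a ≤ b := ha0.trans hb0
  have hlog : 1 ≤ Real.log R := by
    rw [Real.le_log_iff_exp_le hR0]
    linarith [Real.exp_one_lt_d9]
  have hn := card_le_of_arcsSeparated (by linarith) (by linarith) hlog hsep
  obtain ⟨D, N, e, hC⟩ := hcoup n (fun j => circleArc R (θ j) 0) hn
    (fun j => norm_circleArc hR0 (θ j) 0)
    (fun j k hjk => chord_le_of_arcsSeparated hR0 (by linarith) hsep hjk)
  obtain ⟨ζ, hζ, hfζ⟩ := hf.exists_isStdFamily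
  obtain ⟨ξ, H⟩ := hC.exists_coupledFamily hζ
  have hgae : ∀ j, ∀ᵐ ω ∂μ, ∀ z, gefSeries (fun k => ξ (j, k) ω) z =
      gefSeries (fun k => ξ (j, k) ω) z := fun j => Filter.Eventually.of_forall fun _ _ => rfl
  have hfm : ∀ j, AEMeasurable (curveArgIncrement f (circleArc R (θ j)) a b) μ := fun j =>
    hζ.aemeasurable_curveArgIncrement hfζ hab (continuous_circleArc R (θ j))
      (hζ.ae_gefSeries_circleArc_ne_zero (by linarith) (θ j))
  have hgm : ∀ j, AEMeasurable (newIncrement R a b ξ θ j) μ := fun j =>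
    (H.std_block j).aemeasurable_curveArgIncrement (hgae j) hab (continuous_centredArc R (θ j))
      ((H.std_block j).ae_gefSeries_centredArc_ne_zero hR0 ha hb (θ j))
  choose κ hκ using fun j => hζ.ae_curveArgIncrement_circleArc (R := R) (θ := θ) hfζ (by linarith) hab j
  have hTm : ∀ j, AEMeasurable (origIncrement R a b ζ θ j) μ := fun j =>
    ((hfm j).add_const (κ j)).congr (by filter_upwards [hκ j] with ω hω using hω.symm)
  have hmean := fun j => H.abs_integral_sub_le hR hn ha ha0 hb0 hb j (hTm j) (hgm j)
  have hfint : ∀ j, Integrable (curveArgIncrement f (circleArc R (θ j)) a b) μ := fun j =>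
    ((hmean j).1.sub (integrable_const (κ j))).congr (by
      filter_upwards [hκ j] with ω hω
      simp [hω])
  refine ⟨fun j ω => gefSeries fun k => ξ (j, k) ω, fun j => (H.std_block j).isGEF, ?_,
    fun j => ⟨⟨?_, hfint j⟩, (H.std_block j).ae_gefSeries_centredArc_ne_zero hR0 ha hb (θ j),
      (hmean j).2.1⟩, ?_⟩
  · exact H.std_new.indep_blocks.comp (fun _ => gefSeries) fun _ => measurable_pi_lambda _ fun z =>
      measurable_gefSeries_apply (fun k => measurable_pi_apply k) z
  · filter_upwards [hfζ, hζ.ae_gefSeries_circleArc_ne_zero (a := a) (b := b) (R := R)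
      (by linarith) (θ j)] with ω h1 h2
    simpa only [h1] using h2
  have hdev : ∀ᵐ ω ∂μ, ∀ j, argDeviation μ f (circleArc R (θ j)) a b ω -
      argDeviation μ (fun ω => gefSeries fun k => ξ (j, k) ω) (centredArc R (θ j)) a b ω =
        (origIncrement R a b ζ θ j ω - newIncrement R a b ξ θ j ω) -
          ∫ ω', (origIncrement R a b ζ θ j ω' - newIncrement R a b ξ θ j ω') ∂μ := by
    filter_upwards [ae_all_iff.2 hκ] with ω hω j
    rw [integral_sub (hmean j).1 (hmean j).2.1, integral_congr_ae (hκ j),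
      integral_add (hfint j) (integrable_const _), hω j, argDeviation, argDeviation]
    simp only [integral_const, probReal_univ, one_smul]
    have e1 : ∀ ω, curveArgIncrement (fun ω => gefSeries fun k => ξ (j, k) ω)
      (centredArc R (θ j)) a b ω = newIncrement R a b ξ θ j ω := fun _ => rfl
    simp only [e1]
    ring
  refine le_trans (measure_mono_ae ?_) ((H.measure_sum_ge_le hR hn ha ha0 hb0 hb (Λ - 8)).trans
    (ENNReal.ofReal_le_ofReal (exp_neg_add_le hRm hΛ1 hΛ2)))
  filter_upwards [hdev] with ω hω hΛ
  have h1 : Λ ≤ _ := hΛ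
  rw [← Finset.sum_sub_distrib, Finset.sum_congr rfl fun j _ => hω j] at h1
  have h2 : ∑ _j : Fin n, 1 / R ≤ 8 := by
    rw [Finset.sum_const, Finset.card_univ, Fintype.card_fin, nsmul_eq_mul, mul_one_div,
      div_le_iff₀ hR0]
    exact hn
  have h3 := h1.trans ((Finset.abs_sum_le_sum_abs _ _).trans (Finset.sum_le_sum fun j _ =>
    (abs_sub _ _).trans (add_le_add_right (hmean j).2.2 _)))
  rw [Finset.sum_add_distrib] at h3
  show Λ - 8 ≤ _
  linarith
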